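/- **Setting.** Let $\mathcal N=\{1,\dots,N\}$ be a set of arms, $T>1$ and $m\in(0,N]$ integers, and $\eta>0$. Arm $i$ has a weight $w_i\ge 0$ and a mean $u_i\in[0,1]$; put $w_{\max}=\max_i w_i$ and assume $w_{\max}>0$. Let $P_Z$ be a probability distribution on the subsets of $\mathcal N$ and $\mathbf k=(k_1,\dots,k_N)\in\mathbb R^N$. In each round $t=0,\dots,T-1$ an availability set $Z(t)\subseteq\mathcal N$ is drawn from $P_Z$ and rewards $X_i(t)\in\{0,1\}$ are drawn from Bernoulli distributions with means $u_i$, all of them independent of each other and over the rounds. A policy pulls a set $A(t)\subseteq Z(t)$ with $|A(t)|\le m$ and observes $X_i(t)$ for $i\in A(t)$. **Optimal policy.** Assume that $\mathbf k$ is feasible, i.e. that the following linear program has a solution, and let $\mathbf q^*=(q^*_S(A))$ be an optimal one: $$\max_{\mathbf q}\ \sum_{S\subseteq\mathcal N}P_Z(S)\sum_{A\subseteq S,\,|A|\le m}q_S(A)\sum_{i\in A}w_iu_i$$ subject to $\sum_{S}P_Z(S)\sum_{A\subseteq S,\,|A|\le m,\,i\in A}q_S(A)\ge k_i$ for all $i$,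 $\ \sum_{A\subseteq S,\,|A|\le m}q_S(A)=1$ for all $S$, and $q_S(A)\in[0,1]$. The optimal policy pulls in round $t$ a set $A^*(t)$ which, given the past and $Z(t)$, equals $A$ with probability $q^*_{Z(t)}(A)$, and which, like $A(t)$, does not depend on the rewards of round $t$. **Algorithm TSCSF-B.** Start with $\alpha_i(0)=\beta_i(0)=1$. In round $t$, after observing $Z(t)$, draw independent samples $\theta_i(t)\sim\mathrm{Beta}(\alpha_i(t),\beta_i(t))$ for $i\in Z(t)$ and pull $$A(t)\in\operatorname*{argmax}_{A\subseteq Z(t),\,|A|\le m}\ \sum_{i\in A}\Bigl(\tfrac1\eta Q_i(t)+w_i\theta_i(t)\Bigr),\qquad Q_i(t)=\max\Bigl\{t\,k_i-\sum_{\tau=0}^{t-1}\mathbf 1[i\in A(\tau)],\,0\Bigr\},$$ where ties are broken by any rule that does not look into the future. For $i\in A(t)$ put $\alpha_i(t+1)=\alpha_i(t)+X_i(t)$ and $\beta_i(t+1)=\beta_i(t)+1-X_i(t)$; the other parameters do not change. **Theorem.** The time-averaged regret $$\mathcal R(T)=\mathbb E\left[\frac1T\sum_{t=0}^{T-1}\Bigl(\sum_{i\in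 A^*(t)}w_iX_i(t)-\sum_{i\in A(t)}w_iX_i(t)\Bigr)\right]$$ of TSCSF-B satisfies $$\mathcal R(T)\le\frac{N}{2\eta}+\frac{4w_{\max}\sqrt{mNT\ln T}+2.51\,w_{\max}N}{T}.$$ -/

import Mathlib

open MeasureTheory ProbabilityTheory

noncomputable section

namespace CSMABF

/-! Arms are the elements of `Fin N`. A trajectory consists of the availability sets `Z t`, the
samples `θ t i`, the pulled sets `A t` and the rewards `X t i ∈ {0, 1}` (coded by `Bool`). -/

variable {N : ℕ}

/-- The sets of arms that may be pulled when `S` is the set of available arms: the subsets of `S`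
with at most `m` elements. -/
def admissible (m : ℕ) (S : Finset (Fin N)) : Finset (Finset (Fin N)) :=
  S.powerset.filter (fun B => B.card ≤ m)

/-! ### The optimal stationary randomized policy -/

/-- The expected weighted reward per round of the randomized policy that pulls `B` with probability
`q S B` when `S` is the set of available arms. -/
def policyValue (PZ : PMF (Finset (Fin N))) (m : ℕ) (w u : Fin N → ℝ)
    (q : Finset (Fin N) → Finset (Fin N) → ℝ) : ℝ :=
  ∑ S, (PZ S).toReal * ∑ B ∈ admissible m S, q S B * ∑ i ∈ B, w i * u i

/-- The constraints on `q`: the pulling probability of each arm `i` is at least `k i`, and `q S` is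
a probability vector on the admissible subsets of `S`, for every `S`. -/
structure IsFeasiblePolicy (PZ : PMF (Finset (Fin N))) (m : ℕ) (k : Fin N → ℝ)
    (q : Finset (Fin N) → Finset (Fin N) → ℝ) : Prop where
  fair : ∀ i, k i ≤
    ∑ S, (PZ S).toReal * ∑ B ∈ (admissible m S).filter (fun B => i ∈ B), q S B
  sum_eq_one : ∀ S, ∑ B ∈ admissible m S, q S B = 1
  mem_Icc : ∀ S, ∀ B ∈ admissible m S, q S B ∈ Set.Icc (0 : ℝ) 1

/-- `q` is an optimal solution of the linear program that maximizes the expected weighted reward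
under the fairness constraints. -/
def IsOptimalPolicy (PZ : PMF (Finset (Fin N))) (m : ℕ) (k w u : Fin N → ℝ)
    (q : Finset (Fin N) → Finset (Fin N) → ℝ) : Prop :=
  IsFeasiblePolicy PZ m k q ∧
    ∀ q', IsFeasiblePolicy PZ m k q' → policyValue PZ m w u q' ≤ policyValue PZ m w u q

/-! ### The state of the algorithm, along one trajectory -/

/-- First posterior parameter of arm `i`: it starts at `1` and is increased by the reward of `i` in
each round in which `i` is pulled. -/
def alphaParam (A : ℕ → Finset (Fin N)) (X : ℕ → Fin N → Bool) (i : Fin N) : ℕ → ℕ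
  | 0 => 1
  | t + 1 => alphaParam A X i t + if i ∈ A t then (X t i).toNat else 0

/-- Second posterior parameter of arm `i`: it starts at `1` and is increased by one minus the reward
of `i` in each round in which `i` is pulled. -/
def betaParam (A : ℕ → Finset (Fin N)) (X : ℕ → Fin N → Bool) (i : Fin N) : ℕ → ℕ
  | 0 => 1
  | t + 1 => betaParam A X i t + if i ∈ A t then 1 - (X t i).toNat else 0

/-- The virtual queue of arm `i` at the beginning of round `t`. -/
def queue (k : Fin N → ℝ) (A : ℕ → Finset (Fin N)) (i : Fin N) (t : ℕ) : ℝ :=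
  max ((t : ℝ) * k i - ∑ τ ∈ Finset.range t, if i ∈ A τ then (1 : ℝ) else 0) 0

/-- The quantity that the algorithm maximizes over the sets `B` that it may pull, for the queue
lengths `Q` and the samples `s`. -/
def indexSum (η : ℝ) (w Q s : Fin N → ℝ) (B : Finset (Fin N)) : ℝ :=
  ∑ i ∈ B, (1 / η * Q i + w i * s i)

/-! ### The random processes -/

variable {Ω : Type*} [mΩ : MeasurableSpace Ω]

/-- A run of TSCSF-B for `T` rounds, together with the optimal policy `q`, on a probability space.

`ℱ t` is the information that is present at the beginning of round `t`; it contains the past of all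
processes, and possibly further randomness that is used to break ties in the choice of `A t`.
In round `t`, `Z t` is drawn from `PZ`; then independent samples `θ t i`, `i ∈ Z t`, are drawn from
the current beta posteriors; `A t` is any maximizer; `Astar t` is drawn from `q (Z t)`; and the
rewards are independent Bernoulli variables with means `u i`, independent of everything before. -/
structure IsRun (P : Measure Ω) (ℱ : Filtration ℕ mΩ) (T m : ℕ) (η : ℝ)
    (PZ : PMF (Finset (Fin N))) (k w u : Fin N → ℝ)
    (q : Finset (Fin N) → Finset (Fin N) → ℝ)
    (Z : ℕ → Ω → Finset (Fin N)) (θ : ℕ → Ω → Fin N → ℝ) (A : ℕ → Ω → Finset (Fin N))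
    (X : ℕ → Ω → Fin N → Bool) (Astar : ℕ → Ω → Finset (Fin N)) : Prop where
  measurable_Z : ∀ t < T, Measurable[ℱ (t + 1)] (Z t)
  measurable_θ : ∀ t < T, Measurable[ℱ (t + 1)] (θ t)
  measurable_A : ∀ t < T, Measurable[ℱ (t + 1)] (A t)
  measurable_X : ∀ t < T, Measurable[ℱ (t + 1)] (X t)
  measurable_Astar : ∀ t < T, Measurable[ℱ (t + 1)] (Astar t)
  /-- Given the past, the availability set has distribution `PZ`. -/
  law_Z : ∀ t < T, ∀ S : Finset (Fin N),
    P⟦{ω | Z t ω = S} | ℱ t⟧ =ᵐ[P] fun _ => (PZ S).toReal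
  /-- Given the past and the available arms, the samples of the available arms are independent, and
  that of arm `i` has the beta distribution with the current parameters of `i`. -/
  law_θ : ∀ t < T, ∀ b : Fin N → Set ℝ, (∀ i, MeasurableSet (b i)) →
    P⟦{ω | ∀ i ∈ Z t ω, θ t ω i ∈ b i} | ℱ t ⊔ MeasurableSpace.comap (Z t) inferInstance⟧
      =ᵐ[P] fun ω => ∏ i ∈ Z t ω,
        (betaMeasure (alphaParam (fun τ => A τ ω) (fun τ => X τ ω) i t : ℝ)
          (betaParam (fun τ => A τ ω) (fun τ => X τ ω) i t : ℝ)).real (b i)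
  /-- The pulled set is admissible and maximizes the index sum over the admissible sets. -/
  A_mem : ∀ t < T, ∀ ω, A t ω ∈ admissible m (Z t ω)
  A_max : ∀ t < T, ∀ ω, ∀ B ∈ admissible m (Z t ω),
    indexSum η w (fun i => queue k (fun τ => A τ ω) i t) (θ t ω) B ≤
      indexSum η w (fun i => queue k (fun τ => A τ ω) i t) (θ t ω) (A t ω)
  /-- Given the past and the available arms, the optimal policy pulls `B` with probability
  `q (Z t) B`. -/
  law_Astar : ∀ t < T, ∀ B : Finset (Fin N),
    P⟦{ω | Astar t ω = B} | ℱ t ⊔ MeasurableSpace.comap (Z t) inferInstance⟧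
      =ᵐ[P] fun ω => if B ∈ admissible m (Z t ω) then q (Z t ω) B else 0
  /-- Given the past and the availability set, samples and pulled sets of the round, the rewards of
  the arms are independent, and that of arm `i` is Bernoulli with mean `u i`. -/
  law_X : ∀ t < T, ∀ x : Fin N → Bool,
    P⟦{ω | X t ω = x} | ℱ t ⊔ MeasurableSpace.comap
        (fun ω => (Z t ω, θ t ω, A t ω, Astar t ω)) inferInstance⟧
      =ᵐ[P] fun _ => ∏ i, if x i then u i else 1 - u i

/-- The weighted reward that is received in a round with rewards `x` by pulling the set `B`. -/
def reward (w : Fin N → ℝ) (x : Fin N → Bool) (B : Finset (Fin N)) : ℝ :=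
  ∑ i ∈ B, w i * ((x i).toNat : ℝ)

/-- The time-averaged regret over `T` rounds. -/
def regret (P : Measure Ω) (T : ℕ) (w : Fin N → ℝ) (A : ℕ → Ω → Finset (Fin N))
    (X : ℕ → Ω → Fin N → Bool) (Astar : ℕ → Ω → Finset (Fin N)) : ℝ :=
  ∫ ω, (1 / (T : ℝ)) * ∑ t ∈ Finset.range T,
    (reward w (X t ω) (Astar t ω) - reward w (X t ω) (A t ω)) ∂P

end CSMABF

end

/-!
Let `L = log T`. The regret compares the algorithm with the probabilities `pullProb` with which the
stationary policy pulls the arms, and the randomness of `Astar` plays no other role.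

**Drift.** Add `queue / η` to the expected reward `w u` of each arm; this is its `trueIndex`. The
sum of the squared queues is a Lyapunov function, and the stationary policy serves every queue on
average. Hence, up to `N T / (2 η)`, the total regret is the total loss of the pulled sets against
the stationary policy in terms of true indices (`mul_regret_le_drift`).

**Exchange.** The algorithm maximizes the sum of the indices, which have the sample `θ` in place of
the mean `u`. An available arm `i` is pulled if its index exceeds a `threshold` that depends only
on the indices of the *other* arms, and is not pulled if its index is below it. The loss of a round
is at most the sum of two parts (`sum_sub_sum_le_of_maximizer`): the amounts by which the true
indices of arms that are not pulled exceed their thresholds, and the amounts by which the samples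
of pulled arms exceed their means.

**Underestimation.** Fix an arm with mean `u`, and condition on the history and on the samples of
the other arms. The threshold becomes a constant, in terms of samples some `c`, while the sample is
still beta distributed. The loss `u - c - ε` is paid when the sample is below `c`, and it is charged
to the event that it is above `c`, in which the arm is pulled. The price is the loss times the odds
`Beta (Iic c) / Beta (Ioi c)`. By Cauchy--Schwarz it is at most a double integral of likelihood
ratios of `y` against `v` over `y < v < u` that does not depend on `c` any more, the `potential`
(`ofReal_mul_betaMeasure_Iic_le`). Each likelihood ratio decreases geometrically in expectation with
every pull, so that its sum over all pulls is at most `min T (1 / (4 (v - y) (u - v)))`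
(`sum_integral_lik_ratio_le`), and the integral of this bound is `O((1 + L) / ε)`. There is no
union bound and no loss of a further logarithm.

**Overestimation.** The posterior with `n` observations exceeds the empirical mean by more than
about `√(L / (2 n))` with probability at most `1 / T`, because beta tails are binomial distribution
functions, to which Chernoff's bound applies (`betaMeasure_Ioi_le`). Over the pulls, the widths add
up to `√2 * √(m N T L)`. The deviation of the empirical mean is not estimated uniformly in `n`: the
expected sum of its squares over the pulls of an arm is at most `(1 + L) / 4`, by a telescoping
argument (`sum_integral_sq_dev_le`).

The constant `4` comes from the choice of the resolutions `ε` for under- and `ε'` for overestimation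
when `L ≥ 4`. For `L < 4` the bound holds because it exceeds the largest reward that can be lost.
-/

noncomputable section

namespace CSMABF

open Set
open scoped ENNReal

variable {N : ℕ}

/-! ### Likelihoods and the exploration potential -/

/-- The likelihood of a success probability `v` after `s` successes and `f` failures. -/
def lik (s f : ℕ) (v : ℝ) : ℝ := v ^ s * (1 - v) ^ f

lemma lik_pos (s f : ℕ) {v : ℝ} (h0 : 0 < v) (h1 : v < 1) : 0 < lik s f v :=
  mul_pos (pow_pos h0 _) (pow_pos (sub_pos.2 h1) _)

@[fun_prop]
lemma measurable_lik (s f : ℕ) : Measurable (lik s f) := by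
  unfold lik; fun_prop

lemma continuous_lik (s f : ℕ) : Continuous (lik s f) := by
  unfold lik; fun_prop

lemma betaMeasure_apply (s f : ℕ) {E : Set ℝ} (hE : MeasurableSet E) :
    betaMeasure ((s + 1 : ℕ) : ℝ) ((f + 1 : ℕ) : ℝ) E =
      ENNReal.ofReal (1 / beta ((s + 1 : ℕ) : ℝ) ((f + 1 : ℕ) : ℝ)) *
        ∫⁻ v in E ∩ Ioo 0 1, ENNReal.ofReal (lik s f v) := by
  have hpos : 0 ≤ 1 / beta ((s + 1 : ℕ) : ℝ) ((f + 1 : ℕ) : ℝ) :=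
    (one_div_pos.2 (beta_pos (by positivity) (by positivity))).le
  rw [betaMeasure, withDensity_apply _ hE, ← lintegral_const_mul _ (by fun_prop),
    inter_comm, ← Measure.restrict_restrict measurableSet_Ioo,
    ← lintegral_indicator measurableSet_Ioo]
  congr 1
  ext v
  by_cases hv : v ∈ Ioo (0 : ℝ) 1
  · rw [indicator_of_mem hv, betaPDF_of_pos_lt_one hv.1 hv.2, ← ENNReal.ofReal_mul hpos]
    simp [lik, mul_assoc, Real.rpow_natCast]
  · rw [indicator_of_notMem hv, betaPDF_eq, if_neg (by simpa using hv)]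
    simp

/-- Cauchy--Schwarz, applied to `1 = ∫ g = ∫ √lik * (g / √lik)` for a density `g`. This bounds the
likelihood mass above `c` from below in terms of the reciprocal likelihood on `(c, u)`. The density
is the triangular one, `g v = 2 (u - v) / (u - c) ^ 2`. It vanishes at `u`, which later cancels a
singularity there. -/
lemma one_le_lintegral_lik_mul (s f : ℕ) {c u : ℝ} (hc : 0 < c) (hcu : c < u) (hu : u ≤ 1) :
    1 ≤ (∫⁻ v in Ioo c 1, ENNReal.ofReal (lik s f v)) *
      ∫⁻ v in Ioo c u, ENNReal.ofReal ((2 * (u - v) / (u - c) ^ 2) ^ 2 / lik s f v) := by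
  have hD : 0 < u - c := sub_pos.2 hcu
  have hone : ∫⁻ v in Ioo c u, ENNReal.ofReal (2 * (u - v) / (u - c) ^ 2) = 1 := by
    rw [← ofReal_integral_eq_lintegral_ofReal]
    · rw [← integral_Ioc_eq_integral_Ioo, ← intervalIntegral.integral_of_le hcu.le]
      have : ∀ v ∈ uIcc c u, HasDerivAt (fun v => -((u - v) / (u - c)) ^ 2)
          (2 * (u - v) / (u - c) ^ 2) v := by
        intro v _
        have := ((((hasDerivAt_id v).const_sub u).div_const (u - c)).pow 2).neg
        convert! this using 1
        simp; field_simp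
      rw [intervalIntegral.integral_eq_sub_of_hasDerivAt this
        (Continuous.intervalIntegrable (by fun_prop) _ _)]
      simp [hD.ne']
    · exact ((Continuous.intervalIntegrable (by fun_prop) c u).1).mono_set Ioo_subset_Ioc_self
    · refine (ae_restrict_iff' measurableSet_Ioo).2 (.of_forall fun v hv => ?_)
      have := hv.2
      have : 0 ≤ u - v := by linarith
      positivity
  have hprod : ∫⁻ v in Ioo c u, ENNReal.ofReal (2 * (u - v) / (u - c) ^ 2) =
      ∫⁻ v in Ioo c u, ((fun v => ENNReal.ofReal (Real.sqrt (lik s f v))) *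
        fun v => ENNReal.ofReal (2 * (u - v) / (u - c) ^ 2 / Real.sqrt (lik s f v))) v := by
    refine setLIntegral_congr_fun measurableSet_Ioo fun v hv => ?_
    have hl := lik_pos s f (hc.trans hv.1) (hv.2.trans_le hu)
    have hs := Real.sqrt_pos.2 hl
    simp only [Pi.mul_apply]
    rw [← ENNReal.ofReal_mul hs.le]
    congr 1
    field_simp
  have hcs := ENNReal.lintegral_mul_le_Lp_mul_Lq (volume.restrict (Ioo c u))
    (Real.HolderConjugate.two_two)
    (f := fun v => ENNReal.ofReal (Real.sqrt (lik s f v)))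
    (g := fun v => ENNReal.ofReal (2 * (u - v) / (u - c) ^ 2 / Real.sqrt (lik s f v)))
    (by fun_prop) (by fun_prop)
  rw [← hprod, hone] at hcs
  have h1 : ∫⁻ v in Ioo c u, (ENNReal.ofReal (Real.sqrt (lik s f v))) ^ (2 : ℝ) =
      ∫⁻ v in Ioo c u, ENNReal.ofReal (lik s f v) := by
    refine setLIntegral_congr_fun measurableSet_Ioo fun v hv => ?_
    have hl := lik_pos s f (hc.trans hv.1) (hv.2.trans_le hu)
    rw [ENNReal.ofReal_rpow_of_nonneg (Real.sqrt_nonneg _) (by norm_num)]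
    simp [Real.sq_sqrt hl.le]
  have h2 : ∫⁻ v in Ioo c u, (ENNReal.ofReal (2 * (u - v) / (u - c) ^ 2 /
      Real.sqrt (lik s f v))) ^ (2 : ℝ) =
      ∫⁻ v in Ioo c u, ENNReal.ofReal ((2 * (u - v) / (u - c) ^ 2) ^ 2 / lik s f v) := by
    refine setLIntegral_congr_fun measurableSet_Ioo fun v hv => ?_
    have hl := lik_pos s f (hc.trans hv.1) (hv.2.trans_le hu)
    have : 0 ≤ u - v := by linarith [hv.2]
    rw [ENNReal.ofReal_rpow_of_nonneg (by positivity) (by norm_num)]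
    simp [div_pow, Real.sq_sqrt hl.le]
  rw [h1, h2, ← ENNReal.mul_rpow_of_nonneg _ _ (by norm_num)] at hcs
  have h3 : (1 : ℝ≥0∞) ≤ (∫⁻ v in Ioo c u, ENNReal.ofReal (lik s f v)) *
      ∫⁻ v in Ioo c u, ENNReal.ofReal ((2 * (u - v) / (u - c) ^ 2) ^ 2 / lik s f v) := by
    by_contra! hlt
    exact absurd (ENNReal.rpow_lt_one hlt (by norm_num : (0 : ℝ) < 1 / 2)) (not_lt.2 hcs)
  refine h3.trans (mul_le_mul_left (lintegral_mono_set (Ioo_subset_Ioo_right hu)) _)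

/-- The weight of the exploration potential. It dominates `4 w ^ 2 (D - ε) / D ^ 4` for all `D ≥ w`
with `D > ε`, as `mul_sq_le_psi` shows; the maximum of `(D - ε) / D ^ 4` over all `D` is
`27 / (256 ε ^ 3)`, which is rounded up to `1 / (8 ε ^ 3)`. -/
def psi (ε w : ℝ) : ℝ := 4 * w ^ 2 * min (1 / (8 * ε ^ 3)) (1 / w ^ 3)

@[fun_prop]
lemma measurable_psi (ε : ℝ) : Measurable (psi ε) := by
  unfold psi; fun_prop

lemma psi_nonneg {ε w : ℝ} (hε : 0 < ε) (hw : 0 < w) : 0 ≤ psi ε w := by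
  unfold psi; positivity

lemma mul_sq_le_psi {ε w D : ℝ} (hε : 0 < ε) (hw : 0 < w) (hwD : w ≤ D) (hD : ε < D) :
    (D - ε) * (2 * w / D ^ 2) ^ 2 ≤ psi ε w := by
  have hD0 : 0 < D := hw.trans_le hwD
  have : (D - ε) * (2 * w / D ^ 2) ^ 2 = 4 * w ^ 2 * ((D - ε) / D ^ 4) := by
    field_simp; ring
  rw [this, psi]
  refine mul_le_mul_of_nonneg_left (le_min ?_ ?_) (by positivity)
  · rw [div_le_div_iff₀ (by positivity) (by positivity)]
    nlinarith [sq_nonneg (D ^ 2 - 2 * ε ^ 2 ), sq_nonneg (D - ε), sq_nonneg (3 * D - 4 * ε),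
      mul_pos hε hD0, sq_nonneg (3 * D ^ 2 - 4 * D * ε), sq_nonneg (ε * (3 * D - 4 * ε)),
      mul_nonneg (mul_pos hε hD0).le (sq_nonneg (3 * D - 4 * ε)), pow_pos hε 3, pow_pos hε 4]
  · rw [div_le_div_iff₀ (by positivity) (by positivity)]
    have : w ^ 3 ≤ D ^ 3 := pow_le_pow_left₀ hw.le hwD 3
    nlinarith [mul_le_mul_of_nonneg_left this (sub_pos.2 hD).le, pow_pos hD0 3]

/-- The exploration potential of an arm with mean `u` after `s` successes and `f` failures: it
bounds the cost of waiting for the next pull of the arm while its mean is underestimated. It is an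
average of likelihood ratios of `y` against `v` with `y < v < u`, each of which decreases in
expectation under the true mean `u`. -/
def potential (ε u : ℝ) (s f : ℕ) : ℝ≥0∞ :=
  ∫⁻ v in Ioo 0 u, ∫⁻ y in Ioo 0 v,
    ENNReal.ofReal (psi ε (u - v)) * ENNReal.ofReal (lik s f y / lik s f v)

/-- The posterior odds of a sample below `c` against one above `c`, weighted with the gap `u - c`
beyond `ε`, are at most the potential, uniformly in `c`. The normalization of the beta distribution
cancels, the mass below `c` is an integral over `y < c`, and `one_le_lintegral_lik_mul` turns the
reciprocal of the mass above `c` into an integral over `v` in `(c, u)`. -/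
lemma ofReal_mul_betaMeasure_Iic_le {ε u : ℝ} (hε : 0 < ε) (hu : u ≤ 1) (s f : ℕ) (c : ℝ) :
    ENNReal.ofReal (u - c - ε) * betaMeasure ((s + 1 : ℕ) : ℝ) ((f + 1 : ℕ) : ℝ) (Iic c) ≤
      betaMeasure ((s + 1 : ℕ) : ℝ) ((f + 1 : ℕ) : ℝ) (Ioi c) * potential ε u s f := by
  rcases le_or_gt c 0 with hc | hc
  · rw [betaMeasure_apply s f measurableSet_Iic]
    have : Iic c ∩ Ioo (0 : ℝ) 1 = ∅ := by
      ext v; simp only [mem_inter_iff, mem_Iic, mem_Ioo, mem_empty_iff_false, iff_false]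
      intro h; linarith [h.1, h.2.1]
    simp [this]
  rcases le_or_gt (u - ε) c with hcu | hcu
  · rw [ENNReal.ofReal_of_nonpos (by linarith)]; simp
  have hcu' : c < u := by linarith
  rw [betaMeasure_apply s f measurableSet_Iic, betaMeasure_apply s f measurableSet_Ioi]
  have e1 : Iic c ∩ Ioo (0 : ℝ) 1 = Ioc 0 c := by
    ext v; simp only [mem_inter_iff, mem_Iic, mem_Ioo, mem_Ioc]
    constructor
    · rintro ⟨h1, h2, h3⟩; exact ⟨h2, h1⟩
    · rintro ⟨h1, h2⟩; exact ⟨h2, h1, by linarith⟩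
  have e2 : Ioi c ∩ Ioo (0 : ℝ) 1 = Ioo c 1 := by
    ext v; simp only [mem_inter_iff, mem_Ioi, mem_Ioo]
    constructor
    · rintro ⟨h1, h2, h3⟩; exact ⟨h1, h3⟩
    · rintro ⟨h1, h2⟩; exact ⟨h1, by linarith, h2⟩
  rw [e1, e2]
  set K := ENNReal.ofReal (1 / beta ((s + 1 : ℕ) : ℝ) ((f + 1 : ℕ) : ℝ))
  set a := ∫⁻ v in Ioc 0 c, ENNReal.ofReal (lik s f v)
  set b := ∫⁻ v in Ioo c 1, ENNReal.ofReal (lik s f v)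
  set J := ∫⁻ v in Ioo c u, ENNReal.ofReal ((2 * (u - v) / (u - c) ^ 2) ^ 2 / lik s f v) with hJ
  have hcs : 1 ≤ b * J := one_le_lintegral_lik_mul s f hc hcu' hu
  have hH : ENNReal.ofReal (u - c - ε) * J * a ≤ potential ε u s f := by
    have hconst : ENNReal.ofReal (u - c - ε) * J * a = ∫⁻ v in Ioo c u,
        ENNReal.ofReal (u - c - ε) *
          ENNReal.ofReal ((2 * (u - v) / (u - c) ^ 2) ^ 2 / lik s f v) * a := by
      clear_value a
      rw [lintegral_mul_const _ (by fun_prop), lintegral_const_mul _ (by fun_prop)]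
    rw [hconst]
    unfold potential
    refine le_trans ?_ (lintegral_mono_set (Ioo_subset_Ioo_left hc.le))
    refine setLIntegral_mono' measurableSet_Ioo fun v hv => ?_
    have hl := lik_pos s f (hc.trans hv.1) (hv.2.trans_le hu)
    rw [lintegral_const_mul _ (by fun_prop), ← ENNReal.ofReal_mul (by linarith)]
    have h1 : (u - c - ε) * ((2 * (u - v) / (u - c) ^ 2) ^ 2 / lik s f v) ≤
        psi ε (u - v) * (1 / lik s f v) := by
      rw [← mul_div_assoc, mul_one_div]
      refine div_le_div_of_nonneg_right (mul_sq_le_psi hε ?_ ?_ ?_) hl.le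
      · linarith [hv.2]
      · linarith [hv.1]
      · linarith
    refine (mul_le_mul_left (ENNReal.ofReal_le_ofReal h1) _).trans ?_
    rw [ENNReal.ofReal_mul (psi_nonneg hε (by linarith [hv.2])), mul_assoc]
    refine mul_le_mul_right ?_ _
    rw [← lintegral_const_mul _ (by fun_prop)]
    refine le_trans (lintegral_mono_set (Ioc_subset_Ioo_right hv.1)) ?_
    refine lintegral_mono fun y => ?_
    rw [← ENNReal.ofReal_mul (by positivity)]
    refine le_of_eq ?_
    congr 1
    ring
  calc ENNReal.ofReal (u - c - ε) * (K * a) ≤ ENNReal.ofReal (u - c - ε) * (K * a) * (b * J) :=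
        le_mul_of_one_le_right (zero_le) hcs
    _ = K * b * (ENNReal.ofReal (u - c - ε) * J * a) := by ring
    _ ≤ _ := mul_le_mul_right hH _

/-! ### The total exploration cost -/

lemma lintegral_Ioo_sub_left (F : ℝ → ℝ≥0∞) (u : ℝ) :
    ∫⁻ v in Ioo 0 u, F (u - v) = ∫⁻ w in Ioo 0 u, F w := by
  rw [← lintegral_indicator measurableSet_Ioo, ← lintegral_indicator measurableSet_Ioo,
    ← lintegral_sub_left_eq_self _ u]
  congr 1
  ext v
  have : u - v ∈ Ioo 0 u ↔ v ∈ Ioo 0 u := by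
    simp only [mem_Ioo]; constructor <;> rintro ⟨h1, h2⟩ <;> constructor <;> linarith
  by_cases hv : v ∈ Ioo 0 u
  · rw [indicator_of_mem hv, indicator_of_mem (this.2 hv), sub_sub_cancel]
  · rw [indicator_of_notMem hv, indicator_of_notMem (mt this.1 hv)]

lemma setLIntegral_ofReal_eq {g : ℝ → ℝ} {a b : ℝ} (hab : a ≤ b)
    (hg : IntervalIntegrable g volume a b) (h0 : ∀ x ∈ Ioc a b, 0 ≤ g x) :
    ∫⁻ x in Ioc a b, ENNReal.ofReal (g x) = ENNReal.ofReal (∫ x in a..b, g x) := by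
  rw [intervalIntegral.integral_of_le hab, ofReal_integral_eq_lintegral_ofReal hg.1
    ((ae_restrict_iff' measurableSet_Ioc).2 (.of_forall h0))]

/-- The singularity at `z = 0` is capped at `T`. The two terms of `1 + log T` come from the ranges
`z ≤ 1 / (4 w T)`, where the cap is active, and `z > 1 / (4 w T)`. -/
lemma lintegral_min_inv_le {T : ℝ} (hT : 1 ≤ T) {w v : ℝ} (hw : 0 < w)
    (hwv : 4 * (w * v) ≤ 1) :
    ∫⁻ z in Ioo 0 v, ENNReal.ofReal (min T (1 / (4 * (z * w)))) ≤
      ENNReal.ofReal ((1 + Real.log T) / (4 * w)) := by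
  have hT0 : 0 < T := by linarith
  set z0 : ℝ := 1 / (4 * w * T) with hz0
  have hz0pos : 0 < z0 := by positivity
  have hlog : 0 ≤ Real.log T := Real.log_nonneg hT
  have h1 : ∫⁻ z in Ioc 0 z0, ENNReal.ofReal (min T (1 / (4 * (z * w)))) ≤
      ENNReal.ofReal (1 / (4 * w)) := by
    calc _ ≤ ∫⁻ z in Ioc 0 z0, ENNReal.ofReal T :=
          lintegral_mono fun z => ENNReal.ofReal_le_ofReal (min_le_left _ _)
      _ = ENNReal.ofReal (1 / (4 * w)) := by
          rw [setLIntegral_const, Real.volume_Ioc, ← ENNReal.ofReal_mul hT0.le, hz0]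
          congr 1; field_simp; ring
  have h2 : ∫⁻ z in Ioc z0 (max z0 v), ENNReal.ofReal (min T (1 / (4 * (z * w)))) ≤
      ENNReal.ofReal (Real.log T / (4 * w)) := by
    have hle := le_max_left z0 v
    have hnot : (0 : ℝ) ∉ uIcc z0 (max z0 v) := by
      rw [uIcc_of_le hle]; intro h; linarith [h.1]
    calc _ ≤ ∫⁻ z in Ioc z0 (max z0 v), ENNReal.ofReal (1 / (4 * w) * z⁻¹) := by
          refine setLIntegral_mono' measurableSet_Ioc fun z hz => ENNReal.ofReal_le_ofReal ?_
          refine (min_le_right _ _).trans (le_of_eq ?_)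
          have : z ≠ 0 := (hz0pos.trans hz.1).ne'
          field_simp
      _ = ENNReal.ofReal (1 / (4 * w) * Real.log (max z0 v / z0)) := by
          rw [setLIntegral_ofReal_eq hle, intervalIntegral.integral_const_mul, integral_inv hnot]
          · refine IntervalIntegrable.const_mul ?_ _
            exact intervalIntegral.intervalIntegrable_inv (fun x hx h => hnot (h ▸ hx))
              continuousOn_id
          · intro z hz
            have := hz0pos.trans hz.1
            positivity
      _ ≤ _ := by
          refine ENNReal.ofReal_le_ofReal ?_
          rw [one_div_mul_eq_div]
          refine div_le_div_of_nonneg_right ?_ (by positivity)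
          refine Real.log_le_log (by positivity) ?_
          rw [div_le_iff₀ hz0pos]
          refine max_le ?_ ?_
          · nlinarith
          · rw [hz0]; field_simp; linarith
  have hsub : Ioo 0 v ⊆ Ioc 0 z0 ∪ Ioc z0 (max z0 v) := by
    intro z hz
    rcases le_or_gt z z0 with h | h
    · exact Or.inl ⟨hz.1, h⟩
    · exact Or.inr ⟨h, hz.2.le.trans (le_max_right _ _)⟩
  calc _ ≤ _ := lintegral_mono_set hsub
    _ ≤ _ := lintegral_union_le _ _ _
    _ ≤ _ := add_le_add h1 h2
    _ = _ := by
      rw [← ENNReal.ofReal_add (by positivity) (by positivity)]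
      congr 1; ring

lemma lintegral_psi_div_le {ε : ℝ} (hε : 0 < ε) :
    ∫⁻ w in Ioi 0, ENNReal.ofReal (psi ε w / (4 * w)) ≤ ENNReal.ofReal (3 / (4 * ε)) := by
  have h1 : ∫⁻ w in Ioc 0 (2 * ε), ENNReal.ofReal (psi ε w / (4 * w)) ≤
      ENNReal.ofReal (1 / (4 * ε)) := by
    calc _ ≤ ∫⁻ w in Ioc 0 (2 * ε), ENNReal.ofReal (1 / (8 * ε ^ 3) * w) := by
          refine setLIntegral_mono' measurableSet_Ioc fun w hw => ENNReal.ofReal_le_ofReal ?_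
          have hw0 := hw.1
          rw [div_le_iff₀ (by positivity), psi]
          calc 4 * w ^ 2 * min (1 / (8 * ε ^ 3)) (1 / w ^ 3) ≤ 4 * w ^ 2 * (1 / (8 * ε ^ 3)) := by
                gcongr; exact min_le_left _ _
            _ = _ := by ring
      _ = _ := by
          rw [setLIntegral_ofReal_eq (by positivity)
            (Continuous.intervalIntegrable (by fun_prop) _ _)
            (fun x hx => by have := hx.1; positivity), intervalIntegral.integral_const_mul,
            integral_id]
          congr 1; field_simp; ring
  have h2 : ∫⁻ w in Ioi (2 * ε), ENNReal.ofReal (psi ε w / (4 * w)) ≤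
      ENNReal.ofReal (1 / (2 * ε)) := by
    calc _ ≤ ∫⁻ w in Ioi (2 * ε), ENNReal.ofReal (w ^ (-2 : ℝ)) := by
          refine setLIntegral_mono' measurableSet_Ioi fun w hw => ENNReal.ofReal_le_ofReal ?_
          have hw0 : 0 < w := lt_trans (by positivity) hw
          rw [div_le_iff₀ (by positivity), psi]
          calc 4 * w ^ 2 * min (1 / (8 * ε ^ 3)) (1 / w ^ 3) ≤ 4 * w ^ 2 * (1 / w ^ 3) := by
                gcongr; exact min_le_right _ _
            _ = _ := by
                rw [Real.rpow_neg hw0.le]; norm_cast; field_simp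
      _ = ENNReal.ofReal (∫ w in Ioi (2 * ε), w ^ (-2 : ℝ)) := by
          rw [ofReal_integral_eq_lintegral_ofReal
            (integrableOn_Ioi_rpow_of_lt (by norm_num) (by positivity))]
          refine (ae_restrict_iff' measurableSet_Ioi).2 (.of_forall fun w hw => ?_)
          have hw0 : 0 < w := lt_trans (by positivity) hw
          positivity
      _ = _ := by
          rw [integral_Ioi_rpow_of_lt (by norm_num) (by positivity)]
          congr 1
          have : (-2 : ℝ) + 1 = -1 := by norm_num
          rw [this, Real.rpow_neg_one]
          field_simp
  have hsub : Ioi 0 ⊆ Ioc 0 (2 * ε) ∪ Ioi (2 * ε) := by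
    rw [Ioc_union_Ioi_eq_Ioi (by positivity)]
  calc _ ≤ _ := lintegral_mono_set hsub
    _ ≤ _ := lintegral_union_le _ _ _
    _ ≤ _ := add_le_add h1 h2
    _ = _ := by
      rw [← ENNReal.ofReal_add (by positivity) (by positivity)]
      congr 1; field_simp; ring

/-- The total exploration cost, once the sum over the pulls of the likelihood ratio of `y` and `v`
is known to be at most `min T (1 / (4 (v - y) (u - v)))`. -/
lemma lintegral_psi_mul_min_le {ε u T : ℝ} (hε : 0 < ε) (hu : u ≤ 1) (hT : 1 ≤ T) :
    ∫⁻ v in Ioo 0 u, ∫⁻ y in Ioo 0 v, ENNReal.ofReal (psi ε (u - v)) *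
      ENNReal.ofReal (min T (1 / (4 * ((v - y) * (u - v))))) ≤
    ENNReal.ofReal (3 / 4 * (1 + Real.log T) / ε) := by
  have hlog : 0 ≤ Real.log T := Real.log_nonneg hT
  calc _ ≤ ∫⁻ v in Ioo 0 u, ENNReal.ofReal (1 + Real.log T) *
        ENNReal.ofReal (psi ε (u - v) / (4 * (u - v))) := by
        refine setLIntegral_mono' measurableSet_Ioo fun v hv => ?_
        have hw : 0 < u - v := sub_pos.2 hv.2
        have hpsi := psi_nonneg hε hw
        rw [lintegral_const_mul _ (by fun_prop),
          lintegral_Ioo_sub_left (fun z => ENNReal.ofReal (min T (1 / (4 * (z * (u - v)))))) v]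
        refine (mul_le_mul_right (lintegral_min_inv_le hT hw ?_) _).trans ?_
        · -- `4 (u - v) v ≤ u ^ 2`
          nlinarith [sq_nonneg (u - v - v), hv.1]
        · rw [← ENNReal.ofReal_mul hpsi, ← ENNReal.ofReal_mul (by positivity)]
          exact ENNReal.ofReal_le_ofReal (le_of_eq (by ring))
    _ ≤ ENNReal.ofReal (1 + Real.log T) * ENNReal.ofReal (3 / (4 * ε)) := by
        rw [lintegral_const_mul _ (by fun_prop),
          lintegral_Ioo_sub_left (fun w => ENNReal.ofReal (psi ε w / (4 * w))) u]
        refine mul_le_mul_right (le_trans ?_ (lintegral_psi_div_le hε)) _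
        exact lintegral_mono_set Ioo_subset_Ioi_self
    _ = _ := by
        rw [← ENNReal.ofReal_mul (by positivity)]
        congr 1; field_simp

/-! ### Tails of beta distributions -/

/-- The probability that a binomial variable with `n` trials and success probability `x` is at
most `s`. -/
def binomCDF (n s : ℕ) (x : ℝ) : ℝ :=
  ∑ j ∈ Finset.range (s + 1), (n.choose j : ℝ) * x ^ j * (1 - x) ^ (n - j)

lemma binomCDF_eq_eval (n s : ℕ) (x : ℝ) :
    binomCDF n s x = (∑ j ∈ Finset.range (s + 1), bernsteinPolynomial ℝ n j).eval x := by
  simp [binomCDF, bernsteinPolynomial, Polynomial.eval_finsetSum]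

/-- The derivative telescopes to a multiple of a single likelihood. -/
lemma hasDerivAt_binomCDF (s f : ℕ) (x : ℝ) :
    HasDerivAt (binomCDF (s + f + 1) s)
      (-((s + f + 1 : ℝ) * ((s + f).choose s : ℝ) * lik s f x)) x := by
  have hfun : binomCDF (s + f + 1) s =
      fun x => (∑ j ∈ Finset.range (s + 1), bernsteinPolynomial ℝ (s + f + 1) j).eval x := by
    ext x; exact binomCDF_eq_eval _ _ _
  have hder : ∀ k : ℕ, Polynomial.derivative
      (∑ j ∈ Finset.range (k + 1), bernsteinPolynomial ℝ (s + f + 1) j) =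
      -((s + f + 1 : ℕ) : Polynomial ℝ) * bernsteinPolynomial ℝ (s + f) k := by
    intro k
    induction k with
    | zero => simp [bernsteinPolynomial.derivative_zero]
    | succ k ih =>
      rw [Finset.sum_range_succ, Polynomial.derivative_add, ih,
        bernsteinPolynomial.derivative_succ]
      simp only [Nat.add_sub_cancel]
      ring
  rw [hfun]
  convert! Polynomial.hasDerivAt _ x using 1
  rw [hder s]
  simp [bernsteinPolynomial, lik]
  ring

lemma lintegral_lik (s f : ℕ) {x : ℝ} (h0 : 0 ≤ x) (h1 : x ≤ 1) :
    ENNReal.ofReal ((s + f + 1 : ℝ) * ((s + f).choose s : ℝ)) *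
      ∫⁻ v in Ioo x 1, ENNReal.ofReal (lik s f v) = ENNReal.ofReal (binomCDF (s + f + 1) s x) := by
  rw [setLIntegral_congr Ioo_ae_eq_Ioc, setLIntegral_ofReal_eq h1
    ((continuous_lik s f).intervalIntegrable _ _), ← ENNReal.ofReal_mul (by positivity),
    ← intervalIntegral.integral_const_mul]
  · congr 1
    rw [intervalIntegral.integral_eq_sub_of_hasDerivAt (f := -binomCDF (s + f + 1) s)
      (fun v _ => by simpa using (hasDerivAt_binomCDF s f v).neg)
      (((continuous_lik s f).const_mul _).intervalIntegrable _ _)]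
    have : binomCDF (s + f + 1) s 1 = 0 := by
      refine Finset.sum_eq_zero fun j hj => ?_
      have : s + f + 1 - j ≠ 0 := by have := Finset.mem_range.1 hj; omega
      simp [this]
    rw [Pi.neg_apply, Pi.neg_apply, this]; ring
  · intro v hv
    have : 0 ≤ 1 - v := by linarith [hv.2]
    have : 0 ≤ v := h0.trans hv.1.le
    unfold lik; positivity

/-- The tail of a beta distribution with integer parameters is a binomial distribution function. -/
lemma betaMeasure_Ioi (s f : ℕ) {x : ℝ} (h0 : 0 ≤ x) (h1 : x ≤ 1) :
    betaMeasure ((s + 1 : ℕ) : ℝ) ((f + 1 : ℕ) : ℝ) (Ioi x) =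
      ENNReal.ofReal (binomCDF (s + f + 1) s x) := by
  have hprob := isProbabilityMeasureBeta (α := ((s + 1 : ℕ) : ℝ)) (β := ((f + 1 : ℕ) : ℝ))
    (by positivity) (by positivity)
  have huniv := hprob.measure_univ
  rw [betaMeasure_apply s f .univ, univ_inter] at huniv
  have hzero := lintegral_lik s f le_rfl zero_le_one
  have hF0 : binomCDF (s + f + 1) s 0 = 1 := by
    rw [binomCDF, Finset.sum_range_succ']
    simp
  rw [hF0, ENNReal.ofReal_one] at hzero
  -- both densities have total mass `1`, so that their normalizing constants agree
  set I := ∫⁻ v in Ioo 0 1, ENNReal.ofReal (lik s f v)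
  set K := ENNReal.ofReal (1 / beta ((s + 1 : ℕ) : ℝ) ((f + 1 : ℕ) : ℝ))
  set K' := ENNReal.ofReal ((s + f + 1 : ℝ) * ((s + f).choose s : ℝ))
  have hKK : K = K' := by
    calc K = K * (K' * I) := by rw [hzero, mul_one]
      _ = K' * (K * I) := by ring
      _ = K' := by rw [huniv, mul_one]
  have hset : Ioi x ∩ Ioo (0 : ℝ) 1 = Ioo x 1 := by
    ext v; simp only [mem_inter_iff, mem_Ioi, mem_Ioo]
    constructor
    · rintro ⟨h1, h2, h3⟩; exact ⟨h1, h3⟩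
    · rintro ⟨h1, h2⟩; exact ⟨h1, by linarith, h2⟩
  rw [betaMeasure_apply s f measurableSet_Ioi, hset]
  change K * _ = _
  rw [hKK, lintegral_lik s f h0 h1]

/-- Hoeffding's lemma for a Bernoulli variable with mean `x`. -/
lemma bernoulli_mgf_le {x : ℝ} (h0 : 0 ≤ x) (h1 : x ≤ 1) (l : ℝ) :
    1 - x + x * Real.exp (-l) ≤ Real.exp (-l * x + l ^ 2 / 8) := by
  set μ : Measure ℝ := ENNReal.ofReal x • Measure.dirac 1 + ENNReal.ofReal (1 - x) • Measure.dirac 0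
    with hμ
  have hint : ∀ g : ℝ → ℝ, ∫ y, g y ∂μ = x * g 1 + (1 - x) * g 0 := by
    intro g
    rw [hμ, integral_add_measure, integral_smul_measure, integral_smul_measure]
    · simp [h0, ENNReal.toReal_ofReal, sub_nonneg.2 h1]
    · exact (integrable_dirac (by simp)).smul_measure (by simp)
    · exact (integrable_dirac (by simp)).smul_measure (by simp)
  have : IsProbabilityMeasure μ := ⟨by
    simp only [hμ, Measure.add_apply, Measure.smul_apply, measure_univ, smul_eq_mul, mul_one]
    rw [← ENNReal.ofReal_add h0 (by linarith)]; simp⟩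
  have hsub := hasSubgaussianMGF_of_mem_Icc (μ := μ) (X := id) (a := 0) (b := 1)
    aemeasurable_id (by
      rw [hμ, ae_add_measure_iff]
      exact ⟨Measure.ae_smul_measure (by simp [ae_dirac_eq]) _,
        Measure.ae_smul_measure (by simp [ae_dirac_eq]) _⟩)
  have := hsub.mgf_le (-l)
  rw [mgf, hint, hint] at this
  simp at this
  have hexp : Real.exp (-l * x + l ^ 2 / 8) = Real.exp (-l * x) * Real.exp (l ^ 2 / 8) :=
    Real.exp_add _ _
  have e1 : Real.exp (-l) = Real.exp (-l * x) * Real.exp (-(l * (1 - x))) := by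
    rw [← Real.exp_add]; congr 1; ring
  have e2 : 1 = Real.exp (-l * x) * Real.exp (l * x) := by
    rw [← Real.exp_add]; simp
  rw [hexp]
  calc 1 - x + x * Real.exp (-l)
      = Real.exp (-l * x) * (x * Real.exp (-(l * (1 - x))) + (1 - x) * Real.exp (l * x)) := by
        rw [e1]; linear_combination (1 - x) * e2
    _ ≤ _ := by
        refine mul_le_mul_of_nonneg_left (this.trans (le_of_eq ?_)) (Real.exp_pos _).le
        congr 1; ring

/-- Chernoff's bound for the lower tail of the binomial distribution. -/
lemma binomCDF_le {n s : ℕ} (hn : 0 < n) (hsn : s ≤ n) {x : ℝ} (h0 : 0 ≤ x) (h1 : x ≤ 1)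
    (hx : (s : ℝ) / n ≤ x) :
    binomCDF n s x ≤ Real.exp (-2 * n * (x - s / n) ^ 2) := by
  have hn' : (0 : ℝ) < n := by exact_mod_cast hn
  -- the minimizer of the exponent `n * (-l * (x - s / n) + l ^ 2 / 8)`
  set l : ℝ := 4 * (x - s / n) with hl
  have hl0 : 0 ≤ l := by rw [hl]; linarith
  have hx1 : 0 ≤ 1 - x := by linarith
  calc binomCDF n s x
      ≤ ∑ j ∈ Finset.range (s + 1), Real.exp (l * s) *
          ((x * Real.exp (-l)) ^ j * (1 - x) ^ (n - j) * (n.choose j : ℝ)) := by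
        refine Finset.sum_le_sum fun j hj => ?_
        have hjs : (j : ℝ) ≤ s := by exact_mod_cast Nat.lt_succ_iff.1 (Finset.mem_range.1 hj)
        have : 1 ≤ Real.exp (l * s) * Real.exp (-l) ^ j := by
          rw [← Real.exp_nat_mul, ← Real.exp_add]
          refine Real.one_le_exp ?_
          nlinarith
        calc (n.choose j : ℝ) * x ^ j * (1 - x) ^ (n - j)
            ≤ ((n.choose j : ℝ) * x ^ j * (1 - x) ^ (n - j)) *
              (Real.exp (l * s) * Real.exp (-l) ^ j) :=
              le_mul_of_one_le_right (by positivity) this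
          _ = _ := by rw [mul_pow]; ring
    _ ≤ ∑ j ∈ Finset.range (n + 1), Real.exp (l * s) *
          ((x * Real.exp (-l)) ^ j * (1 - x) ^ (n - j) * (n.choose j : ℝ)) := by
        refine Finset.sum_le_sum_of_subset_of_nonneg
          (Finset.range_mono (by omega)) fun j _ _ => by positivity
    _ = Real.exp (l * s) * (x * Real.exp (-l) + (1 - x)) ^ n := by
        rw [← Finset.mul_sum, add_pow]
    _ ≤ Real.exp (l * s) * Real.exp (-l * x + l ^ 2 / 8) ^ n := by
        gcongr
        have := bernoulli_mgf_le h0 h1 l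
        linarith
    _ = _ := by
        rw [← Real.exp_nat_mul, ← Real.exp_add]
        congr 1
        rw [hl]; field_simp; ring

/-- A posterior sample exceeds the shrunken empirical mean `s / (s + f + 1)` by more than
`√(a / (2 (s + f + 1)))` with probability at most `exp (-a)`. -/
lemma betaMeasure_Ioi_le (s f : ℕ) {a : ℝ} (ha : 0 ≤ a) :
    betaMeasure ((s + 1 : ℕ) : ℝ) ((f + 1 : ℕ) : ℝ)
      (Ioi (s / (s + f + 1 : ℝ) + Real.sqrt (a / 2) / Real.sqrt (s + f + 1))) ≤
      ENNReal.ofReal (Real.exp (-a)) := by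
  set x : ℝ := s / (s + f + 1 : ℝ) + Real.sqrt (a / 2) / Real.sqrt (s + f + 1) with hx
  have hx0 : 0 ≤ x := by positivity
  rcases le_or_gt x 1 with h1 | h1
  · rw [betaMeasure_Ioi s f hx0 h1]
    refine ENNReal.ofReal_le_ofReal ((binomCDF_le (by omega) (by omega) hx0 h1 ?_).trans ?_)
    · push_cast
      rw [hx]
      linarith [show 0 ≤ Real.sqrt (a / 2) / Real.sqrt (s + f + 1) by positivity]
    · refine Real.exp_le_exp.2 (le_of_eq ?_)
      push_cast
      rw [hx, add_sub_cancel_left, div_pow, Real.sq_sqrt (by positivity),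
        Real.sq_sqrt (by positivity)]
      field_simp
  · rw [betaMeasure_apply s f measurableSet_Ioi]
    have : Ioi x ∩ Ioo (0 : ℝ) 1 = ∅ := by
      ext v; simp only [mem_inter_iff, mem_Ioi, mem_Ioo, mem_empty_iff_false, iff_false]
      intro h; linarith [h.1, h.2.2]
    simp [this]

lemma betaMeasure_compl_Ioo (s f : ℕ) :
    betaMeasure ((s + 1 : ℕ) : ℝ) ((f + 1 : ℕ) : ℝ) (Ioo 0 1)ᶜ = 0 := by
  rw [betaMeasure_apply s f measurableSet_Ioo.compl]
  simp

/-! ### Thresholds and the exchange argument -/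

lemma mem_admissible {m : ℕ} {S B : Finset (Fin N)} :
    B ∈ admissible m S ↔ B ⊆ S ∧ B.card ≤ m := by
  simp [admissible]

lemma empty_mem_admissible (m : ℕ) (S : Finset (Fin N)) : ∅ ∈ admissible m S := by
  simp [mem_admissible]

/-- The largest value of `∑ i ∈ B, I i` over the admissible subsets `B` of `S`. -/
def bestValue (m : ℕ) (S : Finset (Fin N)) (I : Fin N → ℝ) : ℝ :=
  (admissible m S).sup' ⟨∅, empty_mem_admissible m S⟩ fun B => ∑ i ∈ B, I i

lemma sum_le_bestValue {m : ℕ} {S B : Finset (Fin N)} (hB : B ∈ admissible m S) (I : Fin N → ℝ) :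
    ∑ i ∈ B, I i ≤ bestValue m S I :=
  Finset.le_sup' (fun B => ∑ i ∈ B, I i) hB

lemma exists_eq_bestValue (m : ℕ) (S : Finset (Fin N)) (I : Fin N → ℝ) :
    ∃ B ∈ admissible m S, bestValue m S I = ∑ i ∈ B, I i :=
  Finset.exists_mem_eq_sup' _ _

/-- The threshold that the index of arm `i` has to exceed in order to be pulled: the marginal value
of the `m`-th slot when arm `i` is removed. It does not depend on the index of `i` itself. -/
def threshold (m : ℕ) (S : Finset (Fin N)) (I : Fin N → ℝ) (i : Fin N) : ℝ :=
  bestValue m (S.erase i) I - bestValue (m - 1) (S.erase i) I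

lemma bestValue_congr {m : ℕ} {S : Finset (Fin N)} {I I' : Fin N → ℝ}
    (h : ∀ i ∈ S, I i = I' i) : bestValue m S I = bestValue m S I' :=
  Finset.sup'_congr _ rfl fun _ hB =>
    Finset.sum_congr rfl fun i hi => h i ((mem_admissible.1 hB).1 hi)

lemma threshold_congr {m : ℕ} {S : Finset (Fin N)} {I I' : Fin N → ℝ} {i : Fin N}
    (h : ∀ j ∈ S, j ≠ i → I j = I' j) : threshold m S I i = threshold m S I' i := by
  have h' : ∀ j ∈ S.erase i, I j = I' j := fun j hj =>
    h j (Finset.mem_of_mem_erase hj) (Finset.ne_of_mem_erase hj)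
  simp only [threshold, bestValue_congr h']

lemma measurable_bestValue (m : ℕ) (S : Finset (Fin N)) : Measurable (bestValue m S) := by
  have : bestValue m S = (admissible m S).sup' ⟨∅, empty_mem_admissible m S⟩
      fun B (I : Fin N → ℝ) => ∑ i ∈ B, I i := by
    ext I; exact (Finset.sup'_apply _ _ _).symm
  rw [this]
  exact Finset.measurable_sup' _ fun B _ => by fun_prop

lemma measurable_threshold (m : ℕ) (S : Finset (Fin N)) (i : Fin N) :
    Measurable fun I : Fin N → ℝ => threshold m S I i :=
  (measurable_bestValue _ _).sub (measurable_bestValue _ _)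

section Maximizer

variable {m : ℕ} {S A : Finset (Fin N)} {I : Fin N → ℝ}

lemma bestValue_erase_eq (hA : A ∈ admissible m S)
    (hmax : ∀ B ∈ admissible m S, ∑ i ∈ B, I i ≤ ∑ i ∈ A, I i) {i : Fin N} (hi : i ∉ A) :
    bestValue m (S.erase i) I = ∑ j ∈ A, I j := by
  rw [mem_admissible] at hA
  refine le_antisymm ?_ (sum_le_bestValue (mem_admissible.2 ⟨?_, hA.2⟩) I)
  · obtain ⟨B, hB, h⟩ := exists_eq_bestValue m (S.erase i) I
    rw [mem_admissible] at hB
    rw [h]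
    exact hmax B (mem_admissible.2 ⟨hB.1.trans (Finset.erase_subset _ _), hB.2⟩)
  · intro j hj
    exact Finset.mem_erase.2 ⟨fun h => hi (h ▸ hj), hA.1 hj⟩

/-- An available arm that is not pulled has an index below its threshold. -/
lemma le_threshold (hm : 0 < m) (hA : A ∈ admissible m S)
    (hmax : ∀ B ∈ admissible m S, ∑ i ∈ B, I i ≤ ∑ i ∈ A, I i) {i : Fin N} (hiS : i ∈ S)
    (hi : i ∉ A) : I i ≤ threshold m S I i := by
  rw [threshold, bestValue_erase_eq hA hmax hi]
  obtain ⟨B, hB, h⟩ := exists_eq_bestValue (m - 1) (S.erase i) I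
  rw [mem_admissible] at hB
  have hiB : i ∉ B := fun hh => (Finset.mem_erase.1 (hB.1 hh)).1 rfl
  have := hmax (insert i B) (mem_admissible.2 ⟨?_, ?_⟩)
  · rw [Finset.sum_insert hiB] at this
    linarith
  · exact Finset.insert_subset hiS (hB.1.trans (Finset.erase_subset _ _))
  · rw [Finset.card_insert_of_notMem hiB]; omega

/-- The threshold of an arm that is not pulled is at most the index of every pulled arm. -/
lemma threshold_le_of_mem (hA : A ∈ admissible m S)
    (hmax : ∀ B ∈ admissible m S, ∑ i ∈ B, I i ≤ ∑ i ∈ A, I i) {i j : Fin N} (hi : i ∉ A)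
    (hj : j ∈ A) : threshold m S I i ≤ I j := by
  rw [threshold, bestValue_erase_eq hA hmax hi]
  rw [mem_admissible] at hA
  have := sum_le_bestValue (m := m - 1) (S := S.erase i) (B := A.erase j)
    (mem_admissible.2 ⟨?_, ?_⟩) I
  · rw [← Finset.add_sum_erase A I hj]; linarith
  · intro l hl
    have hlA := Finset.mem_of_mem_erase hl
    exact Finset.mem_erase.2 ⟨fun h => hi (h ▸ hlA), hA.1 hlA⟩
  · rw [Finset.card_erase_of_mem hj]; omega

lemma threshold_nonpos_of_card_lt (hA : A ∈ admissible m S)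
    (hmax : ∀ B ∈ admissible m S, ∑ i ∈ B, I i ≤ ∑ i ∈ A, I i) {i : Fin N} (hi : i ∉ A)
    (hcard : A.card < m) : threshold m S I i ≤ 0 := by
  rw [threshold, bestValue_erase_eq hA hmax hi]
  rw [mem_admissible] at hA
  have := sum_le_bestValue (m := m - 1) (S := S.erase i) (B := A)
    (mem_admissible.2 ⟨?_, by omega⟩) I
  · linarith
  · intro l hl
    exact Finset.mem_erase.2 ⟨fun h => hi (h ▸ hl), hA.1 hl⟩

/-- Exchange argument: the loss of the maximizer `A` of the indices against `B`, measured in the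
true values `v`, is paid by the arms of `B` that are not pulled and by the overestimated arms of
`A`. -/
lemma sum_sub_sum_le_of_maximizer (hA : A ∈ admissible m S)
    (hmax : ∀ B ∈ admissible m S, ∑ i ∈ B, I i ≤ ∑ i ∈ A, I i) (hI : ∀ i ∈ A, 0 ≤ I i)
    (v : Fin N → ℝ) {B : Finset (Fin N)} (hB : B ∈ admissible m S) :
    ∑ i ∈ B, v i - ∑ i ∈ A, v i ≤
      ∑ i ∈ B \ A, max (v i - threshold m S I i) 0 + ∑ i ∈ A, max (I i - v i) 0 := by
  have hB2 := (mem_admissible.1 hB).2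
  have hA2 := (mem_admissible.1 hA).2
  -- If `A` is not full, the thresholds of the arms outside `A` are nonpositive; if it is full, they
  -- are at most the smallest index in `A \ B`, and `B \ A` is not larger than `A \ B`.
  have hthr : ∑ i ∈ B \ A, threshold m S I i ≤ ∑ i ∈ A \ B, I i := by
    have hnn : 0 ≤ ∑ i ∈ A \ B, I i :=
      Finset.sum_nonneg fun i hi => hI i (Finset.mem_sdiff.1 hi).1
    rcases lt_or_eq_of_le hA2 with hc | hc
    · refine le_trans (Finset.sum_nonpos fun i hi => ?_) hnn
      exact threshold_nonpos_of_card_lt hA hmax (Finset.mem_sdiff.1 hi).2 hc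
    · rcases (A \ B).eq_empty_or_nonempty with he | hne
      · have hAB : A ⊆ B := Finset.sdiff_eq_empty_iff_subset.1 he
        have : A = B := Finset.eq_of_subset_of_card_le hAB (by omega)
        simp [this]
      · obtain ⟨j, hj, hmin⟩ := (A \ B).exists_min_image I hne
        have hjA := (Finset.mem_sdiff.1 hj).1
        have hcard : (B \ A).card ≤ (A \ B).card := by
          have h1 := Finset.card_sdiff_add_card_inter B A
          have h2 := Finset.card_sdiff_add_card_inter A B
          rw [Finset.inter_comm] at h2
          omega
        calc ∑ i ∈ B \ A, threshold m S I i ≤ ∑ i ∈ B \ A, I j :=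
              Finset.sum_le_sum fun i hi =>
                threshold_le_of_mem hA hmax (Finset.mem_sdiff.1 hi).2 hjA
          _ = (B \ A).card * I j := by simp
          _ ≤ (A \ B).card * I j :=
              mul_le_mul_of_nonneg_right (by exact_mod_cast hcard) (hI j hjA)
          _ = ∑ i ∈ A \ B, I j := by simp
          _ ≤ _ := Finset.sum_le_sum hmin
  have hsplitB := Finset.sum_inter_add_sum_sdiff B A v
  have hsplitA := Finset.sum_inter_add_sum_sdiff A B v
  rw [Finset.inter_comm] at hsplitA
  have h1 : ∑ i ∈ B \ A, v i ≤ ∑ i ∈ B \ A, max (v i - threshold m S I i) 0 +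
      ∑ i ∈ B \ A, threshold m S I i := by
    rw [← Finset.sum_add_distrib]
    exact Finset.sum_le_sum fun i _ => by linarith [le_max_left (v i - threshold m S I i) 0]
  have h2 : ∑ i ∈ A \ B, I i ≤ ∑ i ∈ A \ B, max (I i - v i) 0 + ∑ i ∈ A \ B, v i := by
    rw [← Finset.sum_add_distrib]
    exact Finset.sum_le_sum fun i _ => by linarith [le_max_left (I i - v i) 0]
  have h3 : ∑ i ∈ A \ B, max (I i - v i) 0 ≤ ∑ i ∈ A, max (I i - v i) 0 :=
    Finset.sum_le_sum_of_subset_of_nonneg Finset.sdiff_subset fun _ _ _ => le_max_right _ _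
  linarith

end Maximizer

/-- The probability that the randomized policy `q` pulls arm `i` when `S` is available. -/
def pullProb (m : ℕ) (q : Finset (Fin N) → Finset (Fin N) → ℝ) (S : Finset (Fin N)) (i : Fin N) :
    ℝ :=
  ∑ B ∈ (admissible m S).filter (fun B => i ∈ B), q S B

section PullProb

variable {m : ℕ} {q : Finset (Fin N) → Finset (Fin N) → ℝ} {PZ : PMF (Finset (Fin N))}
  {k : Fin N → ℝ}

lemma sum_q_mul_sum (S : Finset (Fin N)) (v : Fin N → ℝ) :
    ∑ B ∈ admissible m S, q S B * ∑ i ∈ B, v i = ∑ i, pullProb m q S i * v i := by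
  simp only [pullProb, Finset.sum_mul, Finset.mul_sum, Finset.sum_filter]
  rw [Finset.sum_comm' (t' := Finset.univ)
    (s' := fun i => (admissible m S).filter (fun B => i ∈ B)) (by simp [and_comm])]
  refine Finset.sum_congr rfl fun i _ => ?_
  rw [Finset.sum_filter]
  exact Finset.sum_congr rfl fun B _ => by split_ifs <;> simp

lemma pullProb_nonneg (hq : IsFeasiblePolicy PZ m k q) (S : Finset (Fin N)) (i : Fin N) :
    0 ≤ pullProb m q S i :=
  Finset.sum_nonneg fun B hB => (hq.mem_Icc S B (Finset.mem_filter.1 hB).1).1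

lemma pullProb_le_one (hq : IsFeasiblePolicy PZ m k q) (S : Finset (Fin N)) (i : Fin N) :
    pullProb m q S i ≤ 1 := by
  rw [← hq.sum_eq_one S]
  exact Finset.sum_le_sum_of_subset_of_nonneg (Finset.filter_subset _ _)
    fun B hB _ => (hq.mem_Icc S B hB).1

lemma pullProb_eq_zero {S : Finset (Fin N)} {i : Fin N} (hi : i ∉ S) : pullProb m q S i = 0 := by
  refine Finset.sum_eq_zero fun B hB => ?_
  rw [Finset.mem_filter, mem_admissible] at hB
  exact absurd (hB.1.1 hB.2) hi

lemma sum_pullProb_le (hq : IsFeasiblePolicy PZ m k q) (S : Finset (Fin N)) :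
    ∑ i, pullProb m q S i ≤ m := by
  have := sum_q_mul_sum (m := m) (q := q) S (fun _ => 1)
  simp only [mul_one] at this
  rw [← this]
  calc ∑ B ∈ admissible m S, q S B * ∑ i ∈ B, (1 : ℝ) ≤ ∑ B ∈ admissible m S, q S B * m := by
        refine Finset.sum_le_sum fun B hB => mul_le_mul_of_nonneg_left ?_ (hq.mem_Icc S B hB).1
        simpa using (mem_admissible.1 hB).2
    _ = m := by rw [← Finset.sum_mul, hq.sum_eq_one, one_mul]

/-- The fairness demand of an arm is at most `1`. -/
lemma k_le_one (hq : IsFeasiblePolicy PZ m k q) (i : Fin N) : k i ≤ 1 := by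
  refine (hq.fair i).trans ?_
  have htsum : ∑ S, (PZ S).toReal = 1 := by
    have h := PZ.tsum_coe
    rw [tsum_fintype] at h
    rw [← ENNReal.toReal_sum fun S _ => PZ.apply_ne_top S, h, ENNReal.toReal_one]
  rw [← htsum]
  refine Finset.sum_le_sum fun S _ => ?_
  exact mul_le_of_le_one_right ENNReal.toReal_nonneg (pullProb_le_one hq S i)

/-- The exchange argument, averaged over the sets that the randomized policy `q` pulls. -/
lemma pullProb_sub_sum_le (hq : IsFeasiblePolicy PZ m k q) {S A : Finset (Fin N)} {I : Fin N → ℝ}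
    (hA : A ∈ admissible m S)
    (hmax : ∀ B ∈ admissible m S, ∑ i ∈ B, I i ≤ ∑ i ∈ A, I i) (hI : ∀ i ∈ A, 0 ≤ I i)
    (v : Fin N → ℝ) :
    ∑ i, pullProb m q S i * v i - ∑ i ∈ A, v i ≤
      ∑ i, pullProb m q S i * (if i ∈ A then 0 else max (v i - threshold m S I i) 0) +
        ∑ i ∈ A, max (I i - v i) 0 := by
  rw [← sum_q_mul_sum, ← sum_q_mul_sum]
  have hone := hq.sum_eq_one S
  have e1 : ∑ i ∈ A, v i = ∑ B ∈ admissible m S, q S B * ∑ i ∈ A, v i := by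
    rw [← Finset.sum_mul, hone, one_mul]
  have e2 : ∑ i ∈ A, max (I i - v i) 0 =
      ∑ B ∈ admissible m S, q S B * ∑ i ∈ A, max (I i - v i) 0 := by
    rw [← Finset.sum_mul, hone, one_mul]
  rw [e1, e2, ← Finset.sum_sub_distrib, ← Finset.sum_add_distrib]
  refine Finset.sum_le_sum fun B hB => ?_
  rw [← mul_sub, ← mul_add]
  refine mul_le_mul_of_nonneg_left ?_ (hq.mem_Icc S B hB).1
  refine (sum_sub_sum_le_of_maximizer hA hmax hI v hB).trans (le_of_eq ?_)
  congr 1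
  rw [← Finset.sum_filter_add_sum_filter_not B (fun i => i ∈ A)]
  rw [Finset.sum_eq_zero (s := B.filter (fun i => i ∈ A))
    (fun i hi => by simp [(Finset.mem_filter.1 hi).2]), zero_add, Finset.sdiff_eq_filter]
  exact Finset.sum_congr rfl fun i hi => by simp [(Finset.mem_filter.1 hi).2]

end PullProb

/-! ### Pull counts and queues along one trajectory -/

/-- The number of rounds before round `t` in which arm `i` was pulled and rewarded. -/
def successes (A : ℕ → Finset (Fin N)) (X : ℕ → Fin N → Bool) (i : Fin N) : ℕ → ℕ
  | 0 => 0
  | t + 1 => successes A X i t + if i ∈ A t then (X t i).toNat else 0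

/-- The number of rounds before round `t` in which arm `i` was pulled and not rewarded. -/
def failures (A : ℕ → Finset (Fin N)) (X : ℕ → Fin N → Bool) (i : Fin N) : ℕ → ℕ
  | 0 => 0
  | t + 1 => failures A X i t + if i ∈ A t then 1 - (X t i).toNat else 0

/-- The number of rounds before round `t` in which arm `i` was pulled. -/
def pulls (A : ℕ → Finset (Fin N)) (i : Fin N) : ℕ → ℕ
  | 0 => 0
  | t + 1 => pulls A i t + if i ∈ A t then 1 else 0

section Counts

variable (A : ℕ → Finset (Fin N)) (X : ℕ → Fin N → Bool) (i : Fin N)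

lemma alphaParam_eq (t : ℕ) : alphaParam A X i t = successes A X i t + 1 := by
  induction t with
  | zero => rfl
  | succ t ih => simp only [alphaParam, successes, ih]; ring

lemma betaParam_eq (t : ℕ) : betaParam A X i t = failures A X i t + 1 := by
  induction t with
  | zero => rfl
  | succ t ih => simp only [betaParam, failures, ih]; ring

lemma successes_add_failures (t : ℕ) :
    successes A X i t + failures A X i t = pulls A i t := by
  induction t with
  | zero => rfl
  | succ t ih =>
    simp only [successes, failures, pulls, ← ih]
    split_ifs
    · have := Bool.toNat_le (X t i); omega
    · omega

lemma pulls_le (t : ℕ) : pulls A i t ≤ t := by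
  induction t with
  | zero => simp [pulls]
  | succ t ih => simp only [pulls]; split_ifs <;> omega

lemma sum_pulls_le {m T : ℕ} (hA : ∀ t < T, (A t).card ≤ m) : ∑ i, pulls A i T ≤ m * T := by
  induction T with
  | zero => simp [pulls]
  | succ T ih =>
    have h1 := ih fun t ht => hA t (by omega)
    have h2 := hA T (by omega)
    simp only [pulls, Finset.sum_add_distrib]
    have : ∑ i, (if i ∈ A T then 1 else 0) = (A T).card := by simp
    rw [this, mul_add]
    omega

lemma sum_inv_sqrt_le (T : ℕ) :
    ∑ t ∈ Finset.range T, (if i ∈ A t then 1 / Real.sqrt (pulls A i t + 1) else 0) ≤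
      2 * Real.sqrt (pulls A i T) := by
  induction T with
  | zero => simp [pulls]
  | succ T ih =>
    rw [Finset.sum_range_succ]
    simp only [pulls]
    split_ifs with h
    · push_cast
      set n : ℝ := (pulls A i T : ℝ)
      have hn : 0 ≤ n := Nat.cast_nonneg _
      have hs : 0 < Real.sqrt (n + 1) := Real.sqrt_pos.2 (by linarith)
      have hs1 := Real.sq_sqrt (show 0 ≤ n + 1 by linarith)
      have hs2 := Real.sq_sqrt hn
      have hle : 1 / Real.sqrt (n + 1) ≤ 2 * Real.sqrt (n + 1) - 2 * Real.sqrt n := by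
        rw [div_le_iff₀ hs]
        nlinarith [sq_nonneg (Real.sqrt (n + 1) - Real.sqrt n)]
      linarith
    · simpa using ih

lemma sum_inv_eq_harmonic (T : ℕ) :
    ∑ t ∈ Finset.range T, (if i ∈ A t then 1 / ((pulls A i t : ℝ) + 1) else 0) =
      (harmonic (pulls A i T) : ℝ) := by
  induction T with
  | zero => simp [pulls]
  | succ T ih =>
    rw [Finset.sum_range_succ, ih]
    simp only [pulls]
    split_ifs with h
    · rw [harmonic_succ]; push_cast; simp
    · simp

lemma sum_inv_le {T : ℕ} (hT : 0 < T) :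
    ∑ t ∈ Finset.range T, (if i ∈ A t then 1 / ((pulls A i t : ℝ) + 1) else 0) ≤
      1 + Real.log T := by
  rw [sum_inv_eq_harmonic]
  rcases Nat.eq_zero_or_pos (pulls A i T) with h | h
  · have := Real.log_nonneg (show (1 : ℝ) ≤ T by exact_mod_cast hT)
    rw [h]; simp; linarith
  · refine (harmonic_le_one_add_log _).trans ?_
    have := Real.log_le_log (by exact_mod_cast h)
      (show (pulls A i T : ℝ) ≤ T by exact_mod_cast pulls_le A i T)
    linarith

variable {A X i} in
lemma successes_congr {A' : ℕ → Finset (Fin N)} {X' : ℕ → Fin N → Bool} {t : ℕ}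
    (h : ∀ τ < t, A τ = A' τ ∧ X τ = X' τ) : successes A X i t = successes A' X' i t := by
  induction t with
  | zero => rfl
  | succ t ih =>
    simp only [successes, ih fun τ hτ => h τ (by omega), (h t (by omega)).1, (h t (by omega)).2]

variable {A X i} in
lemma failures_congr {A' : ℕ → Finset (Fin N)} {X' : ℕ → Fin N → Bool} {t : ℕ}
    (h : ∀ τ < t, A τ = A' τ ∧ X τ = X' τ) : failures A X i t = failures A' X' i t := by
  induction t with
  | zero => rfl
  | succ t ih =>
    simp only [failures, ih fun τ hτ => h τ (by omega), (h t (by omega)).1, (h t (by omega)).2]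

variable {A i} in
lemma queue_congr {k : Fin N → ℝ} {A' : ℕ → Finset (Fin N)} {t : ℕ}
    (h : ∀ τ < t, A τ = A' τ) : queue k A i t = queue k A' i t := by
  simp only [queue]
  rw [Finset.sum_congr rfl fun τ hτ => by rw [h τ (Finset.mem_range.1 hτ)]]

lemma queue_nonneg (k : Fin N → ℝ) (t : ℕ) : 0 ≤ queue k A i t := le_max_right _ _

lemma queue_le {k : Fin N → ℝ} (hk : k i ≤ 1) (t : ℕ) : queue k A i t ≤ t := by
  have h1 : (t : ℝ) * k i ≤ t := mul_le_of_le_one_right (Nat.cast_nonneg t) hk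
  have h2 : 0 ≤ ∑ τ ∈ Finset.range t, if i ∈ A τ then (1 : ℝ) else 0 :=
    Finset.sum_nonneg fun τ _ => by split_ifs <;> norm_num
  exact max_le (by linarith) (Nat.cast_nonneg t)

/-- Lyapunov drift of one queue: its square grows in each round by at most
`2 queue * (k - pulled) + 1`. -/
lemma queue_sq_le {k : Fin N → ℝ} (hk : k i ≤ 1) (T : ℕ) :
    queue k A i T ^ 2 ≤ T + 2 * ∑ t ∈ Finset.range T,
      queue k A i t * (k i - if i ∈ A t then 1 else 0) := by
  rcases le_or_gt (k i) 0 with hk0 | hk0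
  · -- a queue without demand stays empty
    have hq : ∀ t, queue k A i t = 0 := fun t => by
      have h1 : (t : ℝ) * k i ≤ 0 := mul_nonpos_of_nonneg_of_nonpos (Nat.cast_nonneg t) hk0
      have h2 : 0 ≤ ∑ τ ∈ Finset.range t, if i ∈ A τ then (1 : ℝ) else 0 :=
        Finset.sum_nonneg fun τ _ => by split_ifs <;> norm_num
      exact max_eq_right (by linarith)
    simp [hq]
  induction T with
  | zero => simp [queue]
  | succ T ih =>
    rw [Finset.sum_range_succ]
    set δ : ℝ := k i - if i ∈ A T then 1 else 0 with hδ
    -- this uses `0 < k i ≤ 1`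
    have hδ1 : δ ^ 2 ≤ 1 := by
      rw [hδ]; split_ifs <;> nlinarith
    have hstep : queue k A i (T + 1) ^ 2 ≤ (queue k A i T + δ) ^ 2 := by
      set D : ℝ := (T : ℝ) * k i - ∑ τ ∈ Finset.range T, if i ∈ A τ then (1 : ℝ) else 0 with hD
      have h1 : queue k A i (T + 1) = max (D + δ) 0 := by
        rw [queue, Finset.sum_range_succ, hD, hδ]; push_cast; congr 1; ring
      have h2 : queue k A i T = max D 0 := rfl
      rw [h1, h2]
      rcases le_or_gt (D + δ) 0 with h | h
      · rw [max_eq_right h]; simpa using sq_nonneg _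
      · rw [max_eq_left h.le]
        have := le_max_left D 0
        exact pow_le_pow_left₀ h.le (by linarith) 2
    push_cast
    nlinarith

end Counts

/-- The total drift of the queues is at most `N T / 2`. -/
lemma sum_queue_mul_le (A : ℕ → Finset (Fin N)) {k : Fin N → ℝ} (hk : ∀ i, k i ≤ 1) (T : ℕ) :
    ∑ t ∈ Finset.range T, ∑ i, queue k A i t * ((if i ∈ A t then 1 else 0) - k i) ≤
      N * T / 2 := by
  rw [Finset.sum_comm]
  have : ∀ i : Fin N, ∑ t ∈ Finset.range T, queue k A i t * ((if i ∈ A t then 1 else 0) - k i) ≤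
      (T : ℝ) / 2 := by
    intro i
    have h := queue_sq_le A i (hk i) T
    have hneg : ∑ t ∈ Finset.range T, queue k A i t * (k i - if i ∈ A t then 1 else 0) =
        -∑ t ∈ Finset.range T, queue k A i t * ((if i ∈ A t then 1 else 0) - k i) := by
      rw [← Finset.sum_neg_distrib]
      exact Finset.sum_congr rfl fun t _ => by ring
    rw [hneg] at h
    nlinarith [sq_nonneg (queue k A i T)]
  refine (Finset.sum_le_sum fun i _ => this i).trans (le_of_eq ?_)
  simp; ring

/-! ### Expected rewards and queues in one round -/

section Probability

variable {Ω : Type*} {mΩ : MeasurableSpace Ω} {P : Measure Ω}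

lemma integrable_of_abs_le [IsFiniteMeasure P] {f : Ω → ℝ} (hf : Measurable f) {C : ℝ}
    (hb : ∀ ω, |f ω| ≤ C) : Integrable f P :=
  Integrable.of_bound hf.aestronglyMeasurable C (.of_forall hb)

lemma integrable_comp_discrete [IsFiniteMeasure P] {β : Type*} [Finite β] [MeasurableSpace β]
    [DiscreteMeasurableSpace β] {Y : Ω → β} (hY : Measurable Y) (g : β → ℝ) :
    Integrable (fun ω => g (Y ω)) P := by
  cases nonempty_fintype β
  refine integrable_of_abs_le (C := ∑ b, |g b|) (Measurable.of_discrete.comp hY) fun ω => ?_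
  exact Finset.single_le_sum (f := fun b => |g b|) (fun b _ => abs_nonneg _) (Finset.mem_univ (Y ω))

lemma integral_mul_indicator_of_condExp [IsFiniteMeasure P] {m : MeasurableSpace Ω} (hm : m ≤ mΩ)
    {E : Set Ω} (hE : MeasurableSet[mΩ] E) {f g : Ω → ℝ} (hf : Measurable[m] f) {C : ℝ}
    (hb : ∀ ω, |f ω| ≤ C) (hcond : P⟦E | m⟧ =ᵐ[P] g) :
    ∫ ω, f ω * E.indicator (fun _ => 1) ω ∂P = ∫ ω, f ω * g ω ∂P := by
  have hint : Integrable (E.indicator fun _ => (1 : ℝ)) P :=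
    (integrable_const _).indicator hE
  have h1 := condExp_stronglyMeasurable_mul_of_bound hm hf.stronglyMeasurable hint C
    (.of_forall hb)
  calc ∫ ω, f ω * E.indicator (fun _ => 1) ω ∂P
      = ∫ ω, (P[f * E.indicator (fun _ => (1 : ℝ)) | m]) ω ∂P := (integral_condExp hm).symm
    _ = ∫ ω, f ω * g ω ∂P := by
      refine integral_congr_ae ?_
      filter_upwards [h1, hcond] with ω h h'
      rw [h, Pi.mul_apply, h']

/-- The expectation of one coordinate of a vector of independent Bernoulli variables. -/
lemma sum_toNat_mul_prod (u : Fin N → ℝ) (i : Fin N) :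
    ∑ x : Fin N → Bool, ((x i).toNat : ℝ) * ∏ j, (if x j then u j else 1 - u j) = u i := by
  have h1 : ∀ x : Fin N → Bool, ((x i).toNat : ℝ) * ∏ j, (if x j then u j else 1 - u j) =
      ∏ j, (if j = i then ((x j).toNat : ℝ) else 1) * (if x j then u j else 1 - u j) := by
    intro x
    rw [Finset.prod_mul_distrib]
    simp
  simp_rw [h1]
  have h2 := Finset.prod_univ_sum (fun _ : Fin N => (Finset.univ : Finset Bool))
    (fun j b => (if j = i then (b.toNat : ℝ) else 1) * (if b then u j else 1 - u j))
  rw [Fintype.piFinset_univ] at h2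
  rw [← h2]
  have h3 : ∀ j, ∑ b : Bool, (if j = i then (b.toNat : ℝ) else 1) *
      (if b then u j else 1 - u j) = if j = i then u i else 1 := by
    intro j
    by_cases hj : j = i <;> simp [hj]
  rw [Finset.prod_congr rfl fun j _ => h3 j, Finset.prod_ite_eq' Finset.univ i]
  simp

/-- What is known in round `t` once the availability set is revealed. -/
abbrev pastAvail (ℱ : Filtration ℕ mΩ) (Z : ℕ → Ω → Finset (Fin N)) (t : ℕ) :
    MeasurableSpace Ω :=
  ℱ t ⊔ MeasurableSpace.comap (Z t) inferInstance

/-- What is known in round `t` before the rewards are drawn. -/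
abbrev preReward (ℱ : Filtration ℕ mΩ) (Z : ℕ → Ω → Finset (Fin N)) (θ : ℕ → Ω → Fin N → ℝ)
    (A Astar : ℕ → Ω → Finset (Fin N)) (t : ℕ) : MeasurableSpace Ω :=
  ℱ t ⊔ MeasurableSpace.comap (fun ω => (Z t ω, θ t ω, A t ω, Astar t ω)) inferInstance

namespace IsRun

variable {ℱ : Filtration ℕ mΩ} {T m : ℕ} {η : ℝ} {PZ : PMF (Finset (Fin N))} {k w u : Fin N → ℝ}
  {q : Finset (Fin N) → Finset (Fin N) → ℝ}
  {Z : ℕ → Ω → Finset (Fin N)} {θ : ℕ → Ω → Fin N → ℝ} {A : ℕ → Ω → Finset (Fin N)}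
  {X : ℕ → Ω → Fin N → Bool} {Astar : ℕ → Ω → Finset (Fin N)} {t : ℕ}

section Measurability

variable (h : IsRun P ℱ T m η PZ k w u q Z θ A X Astar)
include h

lemma meas_Z (ht : t < T) : Measurable (Z t) := (h.measurable_Z t ht).mono (ℱ.le _) le_rfl
lemma meas_θ (ht : t < T) : Measurable (θ t) := (h.measurable_θ t ht).mono (ℱ.le _) le_rfl
lemma meas_A (ht : t < T) : Measurable (A t) := (h.measurable_A t ht).mono (ℱ.le _) le_rfl
lemma meas_X (ht : t < T) : Measurable (X t) := (h.measurable_X t ht).mono (ℱ.le _) le_rfl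
lemma meas_Astar (ht : t < T) : Measurable (Astar t) :=
  (h.measurable_Astar t ht).mono (ℱ.le _) le_rfl


lemma pastAvail_le (ht : t < T) : pastAvail ℱ Z t ≤ mΩ :=
  sup_le (ℱ.le t) (measurable_iff_comap_le.1 (h.meas_Z ht))

lemma preReward_le (ht : t < T) : preReward ℱ Z θ A Astar t ≤ mΩ :=
  sup_le (ℱ.le t) (measurable_iff_comap_le.1
    ((h.meas_Z ht).prodMk ((h.meas_θ ht).prodMk ((h.meas_A ht).prodMk (h.meas_Astar ht)))))

lemma measurable_successes (i : Fin N) (ht : t ≤ T) :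
    Measurable[ℱ t] fun ω => successes (fun τ => A τ ω) (fun τ => X τ ω) i t := by
  induction t with
  | zero => exact measurable_const
  | succ t ih =>
    have h1 := (ih (by omega)).mono (ℱ.mono (Nat.le_succ t)) le_rfl
    have h2 := h.measurable_A t (by omega)
    have h3 := h.measurable_X t (by omega)
    refine h1.add ?_
    exact (Measurable.of_discrete (f := fun p : Finset (Fin N) × (Fin N → Bool) =>
      if i ∈ p.1 then (p.2 i).toNat else 0)).comp (h2.prodMk h3)

lemma measurable_failures (i : Fin N) (ht : t ≤ T) :
    Measurable[ℱ t] fun ω => failures (fun τ => A τ ω) (fun τ => X τ ω) i t := by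
  induction t with
  | zero => exact measurable_const
  | succ t ih =>
    have h1 := (ih (by omega)).mono (ℱ.mono (Nat.le_succ t)) le_rfl
    have h2 := h.measurable_A t (by omega)
    have h3 := h.measurable_X t (by omega)
    refine h1.add ?_
    exact (Measurable.of_discrete (f := fun p : Finset (Fin N) × (Fin N → Bool) =>
      if i ∈ p.1 then 1 - (p.2 i).toNat else 0)).comp (h2.prodMk h3)

lemma measurable_queue (i : Fin N) (ht : t ≤ T) :
    Measurable[ℱ t] fun ω => queue k (fun τ => A τ ω) i t := by
  unfold queue
  refine Measurable.max (Measurable.sub measurable_const ?_) measurable_const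
  refine Finset.measurable_sum _ fun τ hτ => ?_
  have hτ' := Finset.mem_range.1 hτ
  exact (Measurable.of_discrete (f := fun B : Finset (Fin N) => if i ∈ B then (1 : ℝ) else 0)).comp
    ((h.measurable_A τ (by omega)).mono (ℱ.mono (by omega)) le_rfl)

end Measurability

lemma measurable_preReward_round :
    Measurable[preReward ℱ Z θ A Astar t] fun ω => (Z t ω, θ t ω, A t ω, Astar t ω) :=
  (comap_measurable _).mono le_sup_right le_rfl

lemma measurable_preReward_A : Measurable[preReward ℱ Z θ A Astar t] (A t) :=
  measurable_fst.comp (measurable_snd.comp (measurable_snd.comp measurable_preReward_round))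

lemma measurable_preReward_Astar : Measurable[preReward ℱ Z θ A Astar t] (Astar t) :=
  measurable_snd.comp (measurable_snd.comp (measurable_snd.comp measurable_preReward_round))

section Expectations

variable [IsProbabilityMeasure P] (h : IsRun P ℱ T m η PZ k w u q Z θ A X Astar)
include h

/-- The reward of arm `i` in round `t` has conditional mean `u i`. -/
lemma integral_mul_reward (ht : t < T) (i : Fin N) {f : Ω → ℝ}
    (hf : Measurable[preReward ℱ Z θ A Astar t] f) {C : ℝ} (hb : ∀ ω, |f ω| ≤ C) :
    ∫ ω, f ω * ((X t ω i).toNat : ℝ) ∂P = u i * ∫ ω, f ω ∂P := by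
  have hle := h.preReward_le ht
  have hset : ∀ x, MeasurableSet {ω | X t ω = x} := fun x =>
    h.meas_X ht (measurableSet_singleton x)
  have h1 : ∀ ω, f ω * ((X t ω i).toNat : ℝ) = ∑ x : Fin N → Bool, ((x i).toNat : ℝ) *
      (f ω * {ω | X t ω = x}.indicator (fun _ => (1 : ℝ)) ω) := by
    intro ω
    rw [Finset.sum_eq_single (X t ω)]
    · simp [mul_comm]
    · intro x _ hx
      simp [hx.symm]
    · simp
  have hint : ∀ x, Integrable
      (fun ω => f ω * {ω | X t ω = x}.indicator (fun _ => (1 : ℝ)) ω) P := by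
    intro x
    refine integrable_of_abs_le (C := C)
      ((hf.mono hle le_rfl).mul (measurable_const.indicator (hset x))) fun ω => ?_
    rw [abs_mul]
    refine (mul_le_of_le_one_right (abs_nonneg _) ?_).trans (hb ω)
    by_cases hω : X t ω = x <;> simp [hω]
  simp_rw [h1]
  rw [integral_finsetSum _ fun x _ => (hint x).const_mul _]
  simp_rw [integral_const_mul]
  have h2 : ∀ x, ∫ ω, f ω * {ω | X t ω = x}.indicator (fun _ => (1 : ℝ)) ω ∂P =
      (∏ j, if x j then u j else 1 - u j) * ∫ ω, f ω ∂P := by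
    intro x
    rw [integral_mul_indicator_of_condExp hle (hset x) hf hb (h.law_X t ht x),
      integral_mul_const, mul_comm]
  simp_rw [h2, ← mul_assoc]
  rw [← Finset.sum_mul, sum_toNat_mul_prod]

lemma integral_reward (ht : t < T) {B : Ω → Finset (Fin N)}
    (hB : Measurable[preReward ℱ Z θ A Astar t] B) :
    ∫ ω, reward w (X t ω) (B ω) ∂P = ∫ ω, ∑ i ∈ B ω, w i * u i ∂P := by
  have hle := h.preReward_le ht
  have hind : ∀ i, Measurable[preReward ℱ Z θ A Astar t]
      fun ω => if i ∈ B ω then w i else 0 := fun i =>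
    (Measurable.of_discrete (f := fun S : Finset (Fin N) => if i ∈ S then w i else 0)).comp hB
  have hbd : ∀ i ω, |if i ∈ B ω then w i else 0| ≤ |w i| := fun i ω => by
    split_ifs <;> simp
  have e1 : ∀ ω, reward w (X t ω) (B ω) =
      ∑ i, (if i ∈ B ω then w i else 0) * ((X t ω i).toNat : ℝ) := by
    intro ω; simp [reward, ite_mul]
  have e2 : ∀ ω, ∑ i ∈ B ω, w i * u i = ∑ i, u i * (if i ∈ B ω then w i else 0) := by
    intro ω; simp [mul_comm]
  simp_rw [e1, e2]
  rw [integral_finsetSum, integral_finsetSum]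
  · refine Finset.sum_congr rfl fun i _ => ?_
    rw [h.integral_mul_reward ht i (hind i) (hbd i), integral_const_mul]
  · intro i _
    exact (integrable_of_abs_le ((hind i).mono hle le_rfl) (hbd i)).const_mul _
  · intro i _
    refine integrable_of_abs_le (C := |w i|) (((hind i).mono hle le_rfl).mul ?_) fun ω => ?_
    · exact (Measurable.of_discrete (f := fun x : Fin N → Bool => ((x i).toNat : ℝ))).comp
        (h.meas_X ht)
    · rw [abs_mul]
      refine (mul_le_of_le_one_right (abs_nonneg _) ?_).trans (hbd i ω)
      rw [abs_of_nonneg (Nat.cast_nonneg _)]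
      exact_mod_cast Bool.toNat_le _

/-- The optimal policy enters the regret only through its pulling probabilities. -/
lemma integral_sum_Astar (ht : t < T) (v : Fin N → ℝ) :
    ∫ ω, ∑ i ∈ Astar t ω, v i ∂P = ∫ ω, ∑ i, pullProb m q (Z t ω) i * v i ∂P := by
  have hset : ∀ B, MeasurableSet {ω | Astar t ω = B} := fun B =>
    h.meas_Astar ht (measurableSet_singleton B)
  have e1 : ∀ ω, ∑ i ∈ Astar t ω, v i = ∑ B : Finset (Fin N), (∑ i ∈ B, v i) *
      {ω | Astar t ω = B}.indicator (fun _ => (1 : ℝ)) ω := by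
    intro ω
    rw [Finset.sum_eq_single (Astar t ω)]
    · simp
    · intro x _ hx
      simp [hx.symm]
    · simp
  have e2 : ∀ ω, ∑ i, pullProb m q (Z t ω) i * v i = ∑ B : Finset (Fin N), (∑ i ∈ B, v i) *
      (if B ∈ admissible m (Z t ω) then q (Z t ω) B else 0) := by
    intro ω
    rw [← sum_q_mul_sum]
    simp [mul_comm]
  simp_rw [e1, e2]
  rw [integral_finsetSum, integral_finsetSum]
  · refine Finset.sum_congr rfl fun B _ => ?_
    rw [integral_const_mul, integral_const_mul]
    congr 1
    have := integral_mul_indicator_of_condExp (h.pastAvail_le ht) (hset B) (f := fun _ => (1 : ℝ))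
      measurable_const (C := 1) (by simp) (h.law_Astar t ht B)
    simpa using this
  · intro B _
    exact (integrable_comp_discrete (h.meas_Z ht)
      fun S => if B ∈ admissible m S then q S B else 0).const_mul _
  · intro B _
    exact ((integrable_const _).indicator (hset B)).const_mul _

/-- The pulling probabilities of a feasible policy serve the queues on average. -/
lemma integral_queue_mul_le (hq : IsFeasiblePolicy PZ m k q) (ht : t < T) (i : Fin N) :
    ∫ ω, queue k (fun τ => A τ ω) i t * (k i - pullProb m q (Z t ω) i) ∂P ≤ 0 := by
  set Q : Ω → ℝ := fun ω => queue k (fun τ => A τ ω) i t with hQ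
  have hQm : Measurable[ℱ t] Q := h.measurable_queue i ht.le
  have hQm' : Measurable Q := hQm.mono (ℱ.le _) le_rfl
  have hQ0 : ∀ ω, 0 ≤ Q ω := fun ω => queue_nonneg _ _ _ _
  have hQb : ∀ ω, |Q ω| ≤ t := fun ω => by
    rw [abs_of_nonneg (hQ0 ω)]; exact queue_le _ _ (k_le_one hq i) t
  have hQi : Integrable Q P := integrable_of_abs_le hQm' hQb
  have hset : ∀ S, MeasurableSet {ω | Z t ω = S} := fun S =>
    h.meas_Z ht (measurableSet_singleton S)
  have hint : ∀ S, Integrable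
      (fun ω => Q ω * {ω | Z t ω = S}.indicator (fun _ => (1 : ℝ)) ω) P := by
    intro S
    refine integrable_of_abs_le (C := t)
      (hQm'.mul (measurable_const.indicator (hset S))) fun ω => ?_
    rw [abs_mul]
    refine (mul_le_of_le_one_right (abs_nonneg _) ?_).trans (hQb ω)
    by_cases hω : Z t ω = S <;> simp [hω]
  have e1 : ∀ ω, Q ω * (k i - pullProb m q (Z t ω) i) = k i * Q ω - ∑ S, pullProb m q S i *
      (Q ω * {ω | Z t ω = S}.indicator (fun _ => (1 : ℝ)) ω) := by
    intro ω
    rw [Finset.sum_eq_single (Z t ω)]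
    · simp; ring
    · intro x _ hx
      simp [hx.symm]
    · simp
  rw [integral_congr_ae (.of_forall e1)]
  rw [integral_sub (hQi.const_mul _) (integrable_finsetSum _ fun S _ => (hint S).const_mul _),
    integral_finsetSum _ fun S _ => (hint S).const_mul _]
  have h2 : ∀ S, ∫ ω, Q ω * {ω | Z t ω = S}.indicator (fun _ => (1 : ℝ)) ω ∂P =
      (PZ S).toReal * ∫ ω, Q ω ∂P := by
    intro S
    rw [integral_mul_indicator_of_condExp (ℱ.le t) (hset S) hQm hQb (h.law_Z t ht S),
      integral_mul_const, mul_comm]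
  rw [integral_const_mul, Finset.sum_congr rfl fun S _ => by rw [integral_const_mul, h2 S]]
  have h3 : ∑ S, pullProb m q S i * ((PZ S).toReal * ∫ ω, Q ω ∂P) =
      (∑ S, (PZ S).toReal * pullProb m q S i) * ∫ ω, Q ω ∂P := by
    rw [Finset.sum_mul]; exact Finset.sum_congr rfl fun S _ => by ring
  rw [h3, ← sub_mul]
  exact mul_nonpos_of_nonpos_of_nonneg (sub_nonpos.2 (hq.fair i)) (integral_nonneg hQ0)

end Expectations

end IsRun

end Probability

/-! ### Telescoping sums over the pulls of an arm -/

lemma sum_mul_lintegral_le {α ι : Type*} {mα : MeasurableSpace α} (μ : Measure α) (s : Finset ι)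
    (p : ι → ℝ≥0∞) (f : ι → α → ℝ≥0∞) :
    ∑ j ∈ s, p j * ∫⁻ x, f j x ∂μ ≤ ∫⁻ x, ∑ j ∈ s, p j * f j x ∂μ := by
  classical
  induction s using Finset.induction_on with
  | empty => simp
  | insert j s hj ih =>
    simp only [Finset.sum_insert hj]
    exact (add_le_add (lintegral_const_mul_le _ _) ih).trans (le_lintegral_add _ _)

lemma lik_succ_left (s f : ℕ) (v : ℝ) : lik (s + 1) f v = v * lik s f v := by
  simp only [lik]; ring

lemma lik_succ_right (s f : ℕ) (v : ℝ) : lik s (f + 1) v = (1 - v) * lik s f v := by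
  simp only [lik]; ring

section Probability

variable {Ω : Type*} {mΩ : MeasurableSpace Ω} {P : Measure Ω}

namespace IsRun

variable {ℱ : Filtration ℕ mΩ} {T m : ℕ} {η : ℝ} {PZ : PMF (Finset (Fin N))} {k w u : Fin N → ℝ}
  {q : Finset (Fin N) → Finset (Fin N) → ℝ}
  {Z : ℕ → Ω → Finset (Fin N)} {θ : ℕ → Ω → Fin N → ℝ} {A : ℕ → Ω → Finset (Fin N)}
  {X : ℕ → Ω → Fin N → Bool} {Astar : ℕ → Ω → Finset (Fin N)} {t : ℕ}

/-- The number of rewarded pulls of arm `i` before round `t`, as a random variable. -/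
abbrev succ (A : ℕ → Ω → Finset (Fin N)) (X : ℕ → Ω → Fin N → Bool) (i : Fin N) (t : ℕ) (ω : Ω) :
    ℕ :=
  successes (fun τ => A τ ω) (fun τ => X τ ω) i t

/-- The number of unrewarded pulls of arm `i` before round `t`, as a random variable. -/
abbrev fail (A : ℕ → Ω → Finset (Fin N)) (X : ℕ → Ω → Fin N → Bool) (i : Fin N) (t : ℕ) (ω : Ω) :
    ℕ :=
  failures (fun τ => A τ ω) (fun τ => X τ ω) i t

lemma succ_le (i : Fin N) (t : ℕ) (ω : Ω) : succ A X i t ω ≤ t := by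
  have h1 := successes_add_failures (fun τ => A τ ω) (fun τ => X τ ω) i t
  have h2 := pulls_le (fun τ => A τ ω) i t
  simp only [succ]; omega

lemma fail_le (i : Fin N) (t : ℕ) (ω : Ω) : fail A X i t ω ≤ t := by
  have h1 := successes_add_failures (fun τ => A τ ω) (fun τ => X τ ω) i t
  have h2 := pulls_le (fun τ => A τ ω) i t
  simp only [fail]; omega

lemma abs_counts_le (g : ℕ → ℕ → ℝ) (i : Fin N) (t : ℕ) (ω : Ω) :
    |g (succ A X i t ω) (fail A X i t ω)| ≤
      ∑ a ∈ Finset.range (t + 1), ∑ b ∈ Finset.range (t + 1), |g a b| := by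
  have h1 : succ A X i t ω ∈ Finset.range (t + 1) :=
    Finset.mem_range.2 (Nat.lt_succ_of_le (succ_le i t ω))
  have h2 : fail A X i t ω ∈ Finset.range (t + 1) :=
    Finset.mem_range.2 (Nat.lt_succ_of_le (fail_le i t ω))
  refine (Finset.single_le_sum (f := fun b => |g (succ A X i t ω) b|)
    (fun b _ => abs_nonneg _) h2).trans ?_
  exact Finset.single_le_sum (f := fun a => ∑ b ∈ Finset.range (t + 1), |g a b|)
    (fun a _ => Finset.sum_nonneg fun b _ => abs_nonneg _) h1

section

variable (h : IsRun P ℱ T m η PZ k w u q Z θ A X Astar)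
include h

lemma measurable_counts (i : Fin N) (ht : t ≤ T) (g : ℕ → ℕ → ℝ) :
    Measurable[ℱ t] fun ω => g (succ A X i t ω) (fail A X i t ω) :=
  (Measurable.of_discrete (f := fun p : ℕ × ℕ => g p.1 p.2)).comp
    ((h.measurable_successes i ht).prodMk (h.measurable_failures i ht))

lemma measurable_ite_counts (i : Fin N) (ht : t < T) (g : ℕ → ℕ → ℝ) :
    Measurable[preReward ℱ Z θ A Astar t]
      fun ω => if i ∈ A t ω then g (succ A X i t ω) (fail A X i t ω) else 0 :=
  (Measurable.of_discrete (f := fun p : Finset (Fin N) × ℕ × ℕ =>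
    if i ∈ p.1 then g p.2.1 p.2.2 else 0)).comp (measurable_preReward_A.prodMk
    (((h.measurable_successes i ht.le).prodMk (h.measurable_failures i ht.le)).mono le_sup_left
      le_rfl))

omit h in
lemma abs_ite_counts_le (g : ℕ → ℕ → ℝ) (i : Fin N) (t : ℕ) (ω : Ω) :
    |if i ∈ A t ω then g (succ A X i t ω) (fail A X i t ω) else 0| ≤
      ∑ a ∈ Finset.range (t + 1), ∑ b ∈ Finset.range (t + 1), |g a b| := by
  refine le_trans ?_ (abs_counts_le (A := A) (X := X) g i t ω)
  split_ifs <;> simp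

variable [IsProbabilityMeasure P]

lemma integrable_counts (i : Fin N) (ht : t ≤ T) (g : ℕ → ℕ → ℝ) :
    Integrable (fun ω => g (succ A X i t ω) (fail A X i t ω)) P :=
  integrable_of_abs_le ((h.measurable_counts i ht g).mono (ℱ.le t) le_rfl) (abs_counts_le g i t)

lemma integrable_ite_counts (i : Fin N) (ht : t < T) (g : ℕ → ℕ → ℝ) :
    Integrable (fun ω => if i ∈ A t ω then g (succ A X i t ω) (fail A X i t ω) else 0) P :=
  integrable_of_abs_le ((h.measurable_ite_counts i ht g).mono (h.preReward_le ht) le_rfl)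
    (abs_ite_counts_le g i t)

/-- The expected one-step change of a function of the counts of arm `i`. -/
lemma integral_counts_step (i : Fin N) (ht : t < T) (g : ℕ → ℕ → ℝ) :
    ∫ ω, g (succ A X i (t + 1) ω) (fail A X i (t + 1) ω) ∂P =
      ∫ ω, g (succ A X i t ω) (fail A X i t ω) ∂P +
      ∫ ω, (if i ∈ A t ω then
        u i * g (succ A X i t ω + 1) (fail A X i t ω) +
          (1 - u i) * g (succ A X i t ω) (fail A X i t ω + 1) -
          g (succ A X i t ω) (fail A X i t ω) else 0) ∂P := by
  set g1 : ℕ → ℕ → ℝ := fun a b => g a (b + 1) - g a b with hg1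
  set g2 : ℕ → ℕ → ℝ := fun a b => g (a + 1) b - g a (b + 1) with hg2
  have e : ∀ ω, g (succ A X i (t + 1) ω) (fail A X i (t + 1) ω) =
      g (succ A X i t ω) (fail A X i t ω) +
        (if i ∈ A t ω then g1 (succ A X i t ω) (fail A X i t ω) else 0) +
        (if i ∈ A t ω then g2 (succ A X i t ω) (fail A X i t ω) else 0) *
          ((X t ω i).toNat : ℝ) := by
    intro ω
    simp only [succ, fail, successes, failures]
    split_ifs
    · cases X t ω i <;> simp [hg1, hg2]
    · simp
  have hi := h.integrable_counts i ht.le g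
  have hi1 := h.integrable_ite_counts i ht g1
  have hi2 := h.integrable_ite_counts i ht g2
  have hi3 : Integrable (fun ω => (if i ∈ A t ω then g2 (succ A X i t ω) (fail A X i t ω) else 0) *
      ((X t ω i).toNat : ℝ)) P := by
    refine hi2.mul_bdd (c := 1) ?_ (.of_forall fun ω => ?_)
    · exact ((Measurable.of_discrete (f := fun x : Fin N → Bool => ((x i).toNat : ℝ))).comp
        (h.meas_X ht)).aestronglyMeasurable
    · rw [Real.norm_of_nonneg (Nat.cast_nonneg _)]
      exact_mod_cast Bool.toNat_le _
  have hi12 : Integrable (fun ω => g (succ A X i t ω) (fail A X i t ω) +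
      if i ∈ A t ω then g1 (succ A X i t ω) (fail A X i t ω) else 0) P := hi.add hi1
  rw [integral_congr_ae (.of_forall e), integral_add hi12 hi3, integral_add hi hi1,
    h.integral_mul_reward ht i (h.measurable_ite_counts i ht g2) (abs_ite_counts_le g2 i t),
    add_assoc, ← integral_const_mul, ← integral_add hi1 (hi2.const_mul _)]
  congr 1
  refine integral_congr_ae (.of_forall fun ω => ?_)
  simp only [hg1, hg2]
  split_ifs <;> ring

/-- The likelihood ratio of `y` against `v` is a supermartingale for `y < v < u i`. In each pull its
expectation is multiplied by `1 - (v - y) (u i - v) / (v (1 - v))`, so that the sum over all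
pulls telescopes. -/
lemma sum_integral_lik_ratio_le (i : Fin N) (hu : u i ≤ 1) {y v : ℝ} (hy : 0 < y) (hyv : y < v)
    (hv : v < u i) :
    ∑ t ∈ Finset.range T, ∫ ω, (if i ∈ A t ω then
      lik (succ A X i t ω) (fail A X i t ω) y / lik (succ A X i t ω) (fail A X i t ω) v else 0) ∂P ≤
      min (T : ℝ) (1 / (4 * ((v - y) * (u i - v)))) := by
  have hv0 : 0 < v := hy.trans hyv
  have hv1 : v < 1 := hv.trans_le hu
  have hy1 : y < 1 := hyv.trans hv1
  set g : ℕ → ℕ → ℝ := fun a b => lik a b y / lik a b v with hg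
  have hgpos : ∀ a b, 0 < g a b := fun a b => div_pos (lik_pos a b hy hy1) (lik_pos a b hv0 hv1)
  set δ : ℝ := (v - y) * (u i - v) / (v * (1 - v)) with hδ
  have h1v : 0 < 1 - v := sub_pos.2 hv1
  have hd : 0 < (v - y) * (u i - v) := mul_pos (sub_pos.2 hyv) (sub_pos.2 hv)
  have hδ0 : 0 < δ := by positivity
  -- a pull multiplies the ratio by `y / v` or by `(1 - y) / (1 - v)`, which on average is `1 - δ`
  have hstep : ∀ a b, u i * g (a + 1) b + (1 - u i) * g a (b + 1) - g a b = -δ * g a b := by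
    intro a b
    have hl := (lik_pos a b hv0 hv1).ne'
    simp only [hg, lik_succ_left, lik_succ_right, hδ]
    field_simp
    ring
  set a : ℕ → ℝ := fun t => ∫ ω, g (succ A X i t ω) (fail A X i t ω) ∂P with ha
  set b : ℕ → ℝ := fun t =>
    ∫ ω, (if i ∈ A t ω then g (succ A X i t ω) (fail A X i t ω) else 0) ∂P with hb
  have hab : ∀ t < T, a (t + 1) = a t - δ * b t := by
    intro t ht
    simp only [ha, hb]
    rw [h.integral_counts_step i ht g, sub_eq_add_neg _ (δ * _), ← neg_mul, ← integral_const_mul]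
    congr 1
    refine integral_congr_ae (.of_forall fun ω => ?_)
    simp only [hstep]
    split_ifs <;> ring
  have hb0 : ∀ t, 0 ≤ b t := fun t => integral_nonneg fun ω => by
    dsimp only; split_ifs
    · exact (hgpos _ _).le
    · exact le_rfl
  have ha0 : ∀ t, 0 ≤ a t := fun t => integral_nonneg fun ω => (hgpos _ _).le
  have hsum : ∀ n ≤ T, a n + δ * ∑ t ∈ Finset.range n, b t = 1 := by
    intro n
    induction n with
    | zero => intro _; simp [ha, hg, succ, fail, successes, failures, lik]
    | succ n ih =>
      intro hn
      rw [Finset.sum_range_succ, hab n (by omega)]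
      linarith [ih (by omega)]
  have hba : ∀ t < T, b t ≤ 1 := by
    intro t ht
    have h1 : b t ≤ a t := by
      refine integral_mono (h.integrable_ite_counts i ht g) (h.integrable_counts i ht.le g)
        fun ω => ?_
      dsimp only; split_ifs
      · exact le_rfl
      · exact (hgpos _ _).le
    have := hsum t ht.le
    have : 0 ≤ δ * ∑ t ∈ Finset.range t, b t :=
      mul_nonneg hδ0.le (Finset.sum_nonneg fun t _ => hb0 t)
    linarith
  refine le_min ?_ ?_
  · calc ∑ t ∈ Finset.range T, b t ≤ ∑ t ∈ Finset.range T, (1 : ℝ) :=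
          Finset.sum_le_sum fun t ht => hba t (Finset.mem_range.1 ht)
      _ = T := by simp
  · have h1 := hsum T le_rfl
    have h2 : δ * ∑ t ∈ Finset.range T, b t ≤ 1 := by linarith [ha0 T]
    have h3 : ∑ t ∈ Finset.range T, b t ≤ 1 / δ := by
      rw [le_div_iff₀ hδ0]; linarith
    refine h3.trans ?_
    rw [hδ, one_div_div, div_le_div_iff₀ hd (by positivity)]
    -- `v (1 - v) ≤ 1 / 4`
    nlinarith [sq_nonneg (2 * v - 1)]

omit [IsProbabilityMeasure P] in
/-- Only finitely many values of the counts occur. This reduces integrals of functions of the counts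
to finite sums, also where the function is itself an integral. -/
lemma lintegral_ite_counts (i : Fin N) (ht : t < T) (G : ℕ → ℕ → ℝ≥0∞) :
    ∫⁻ ω, (if i ∈ A t ω then G (succ A X i t ω) (fail A X i t ω) else 0) ∂P =
      ∑ p ∈ Finset.range (T + 1) ×ˢ Finset.range (T + 1),
        P {ω | i ∈ A t ω ∧ succ A X i t ω = p.1 ∧ fail A X i t ω = p.2} * G p.1 p.2 := by
  have hmeas : ∀ p : ℕ × ℕ, MeasurableSet
      {ω | i ∈ A t ω ∧ succ A X i t ω = p.1 ∧ fail A X i t ω = p.2} := by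
    intro p
    have hm : Measurable fun ω => (A t ω, succ A X i t ω, fail A X i t ω) :=
      (h.meas_A ht).prodMk (((h.measurable_successes i ht.le).mono (ℱ.le _) le_rfl).prodMk
        ((h.measurable_failures i ht.le).mono (ℱ.le _) le_rfl))
    exact hm (MeasurableSet.of_discrete
      (s := {x : Finset (Fin N) × ℕ × ℕ | i ∈ x.1 ∧ x.2.1 = p.1 ∧ x.2.2 = p.2}))
  have e : ∀ ω, (if i ∈ A t ω then G (succ A X i t ω) (fail A X i t ω) else 0) =
      ∑ p ∈ Finset.range (T + 1) ×ˢ Finset.range (T + 1),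
        {ω | i ∈ A t ω ∧ succ A X i t ω = p.1 ∧ fail A X i t ω = p.2}.indicator
          (fun _ => G p.1 p.2) ω := by
    intro ω
    rw [Finset.sum_eq_single (succ A X i t ω, fail A X i t ω)]
    · by_cases hi : i ∈ A t ω <;> simp [hi]
    · intro p _ hp
      refine indicator_of_notMem (fun hh => hp ?_) _
      exact Prod.ext hh.2.1.symm hh.2.2.symm
    · intro hp
      refine absurd (Finset.mem_product.2 ⟨?_, ?_⟩) hp <;> rw [Finset.mem_range]
      · have := succ_le (A := A) (X := X) i t ω; omega
      · have := fail_le (A := A) (X := X) i t ω; omega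
  simp_rw [e]
  rw [lintegral_finsetSum _ fun p _ => measurable_const.indicator (hmeas p)]
  refine Finset.sum_congr rfl fun p _ => ?_
  rw [lintegral_indicator_const (hmeas p), mul_comm]

/-- The expected exploration potential, summed over the pulls of an arm. The double integral that
defines the potential is interchanged with the sum over the pulls, and the likelihood ratios under
it are summed by `sum_integral_lik_ratio_le`. -/
lemma sum_lintegral_potential_le (i : Fin N) (hu : u i ≤ 1) (hT : 1 ≤ T) {ε : ℝ} (hε : 0 < ε) :
    ∑ t ∈ Finset.range T, ∫⁻ ω, (if i ∈ A t ω then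
      potential ε (u i) (succ A X i t ω) (fail A X i t ω) else 0) ∂P ≤
      ENNReal.ofReal (3 / 4 * (1 + Real.log T) / ε) := by
  -- the expected number of pulls that occur at given counts
  set p : ℕ × ℕ → ℝ≥0∞ := fun x => ∑ t ∈ Finset.range T,
    P {ω | i ∈ A t ω ∧ succ A X i t ω = x.1 ∧ fail A X i t ω = x.2} with hp
  set s := Finset.range (T + 1) ×ˢ Finset.range (T + 1)
  have hG : ∀ G : ℕ → ℕ → ℝ≥0∞, ∑ t ∈ Finset.range T, ∫⁻ ω, (if i ∈ A t ω then
      G (succ A X i t ω) (fail A X i t ω) else 0) ∂P = ∑ x ∈ s, p x * G x.1 x.2 := by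
    intro G
    rw [Finset.sum_congr rfl fun t ht => h.lintegral_ite_counts i (Finset.mem_range.1 ht) G,
      Finset.sum_comm]
    exact Finset.sum_congr rfl fun x _ => (Finset.sum_mul _ _ _).symm
  rw [hG]
  unfold potential
  refine (sum_mul_lintegral_le _ _ _ _).trans ?_
  refine le_trans ?_ (lintegral_psi_mul_min_le hε hu (T := T) (by exact_mod_cast hT))
  refine setLIntegral_mono' measurableSet_Ioo fun v hv => ?_
  refine (sum_mul_lintegral_le _ _ _ _).trans ?_
  refine setLIntegral_mono' measurableSet_Ioo fun y hy => ?_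
  have e : ∑ x ∈ s, p x * (ENNReal.ofReal (psi ε (u i - v)) *
      ENNReal.ofReal (lik x.1 x.2 y / lik x.1 x.2 v)) = ENNReal.ofReal (psi ε (u i - v)) *
      ∑ x ∈ s, p x * ENNReal.ofReal (lik x.1 x.2 y / lik x.1 x.2 v) := by
    rw [Finset.mul_sum]; exact Finset.sum_congr rfl fun x _ => by ring
  rw [e]
  refine mul_le_mul_right ?_ _
  rw [← hG fun a b => ENNReal.ofReal (lik a b y / lik a b v)]
  refine le_trans (le_of_eq ?_)
    (ENNReal.ofReal_le_ofReal (h.sum_integral_lik_ratio_le i hu hy.1 hy.2 hv.2))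
  have hpos : ∀ a b, 0 ≤ lik a b y / lik a b v := fun a b =>
    (div_pos (lik_pos a b hy.1 (hy.2.trans (hv.2.trans_le hu)))
      (lik_pos a b hv.1 (hv.2.trans_le hu))).le
  have hite : ∀ t ω, 0 ≤ (if i ∈ A t ω then
      lik (succ A X i t ω) (fail A X i t ω) y / lik (succ A X i t ω) (fail A X i t ω) v else 0) :=
    fun t ω => by
      split_ifs
      · exact hpos _ _
      · exact le_rfl
  rw [ENNReal.ofReal_sum_of_nonneg fun t _ => integral_nonneg (hite t)]
  refine Finset.sum_congr rfl fun t ht => ?_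
  rw [ofReal_integral_eq_lintegral_ofReal (h.integrable_ite_counts i (Finset.mem_range.1 ht)
    fun a b => lik a b y / lik a b v) (.of_forall (hite t))]
  refine lintegral_congr fun ω => ?_
  split_ifs <;> simp

/-- Telescoping: the squared deviation of the empirical mean, summed over the pulls of an arm,
grows only logarithmically. The potential function is `2 / (2 n + 1)` times the square of the
martingale `S - n u`. -/
lemma sum_integral_sq_dev_le (i : Fin N) (hT : 0 < T) :
    ∑ t ∈ Finset.range T, ∫ ω, (if i ∈ A t ω then
      (((succ A X i t ω : ℝ) - (succ A X i t ω + fail A X i t ω) * u i) /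
        (succ A X i t ω + fail A X i t ω + 1)) ^ 2 else 0) ∂P ≤ (1 + Real.log T) / 4 := by
  set M : ℕ → ℕ → ℝ := fun a b => (a : ℝ) - (a + b) * u i with hM
  set g : ℕ → ℕ → ℝ := fun a b => M a b ^ 2 * (2 / (2 * (a + b) + 1)) with hg
  set d : ℕ → ℕ → ℝ := fun a b => (M a b / (a + b + 1)) ^ 2 with hd
  set r : ℕ → ℕ → ℝ := fun a b => 1 / ((a + b : ℝ) + 1) with hr
  have hstep : ∀ a b, d a b ≤
      1 / 4 * r a b - (u i * g (a + 1) b + (1 - u i) * g a (b + 1) - g a b) := by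
    intro a b
    have ha : (0 : ℝ) ≤ a := Nat.cast_nonneg a
    have hb : (0 : ℝ) ≤ b := Nat.cast_nonneg b
    set n : ℝ := (a : ℝ) + b with hn
    have hn0 : 0 ≤ n := by positivity
    have e1 : u i * g (a + 1) b + (1 - u i) * g a (b + 1) =
        (M a b ^ 2 + u i * (1 - u i)) * (2 / (2 * n + 3)) := by
      simp only [hg, hM]; push_cast
      have c1 : (2 * ((a : ℝ) + 1 + b) + 1) = 2 * n + 3 := by rw [hn]; ring
      have c2 : (2 * ((a : ℝ) + (b + 1)) + 1) = 2 * n + 3 := by rw [hn]; ring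
      rw [c1, c2, hn]; ring
    have e2 : g a b = M a b ^ 2 * (2 / (2 * n + 1)) := rfl
    have e3 : d a b = M a b ^ 2 * (1 / (n + 1) ^ 2) := by
      simp only [hd, div_pow]; rw [← hn]; ring
    have e4 : r a b = 1 / (n + 1) := rfl
    have i1 : 1 / (n + 1) ^ 2 ≤ 2 / (2 * n + 1) - 2 / (2 * n + 3) := by
      rw [div_sub_div _ _ (by positivity) (by positivity), div_le_div_iff₀ (by positivity)
        (by positivity)]
      nlinarith
    have i2 : u i * (1 - u i) * (2 / (2 * n + 3)) ≤ 1 / 4 * (1 / (n + 1)) := by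
      have j1 : u i * (1 - u i) ≤ 1 / 4 := by nlinarith [sq_nonneg (2 * u i - 1)]
      have j2 : 2 / (2 * n + 3) ≤ 1 / (n + 1) := by
        rw [div_le_div_iff₀ (by positivity) (by positivity)]; linarith
      exact (mul_le_mul_of_nonneg_right j1 (by positivity)).trans
        (mul_le_mul_of_nonneg_left j2 (by norm_num))
    have i3 := mul_le_mul_of_nonneg_left i1 (sq_nonneg (M a b))
    rw [e1, e2, e3, e4]
    linarith
  set Y : ℕ → ℝ := fun t => ∫ ω, g (succ A X i t ω) (fail A X i t ω) ∂P with hY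
  have hone : ∀ t < T, ∫ ω, (if i ∈ A t ω then d (succ A X i t ω) (fail A X i t ω) else 0) ∂P ≤
      1 / 4 * ∫ ω, (if i ∈ A t ω then r (succ A X i t ω) (fail A X i t ω) else 0) ∂P -
        (Y (t + 1) - Y t) := by
    intro t ht
    simp only [hY]
    rw [h.integral_counts_step i ht g, add_sub_cancel_left, ← integral_const_mul, ← integral_sub
      ((h.integrable_ite_counts i ht r).const_mul _) (h.integrable_ite_counts i ht
        fun a b => u i * g (a + 1) b + (1 - u i) * g a (b + 1) - g a b)]
    refine integral_mono (h.integrable_ite_counts i ht d)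
      (((h.integrable_ite_counts i ht r).const_mul _).sub (h.integrable_ite_counts i ht
        fun a b => u i * g (a + 1) b + (1 - u i) * g a (b + 1) - g a b)) fun ω => ?_
    dsimp only
    split_ifs
    · exact hstep _ _
    · simp
  have hY0 : Y 0 = 0 := by simp [hY, hg, hM, succ, fail, successes, failures]
  have hYT : 0 ≤ Y T := integral_nonneg fun ω => by simp only [hg]; positivity
  have hrsum : ∑ t ∈ Finset.range T,
      ∫ ω, (if i ∈ A t ω then r (succ A X i t ω) (fail A X i t ω) else 0) ∂P ≤ 1 + Real.log T := by
    rw [← integral_finsetSum _ fun t ht => h.integrable_ite_counts i (Finset.mem_range.1 ht) r]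
    calc _ ≤ ∫ _ω, (1 + Real.log T) ∂P := by
          refine integral_mono (integrable_finsetSum _ fun t ht =>
            h.integrable_ite_counts i (Finset.mem_range.1 ht) r) (integrable_const _) fun ω => ?_
          refine le_trans (le_of_eq (Finset.sum_congr rfl fun t _ => ?_))
            (sum_inv_le (fun τ => A τ ω) i hT)
          rw [← successes_add_failures (fun τ => A τ ω) (fun τ => X τ ω) i t]
          simp only [hr]; push_cast; rfl
      _ = _ := by simp
  calc _ ≤ ∑ t ∈ Finset.range T,
        (1 / 4 * ∫ ω, (if i ∈ A t ω then r (succ A X i t ω) (fail A X i t ω) else 0) ∂P -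
        (Y (t + 1) - Y t)) := Finset.sum_le_sum fun t ht => hone t (Finset.mem_range.1 ht)
    _ ≤ _ := by
      rw [Finset.sum_sub_distrib, ← Finset.mul_sum, Finset.sum_range_sub, hY0]
      linarith

end

end IsRun

end Probability

/-! ### The conditional law of the samples -/

section Probability

variable {Ω : Type*} {mΩ : MeasurableSpace Ω} {P : Measure Ω}

/-- Comparison of two integrals on the fibres of a random variable with finitely many values. -/
lemma lintegral_le_of_fibers {β : Type*} [Finite β] [MeasurableSpace β]
    [DiscreteMeasurableSpace β] {Y : Ω → β} (hY : Measurable Y) {f g : Ω → ℝ≥0∞}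
    (hfg : ∀ ω₀, ∫⁻ ω in Y ⁻¹' {Y ω₀}, f ω ∂P ≤ ∫⁻ ω in Y ⁻¹' {Y ω₀}, g ω ∂P) :
    ∫⁻ ω, f ω ∂P ≤ ∫⁻ ω, g ω ∂P := by
  have hcover : (⋃ b : β, Y ⁻¹' {b}) = univ := by
    ext ω; simp
  have hdisj : Pairwise (Function.onFun Disjoint fun b : β => Y ⁻¹' {b}) := fun a b hab =>
    Disjoint.preimage Y (by simpa using hab)
  have hm : ∀ b : β, MeasurableSet (Y ⁻¹' {b}) := fun b => hY (MeasurableSet.of_discrete)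
  rw [← setLIntegral_univ f, ← setLIntegral_univ g, ← hcover, lintegral_iUnion hm hdisj,
    lintegral_iUnion hm hdisj]
  refine ENNReal.tsum_le_tsum fun b => ?_
  by_cases hb : ∃ ω₀, Y ω₀ = b
  · obtain ⟨ω₀, rfl⟩ := hb
    exact hfg ω₀
  · have : Y ⁻¹' {b} = ∅ := by
      ext ω; simp only [mem_preimage, mem_singleton_iff, mem_empty_iff_false, iff_false]
      exact fun hω => hb ⟨ω, hω⟩
    simp [this]

/-- The discrete part of the history at the moment when the samples of round `t` are drawn. -/
def hist (Z A : ℕ → Ω → Finset (Fin N)) (X : ℕ → Ω → Fin N → Bool) (t : ℕ) (ω : Ω) :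
    Finset (Fin N) × (Fin t → Finset (Fin N) × (Fin N → Bool)) :=
  (Z t ω, fun τ => (A τ ω, X τ ω))

/-- The law of one sample of the posterior of the arms in `S`; arms outside `S` get the value
`0`. -/
def sampleLaw (S : Finset (Fin N)) (a b : Fin N → ℕ) (j : Fin N) : Measure ℝ :=
  if j ∈ S then betaMeasure ((a j + 1 : ℕ) : ℝ) ((b j + 1 : ℕ) : ℝ) else Measure.dirac 0

instance isProbabilityMeasure_sampleLaw (S : Finset (Fin N)) (a b : Fin N → ℕ) (j : Fin N) :
    IsProbabilityMeasure (sampleLaw S a b j) := by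
  unfold sampleLaw
  split_ifs
  · exact isProbabilityMeasureBeta (by positivity) (by positivity)
  · infer_instance

namespace IsRun

variable {ℱ : Filtration ℕ mΩ} {T m : ℕ} {η : ℝ} {PZ : PMF (Finset (Fin N))} {k w u : Fin N → ℝ}
  {q : Finset (Fin N) → Finset (Fin N) → ℝ}
  {Z : ℕ → Ω → Finset (Fin N)} {θ : ℕ → Ω → Fin N → ℝ} {A : ℕ → Ω → Finset (Fin N)}
  {X : ℕ → Ω → Fin N → Bool} {Astar : ℕ → Ω → Finset (Fin N)} {t : ℕ}

lemma hist_eq {ω ω₀ : Ω} (hω : hist Z A X t ω = hist Z A X t ω₀) :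
    Z t ω = Z t ω₀ ∧ ∀ τ < t, A τ ω = A τ ω₀ ∧ X τ ω = X τ ω₀ := by
  refine ⟨congrArg Prod.fst hω, fun τ hτ => ?_⟩
  have := congrFun (congrArg Prod.snd hω) ⟨τ, hτ⟩
  exact ⟨congrArg Prod.fst this, congrArg Prod.snd this⟩

lemma succ_congr {ω ω₀ : Ω} (hω : hist Z A X t ω = hist Z A X t ω₀) (i : Fin N) :
    succ A X i t ω = succ A X i t ω₀ :=
  successes_congr fun τ hτ => (hist_eq hω).2 τ hτ

lemma fail_congr {ω ω₀ : Ω} (hω : hist Z A X t ω = hist Z A X t ω₀) (i : Fin N) :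
    fail A X i t ω = fail A X i t ω₀ :=
  failures_congr fun τ hτ => (hist_eq hω).2 τ hτ

variable (h : IsRun P ℱ T m η PZ k w u q Z θ A X Astar)
include h

lemma measurable_hist_pastAvail (ht : t < T) : Measurable[pastAvail ℱ Z t] (hist Z A X t) := by
  have hpast : Measurable[ℱ t] fun ω (τ : Fin t) => (A τ ω, X τ ω) :=
    @measurable_pi_lambda _ _ _ (ℱ t) _ _ fun τ =>
      ((h.measurable_A τ (by omega)).mono (ℱ.mono (by omega)) le_rfl).prodMk
        ((h.measurable_X τ (by omega)).mono (ℱ.mono (by omega)) le_rfl)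
  exact ((comap_measurable (Z t)).mono le_sup_right le_rfl).prodMk
    (hpast.mono le_sup_left le_rfl)

lemma measurable_hist (ht : t < T) : Measurable (hist Z A X t) :=
  (h.measurable_hist_pastAvail ht).mono (h.pastAvail_le ht) le_rfl

variable [IsProbabilityMeasure P]

/-- On an atom of the discrete history the current parameters are constants, and the samples of the
available arms are independent with their beta distributions. The samples of the other arms, of
which nothing is known, are replaced by `0`. -/
lemma map_sample (ht : t < T) (ω₀ : Ω) :
    (P.restrict (hist Z A X t ⁻¹' {hist Z A X t ω₀})).map
      (fun ω j => if j ∈ Z t ω₀ then θ t ω j else 0) =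
    P (hist Z A X t ⁻¹' {hist Z A X t ω₀}) • Measure.pi
      (sampleLaw (Z t ω₀) (fun j => succ A X j t ω₀) (fun j => fail A X j t ω₀)) := by
  set S := Z t ω₀ with hS
  set E := hist Z A X t ⁻¹' {hist Z A X t ω₀} with hE
  set ν := sampleLaw S (fun j => succ A X j t ω₀) (fun j => fail A X j t ω₀) with hν
  have hEm' : MeasurableSet[pastAvail ℱ Z t] E :=
    h.measurable_hist_pastAvail ht MeasurableSet.of_discrete
  have hEm : MeasurableSet E := h.pastAvail_le ht _ hEm'
  have hθ' : Measurable fun ω j => if j ∈ S then θ t ω j else 0 := by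
    refine measurable_pi_lambda _ fun j => ?_
    split_ifs
    · exact (measurable_pi_apply j).comp (h.meas_θ ht)
    · exact measurable_const
  have hZE : ∀ ω ∈ E, Z t ω = S := fun ω hω => (hist_eq hω).1
  have hbox : ∀ b : Fin N → Set ℝ, (∀ j, MeasurableSet (b j)) →
      (P.restrict E).map (fun ω j => if j ∈ S then θ t ω j else 0) (univ.pi b) =
        P E * ∏ j, ν j (b j) := by
    intro b hb
    rw [Measure.map_apply hθ' (.univ_pi hb), Measure.restrict_apply (hθ' (.univ_pi hb))]
    -- a side that misses the value `0` of an unavailable arm makes both measures vanish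
    by_cases hz : ∃ j, j ∉ S ∧ (0 : ℝ) ∉ b j
    · obtain ⟨j, hjS, hj⟩ := hz
      have h1 : (fun ω j => if j ∈ S then θ t ω j else 0) ⁻¹' univ.pi b ∩ E = ∅ := by
        ext ω
        simp only [mem_inter_iff, mem_preimage, mem_univ_pi, mem_empty_iff_false, iff_false]
        intro hh
        have := hh.1 j
        rw [if_neg hjS] at this
        exact hj this
      have h2 : ν j (b j) = 0 := by
        rw [hν, sampleLaw, if_neg hjS, Measure.dirac_apply' _ (hb j)]
        simp [hj]
      rw [h1, measure_empty, Finset.prod_eq_zero (Finset.mem_univ j) h2, mul_zero]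
    push Not at hz
    set F : Set Ω := {ω | ∀ i ∈ Z t ω, θ t ω i ∈ b i} with hF
    have h1 : (fun ω j => if j ∈ S then θ t ω j else 0) ⁻¹' univ.pi b ∩ E = F ∩ E := by
      ext ω
      simp only [mem_inter_iff, mem_preimage, mem_univ_pi, and_congr_left_iff, hF, mem_ofPred_eq]
      intro hω
      rw [hZE ω hω]
      constructor
      · intro hh i hi
        have := hh i
        rwa [if_pos hi] at this
      · intro hh i
        by_cases hi : i ∈ S
        · rw [if_pos hi]; exact hh i hi
        · rw [if_neg hi]; exact hz i hi
    have hFm : MeasurableSet F := by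
      have : F = ⋃ S' : Finset (Fin N), {ω | Z t ω = S'} ∩
          {ω | ∀ i ∈ S', θ t ω i ∈ b i} := by
        ext ω; simp [hF]
      rw [this]
      refine MeasurableSet.iUnion fun S' => (h.meas_Z ht (measurableSet_singleton S')).inter ?_
      have : {ω | ∀ i ∈ S', θ t ω i ∈ b i} = ⋂ i ∈ S', {ω | θ t ω i ∈ b i} := by
        ext ω; simp
      rw [this]
      exact MeasurableSet.biInter S'.countable_toSet fun i _ =>
        ((measurable_pi_apply i).comp (h.meas_θ ht)) (hb i)
    have hint := integral_mul_indicator_of_condExp (h.pastAvail_le ht) hFm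
      (f := E.indicator fun _ => (1 : ℝ)) (measurable_const.indicator hEm') (C := 1)
      (fun ω => by by_cases hω : ω ∈ E <;> simp [hω]) (h.law_θ t ht b hb)
    have e1 : ∀ ω, E.indicator (fun _ => (1 : ℝ)) ω * F.indicator (fun _ => 1) ω =
        (F ∩ E).indicator (fun _ => 1) ω := by
      intro ω
      by_cases h1 : ω ∈ E <;> by_cases h2 : ω ∈ F <;> simp [h1, h2]
    have e2 : ∀ ω, E.indicator (fun _ => (1 : ℝ)) ω * ∏ i ∈ Z t ω,
        (betaMeasure (alphaParam (fun τ => A τ ω) (fun τ => X τ ω) i t : ℝ)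
          (betaParam (fun τ => A τ ω) (fun τ => X τ ω) i t : ℝ)).real (b i) =
        (∏ i ∈ S, (ν i).real (b i)) * E.indicator (fun _ => (1 : ℝ)) ω := by
      intro ω
      by_cases hω : ω ∈ E
      · rw [mul_comm]
        congr 1
        rw [hZE ω hω]
        refine Finset.prod_congr rfl fun i hi => ?_
        rw [alphaParam_eq, betaParam_eq, hν, sampleLaw, if_pos hi, ← succ_congr hω i,
          ← fail_congr hω i]
      · simp [hω]
    rw [integral_congr_ae (.of_forall e1), integral_congr_ae (.of_forall e2), integral_const_mul,
      integral_indicator_const _ (hFm.inter hEm), integral_indicator_const _ hEm] at hint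
    simp only [smul_eq_mul, mul_one] at hint
    have hprod : ∏ j, ν j (b j) = ∏ j ∈ S, ν j (b j) := by
      refine (Finset.prod_subset (Finset.subset_univ S) fun j _ hj => ?_).symm
      rw [hν, sampleLaw, if_neg hj, Measure.dirac_apply' _ (hb j)]
      simp [hz j hj]
    rw [h1, hprod, ← ENNReal.toReal_eq_toReal_iff' (measure_ne_top _ _)
      (ENNReal.mul_ne_top (measure_ne_top _ _)
        (ENNReal.prod_ne_top fun j _ => measure_ne_top _ _)), ENNReal.toReal_mul,
      ENNReal.toReal_prod, mul_comm]
    exact hint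
  by_cases hPE : P E = 0
  · rw [hPE, zero_smul, Measure.restrict_eq_zero.2 hPE, Measure.map_zero]
  · have hpi : Measure.pi ν =
        (P E)⁻¹ • (P.restrict E).map (fun ω j => if j ∈ S then θ t ω j else 0) := by
      refine Measure.pi_eq fun b hb => ?_
      rw [Measure.smul_apply, hbox b hb, smul_eq_mul, ← mul_assoc,
        ENNReal.inv_mul_cancel hPE (measure_ne_top _ _), one_mul]
    rw [hpi, smul_smul, ENNReal.mul_inv_cancel hPE (measure_ne_top _ _), one_smul]

lemma lintegral_sample (ht : t < T) (ω₀ : Ω) {Φ : (Fin N → ℝ) → ℝ≥0∞} (hΦ : Measurable Φ) :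
    ∫⁻ ω in hist Z A X t ⁻¹' {hist Z A X t ω₀},
      Φ (fun j => if j ∈ Z t ω₀ then θ t ω j else 0) ∂P =
    P (hist Z A X t ⁻¹' {hist Z A X t ω₀}) * ∫⁻ x, Φ x ∂Measure.pi
      (sampleLaw (Z t ω₀) (fun j => succ A X j t ω₀) (fun j => fail A X j t ω₀)) := by
  have hθ' : Measurable fun ω j => if j ∈ Z t ω₀ then θ t ω j else 0 := by
    refine measurable_pi_lambda _ fun j => ?_
    split_ifs
    · exact (measurable_pi_apply j).comp (h.meas_θ ht)
    · exact measurable_const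
  rw [← lintegral_map hΦ hθ', h.map_sample ht ω₀, lintegral_smul_measure, smul_eq_mul]

omit [IsProbabilityMeasure P] in
lemma measurableSet_sample_mem (ht : t < T) (i : Fin N) {b : ℕ → ℕ → Set ℝ}
    (hb : ∀ s f, MeasurableSet (b s f)) :
    MeasurableSet {ω | i ∈ Z t ω ∧ θ t ω i ∈ b (succ A X i t ω) (fail A X i t ω)} := by
  have e : {ω | i ∈ Z t ω ∧ θ t ω i ∈ b (succ A X i t ω) (fail A X i t ω)} =
      ⋃ p : ℕ × ℕ, {ω | i ∈ Z t ω ∧ succ A X i t ω = p.1 ∧ fail A X i t ω = p.2} ∩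
        {ω | θ t ω i ∈ b p.1 p.2} := by
    ext ω; simp
  rw [e]
  refine MeasurableSet.iUnion fun p => MeasurableSet.inter ?_
    (((measurable_pi_apply i).comp (h.meas_θ ht)) (hb _ _))
  have hm : Measurable fun ω => (Z t ω, succ A X i t ω, fail A X i t ω) :=
    (h.meas_Z ht).prodMk (((h.measurable_successes i ht.le).mono (ℱ.le _) le_rfl).prodMk
      ((h.measurable_failures i ht.le).mono (ℱ.le _) le_rfl))
  exact hm (MeasurableSet.of_discrete
    (s := {x : Finset (Fin N) × ℕ × ℕ | i ∈ x.1 ∧ x.2.1 = p.1 ∧ x.2.2 = p.2}))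

/-- A bound for the posterior probability of a set that may depend on the counts of the arm. -/
lemma measure_sample_mem_le (ht : t < T) (i : Fin N) {b : ℕ → ℕ → Set ℝ}
    (hb : ∀ s f, MeasurableSet (b s f)) {r : ℝ≥0∞}
    (hr : ∀ s f, betaMeasure ((s + 1 : ℕ) : ℝ) ((f + 1 : ℕ) : ℝ) (b s f) ≤ r) :
    P {ω | i ∈ Z t ω ∧ θ t ω i ∈ b (succ A X i t ω) (fail A X i t ω)} ≤ r := by
  classical
  have hle : ∫⁻ ω, (if i ∈ Z t ω ∧ θ t ω i ∈ b (succ A X i t ω) (fail A X i t ω) then 1 else 0) ∂P ≤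
      ∫⁻ _ω, r ∂P := by
    refine lintegral_le_of_fibers (h.measurable_hist ht) fun ω₀ => ?_
    by_cases hi : i ∈ Z t ω₀
    · have e : ∫⁻ ω in hist Z A X t ⁻¹' {hist Z A X t ω₀}, (if i ∈ Z t ω ∧
          θ t ω i ∈ b (succ A X i t ω) (fail A X i t ω) then 1 else 0) ∂P =
          ∫⁻ ω in hist Z A X t ⁻¹' {hist Z A X t ω₀},
            (b (succ A X i t ω₀) (fail A X i t ω₀)).indicator (fun _ => (1 : ℝ≥0∞))
              ((fun j => if j ∈ Z t ω₀ then θ t ω j else 0) i) ∂P := by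
        refine setLIntegral_congr_fun (h.measurable_hist ht MeasurableSet.of_discrete)
          fun ω hω => ?_
        simp only [(hist_eq hω).1, succ_congr hω i, fail_congr hω i, hi, true_and, if_true,
          indicator_apply]
      have hm : Measurable fun x : Fin N → ℝ =>
          (b (succ A X i t ω₀) (fail A X i t ω₀)).indicator (fun _ => (1 : ℝ≥0∞)) (x i) :=
        (measurable_const.indicator (hb _ _)).comp (measurable_pi_apply i)
      rw [e, h.lintegral_sample ht ω₀ hm, setLIntegral_const, mul_comm r]
      refine mul_le_mul_right ?_ _
      rw [(measurePreserving_eval (sampleLaw (Z t ω₀) (fun j => succ A X j t ω₀)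
        (fun j => fail A X j t ω₀)) i).lintegral_comp
        (f := (b (succ A X i t ω₀) (fail A X i t ω₀)).indicator (fun _ => (1 : ℝ≥0∞)))
        (measurable_const.indicator (hb _ _)), lintegral_indicator_const (hb _ _), one_mul,
        sampleLaw, if_pos hi]
      exact hr _ _
    · have e : ∫⁻ ω in hist Z A X t ⁻¹' {hist Z A X t ω₀}, (if i ∈ Z t ω ∧
          θ t ω i ∈ b (succ A X i t ω) (fail A X i t ω) then 1 else 0) ∂P =
          ∫⁻ ω in hist Z A X t ⁻¹' {hist Z A X t ω₀}, (0 : ℝ≥0∞) ∂P := by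
        refine setLIntegral_congr_fun (h.measurable_hist ht MeasurableSet.of_discrete)
          fun ω hω => ?_
        simp only [(hist_eq hω).1, hi, false_and, if_false]
      rw [e]; simp
  rw [lintegral_const, measure_univ, mul_one] at hle
  refine le_trans ?_ hle
  have : ∀ ω,
      (if i ∈ Z t ω ∧ θ t ω i ∈ b (succ A X i t ω) (fail A X i t ω) then (1 : ℝ≥0∞) else 0) =
      {ω | i ∈ Z t ω ∧ θ t ω i ∈ b (succ A X i t ω) (fail A X i t ω)}.indicator 1 ω := by
    intro ω; simp [indicator_apply]
  simp_rw [this]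
  rw [lintegral_indicator_one (h.measurableSet_sample_mem ht i hb)]

end IsRun

end Probability

/-! ### The loss by underestimation -/

/-- One coordinate of the exploration argument: the loss `a + w u - τ` beyond `w ε`, paid while the
index `a + w y` of the posterior sample `y` stays below the threshold `τ`, is charged to the event
that the index exceeds the threshold. -/
lemma lintegral_ite_le_threshold {ε u w : ℝ} (hε : 0 < ε) (hu : u ≤ 1) (hw : 0 < w) (s f : ℕ)
    (a τ : ℝ) :
    ∫⁻ y, (if a + w * y ≤ τ then ENNReal.ofReal (a + w * u - τ - w * ε) else 0)
        ∂betaMeasure ((s + 1 : ℕ) : ℝ) ((f + 1 : ℕ) : ℝ) ≤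
      ENNReal.ofReal w * ∫⁻ y, (if τ < a + w * y then potential ε u s f else 0)
        ∂betaMeasure ((s + 1 : ℕ) : ℝ) ((f + 1 : ℕ) : ℝ) := by
  set c := (τ - a) / w with hc
  have h1 : ∀ y, (if a + w * y ≤ τ then ENNReal.ofReal (a + w * u - τ - w * ε) else 0) =
      (Iic c).indicator (fun _ => ENNReal.ofReal (w * (u - c - ε))) y := by
    intro y
    have hiff : a + w * y ≤ τ ↔ y ∈ Iic c := by
      rw [mem_Iic, hc, le_div_iff₀ hw]; constructor <;> intro h <;> linarith
    have hval : a + w * u - τ - w * ε = w * (u - c - ε) := by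
      rw [hc]; field_simp; ring
    simp only [indicator_apply, hiff, hval]
  have h2 : ∀ y, (if τ < a + w * y then potential ε u s f else 0) =
      (Ioi c).indicator (fun _ => potential ε u s f) y := by
    intro y
    have hiff : τ < a + w * y ↔ y ∈ Ioi c := by
      rw [mem_Ioi, hc, div_lt_iff₀ hw]; constructor <;> intro h <;> linarith
    simp only [indicator_apply, hiff]
  simp_rw [h1, h2]
  rw [lintegral_indicator_const measurableSet_Iic, lintegral_indicator_const measurableSet_Ioi,
    ENNReal.ofReal_mul hw.le, mul_assoc, mul_comm (potential ε u s f)]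
  exact mul_le_mul_right (ofReal_mul_betaMeasure_Iic_le hε hu s f c) _

section Probability

variable {Ω : Type*} {mΩ : MeasurableSpace Ω} {P : Measure Ω}

namespace IsRun

variable {ℱ : Filtration ℕ mΩ} {T m : ℕ} {η : ℝ} {PZ : PMF (Finset (Fin N))} {k w u : Fin N → ℝ}
  {q : Finset (Fin N) → Finset (Fin N) → ℝ}
  {Z : ℕ → Ω → Finset (Fin N)} {θ : ℕ → Ω → Fin N → ℝ} {A : ℕ → Ω → Finset (Fin N)}
  {X : ℕ → Ω → Fin N → Bool} {Astar : ℕ → Ω → Finset (Fin N)} {t : ℕ}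

/-- The index of arm `j` in round `t`, i.e. its contribution to the sum that the algorithm
maximizes. -/
def index (η : ℝ) (k w : Fin N → ℝ) (θ : ℕ → Ω → Fin N → ℝ) (A : ℕ → Ω → Finset (Fin N)) (t : ℕ)
    (ω : Ω) (j : Fin N) : ℝ :=
  1 / η * queue k (fun τ => A τ ω) j t + w j * θ t ω j

/-- The value of arm `j` in round `t`: its index for the true mean in place of the sample. -/
def trueIndex (η : ℝ) (k w u : Fin N → ℝ) (A : ℕ → Ω → Finset (Fin N)) (t : ℕ) (ω : Ω)
    (j : Fin N) : ℝ :=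
  1 / η * queue k (fun τ => A τ ω) j t + w j * u j

/-- The part of the underestimation loss of arm `i` in round `t` that exceeds `w i * ε`. -/
def excess (m : ℕ) (η ε : ℝ) (k w u : Fin N → ℝ) (Z : ℕ → Ω → Finset (Fin N))
    (θ : ℕ → Ω → Fin N → ℝ) (A : ℕ → Ω → Finset (Fin N)) (i : Fin N) (t : ℕ) (ω : Ω) : ℝ :=
  if i ∈ Z t ω ∧ i ∉ A t ω then
    max (trueIndex η k w u A t ω i - threshold m (Z t ω) (index η k w θ A t ω) i - w i * ε) 0
  else 0

lemma excess_nonneg {ε : ℝ} (i : Fin N) (t : ℕ) (ω : Ω) :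
    0 ≤ excess m η ε k w u Z θ A i t ω := by
  unfold excess; split_ifs
  · exact le_max_right _ _
  · exact le_rfl

variable (h : IsRun P ℱ T m η PZ k w u q Z θ A X Astar)
include h

lemma sum_index_le (ht : t < T) (ω : Ω) {B : Finset (Fin N)} (hB : B ∈ admissible m (Z t ω)) :
    ∑ j ∈ B, index η k w θ A t ω j ≤ ∑ j ∈ A t ω, index η k w θ A t ω j :=
  h.A_max t ht ω B hB

lemma measurable_index (ht : t < T) : Measurable (index η k w θ A t) := by
  refine measurable_pi_lambda _ fun j => ?_
  exact (((h.measurable_queue j ht.le).mono (ℱ.le t) le_rfl).const_mul _).add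
    (((measurable_pi_apply j).comp (h.meas_θ ht)).const_mul _)

lemma measurable_excess {ε : ℝ} (ht : t < T) (i : Fin N) :
    Measurable (excess m η ε k w u Z θ A i t) := by
  have hthr : Measurable fun ω => threshold m (Z t ω) (index η k w θ A t ω) i := by
    have : Measurable fun p : Finset (Fin N) × (Fin N → ℝ) => threshold m p.1 p.2 i :=
      measurable_from_prod_countable_right fun S => measurable_threshold m S i
    exact Measurable.comp (f := fun ω => (Z t ω, index η k w θ A t ω)) this
      ((h.meas_Z ht).prodMk (h.measurable_index ht))
  have hv : Measurable fun ω => trueIndex η k w u A t ω i :=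
    (((h.measurable_queue i ht.le).mono (ℱ.le t) le_rfl).const_mul _).add measurable_const
  refine Measurable.ite ?_ (((hv.sub hthr).sub measurable_const).max measurable_const)
    measurable_const
  exact ((h.meas_Z ht).prodMk (h.meas_A ht)) (MeasurableSet.of_discrete
    (s := {x : Finset (Fin N) × Finset (Fin N) | i ∈ x.1 ∧ i ∉ x.2}))

variable [IsProbabilityMeasure P]

/-- The underestimation loss of an arm is charged to its pulls. Given the history and the samples of
the other arms, the threshold is a constant and the sample of the arm is still beta distributed. -/
lemma lintegral_excess_le (hm : 0 < m) (ht : t < T) (i : Fin N) (hw : 0 ≤ w i) (hu : u i ≤ 1)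
    {ε : ℝ} (hε : 0 < ε) :
    ∫⁻ ω, ENNReal.ofReal (excess m η ε k w u Z θ A i t ω) ∂P ≤
      ENNReal.ofReal (w i) * ∫⁻ ω, (if i ∈ A t ω then
        potential ε (u i) (succ A X i t ω) (fail A X i t ω) else 0) ∂P := by
  have hle : ∀ ω, i ∈ Z t ω → i ∉ A t ω →
      index η k w θ A t ω i ≤ threshold m (Z t ω) (index η k w θ A t ω) i := fun ω hi hA =>
    le_threshold hm (h.A_mem t ht ω) (fun B hB => h.sum_index_le ht ω hB) hi hA
  rcases hw.eq_or_lt with hw0 | hw0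
  · -- an arm without weight is never underestimated
    have : ∀ ω, excess m η ε k w u Z θ A i t ω = 0 := by
      intro ω
      unfold excess
      split_ifs with hcase
      · have := hle ω hcase.1 hcase.2
        refine max_eq_right ?_
        simp only [index, trueIndex, ← hw0, zero_mul] at this ⊢
        linarith
      · rfl
    simp [this]
  rw [← lintegral_const_mul' _ _ ENNReal.ofReal_ne_top]
  refine lintegral_le_of_fibers (h.measurable_hist ht) fun ω₀ => ?_
  have hEm := h.measurable_hist ht (MeasurableSet.of_discrete (s := {hist Z A X t ω₀}))
  set S := Z t ω₀ with hS
  set Q₀ : Fin N → ℝ := fun j => queue k (fun τ => A τ ω₀) j t with hQ₀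
  set s₀ := succ A X i t ω₀ with hs₀
  set f₀ := fail A X i t ω₀ with hf₀
  by_cases hi : i ∈ S
  swap
  · have : ∫⁻ ω in hist Z A X t ⁻¹' {hist Z A X t ω₀},
        ENNReal.ofReal (excess m η ε k w u Z θ A i t ω) ∂P =
        ∫⁻ ω in hist Z A X t ⁻¹' {hist Z A X t ω₀}, 0 ∂P := by
      refine setLIntegral_congr_fun hEm fun ω hω => ?_
      have hZ : Z t ω = S := (hist_eq hω).1
      simp [excess, hZ, hi]
    rw [this]; simp
  set J : (Fin N → ℝ) → Fin N → ℝ := fun x j => 1 / η * Q₀ j + w j * x j with hJ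
  have hJm : Measurable J := measurable_pi_lambda _ fun j => by fun_prop
  have hthr : Measurable fun x => threshold m S (J x) i := (measurable_threshold m S i).comp hJm
  have hJi : Measurable fun x => J x i := (measurable_pi_apply i).comp hJm
  -- bounds for the excess and for the cost of a pull, as functions of the samples alone
  set Φ₁ : (Fin N → ℝ) → ℝ≥0∞ := fun x => if J x i ≤ threshold m S (J x) i then
    ENNReal.ofReal (1 / η * Q₀ i + w i * u i - threshold m S (J x) i - w i * ε) else 0 with hΦ₁
  set Φ₂ : (Fin N → ℝ) → ℝ≥0∞ := fun x => if threshold m S (J x) i < J x i then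
    potential ε (u i) s₀ f₀ else 0 with hΦ₂
  have hΦ₁m : Measurable Φ₁ := by
    refine Measurable.ite (measurableSet_le hJi hthr) ?_ measurable_const
    exact ((measurable_const.sub hthr).sub measurable_const).ennreal_ofReal
  have hΦ₂m : Measurable Φ₂ :=
    Measurable.ite (measurableSet_lt hthr hJi) measurable_const measurable_const
  have hJω : ∀ ω ∈ hist Z A X t ⁻¹' {hist Z A X t ω₀},
      (∀ j ∈ S, J (fun j => if j ∈ S then θ t ω j else 0) j = index η k w θ A t ω j) := by
    intro ω hω j hj
    have hQ : queue k (fun τ => A τ ω) j t = Q₀ j :=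
      queue_congr fun τ hτ => ((hist_eq hω).2 τ hτ).1
    simp only [hJ, index, if_pos hj, hQ]
  have hthrω : ∀ ω ∈ hist Z A X t ⁻¹' {hist Z A X t ω₀},
      threshold m S (J fun j => if j ∈ S then θ t ω j else 0) i =
        threshold m (Z t ω) (index η k w θ A t ω) i := by
    intro ω hω
    have hZ : Z t ω = S := (hist_eq hω).1
    rw [hZ]
    exact threshold_congr fun j hj _ => hJω ω hω j hj
  calc ∫⁻ ω in hist Z A X t ⁻¹' {hist Z A X t ω₀},
        ENNReal.ofReal (excess m η ε k w u Z θ A i t ω) ∂P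
      ≤ ∫⁻ ω in hist Z A X t ⁻¹' {hist Z A X t ω₀},
          Φ₁ (fun j => if j ∈ S then θ t ω j else 0) ∂P := by
        refine setLIntegral_mono' hEm fun ω hω => ?_
        unfold excess
        split_ifs with hcase
        · have hQ : queue k (fun τ => A τ ω) i t = Q₀ i :=
            queue_congr fun τ hτ => ((hist_eq hω).2 τ hτ).1
          have := hle ω hcase.1 hcase.2
          simp only [hΦ₁]
          rw [hthrω ω hω, hJω ω hω i hi, if_pos this, ENNReal.ofReal_max, ENNReal.ofReal_zero,
            max_eq_left (zero_le), trueIndex, hQ]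
        · simp
    _ = P (hist Z A X t ⁻¹' {hist Z A X t ω₀}) * ∫⁻ x, Φ₁ x ∂Measure.pi
          (sampleLaw S (fun j => succ A X j t ω₀) (fun j => fail A X j t ω₀)) :=
        h.lintegral_sample ht ω₀ hΦ₁m
    _ ≤ P (hist Z A X t ⁻¹' {hist Z A X t ω₀}) * ∫⁻ x, ENNReal.ofReal (w i) * Φ₂ x ∂Measure.pi
          (sampleLaw S (fun j => succ A X j t ω₀) (fun j => fail A X j t ω₀)) := by
        refine mul_le_mul_right ?_ _
        -- integrate over the sample of arm `i` first
        refine lintegral_le_of_lmarginal_le {i} hΦ₁m (hΦ₂m.const_mul _) ?_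
        rw [lmarginal_singleton, lmarginal_singleton]
        intro x
        have hthr_up : ∀ y, threshold m S (J (Function.update x i y)) i = threshold m S (J x) i :=
          fun y => threshold_congr fun j _ hj => by simp [hJ, Function.update_of_ne hj]
        have hJ_up : ∀ y, J (Function.update x i y) i = 1 / η * Q₀ i + w i * y := fun y => by
          simp [hJ]
        simp only [hΦ₁, hΦ₂, hthr_up, hJ_up]
        rw [lintegral_const_mul' _ _ ENNReal.ofReal_ne_top, sampleLaw, if_pos hi]
        exact lintegral_ite_le_threshold hε hu hw0 _ _ _ _
    _ = ∫⁻ ω in hist Z A X t ⁻¹' {hist Z A X t ω₀},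
          ENNReal.ofReal (w i) * Φ₂ (fun j => if j ∈ S then θ t ω j else 0) ∂P :=
        (h.lintegral_sample ht ω₀ (hΦ₂m.const_mul _)).symm
    _ ≤ _ := by
        refine setLIntegral_mono' hEm fun ω hω => mul_le_mul_right ?_ _
        have hZ : Z t ω = S := (hist_eq hω).1
        simp only [hΦ₂]
        rw [hthrω ω hω, hJω ω hω i hi, hs₀, hf₀, ← succ_congr hω i, ← fail_congr hω i]
        split_ifs with h1 h2
        · exact le_rfl
        · exact absurd (hle ω (hZ ▸ hi) h2) (not_le.2 h1)
        · exact zero_le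
        · exact le_rfl

/-- The expected underestimation loss of one arm over all rounds. -/
lemma sum_lintegral_excess_le (hm : 0 < m) (hT : 1 ≤ T) (i : Fin N) (hw : 0 ≤ w i) (hu : u i ≤ 1)
    {ε : ℝ} (hε : 0 < ε) :
    ∑ t ∈ Finset.range T, ∫⁻ ω, ENNReal.ofReal (excess m η ε k w u Z θ A i t ω) ∂P ≤
      ENNReal.ofReal (w i * (3 / 4 * (1 + Real.log T) / ε)) := by
  rw [ENNReal.ofReal_mul hw]
  refine le_trans ?_ (mul_le_mul_right (h.sum_lintegral_potential_le i hu hT hε) _)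
  rw [Finset.mul_sum]
  exact Finset.sum_le_sum fun t ht =>
    h.lintegral_excess_le hm (Finset.mem_range.1 ht) i hw hu hε

end IsRun

end Probability

/-! ### The loss by overestimation -/

/-- The part of the overestimation of a pulled arm with mean `x` that is not due to an exceptionally
large sample: the width of the posterior, and a bound for the deviation `z` of the empirical mean
that comes from `z ≤ ε + z ^ 2 / (4 ε)`. -/
def overBound (a ε x : ℝ) (s f : ℕ) : ℝ :=
  Real.sqrt (a / 2) * (1 / Real.sqrt ((s + f : ℝ) + 1)) + ε +
    1 / (4 * ε) * (((s : ℝ) - (s + f) * x) / (s + f + 1)) ^ 2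

/-- The exceptionally large samples of an arm with `s` successes and `f` failures: by
`betaMeasure_Ioi_le`, their posterior probability is at most `exp (-a)`. -/
def largeSamples (a : ℝ) (s f : ℕ) : Set ℝ :=
  Ioi (s / (s + f + 1 : ℝ) + Real.sqrt (a / 2) / Real.sqrt (s + f + 1))

lemma overBound_nonneg {a ε x : ℝ} (hε : 0 < ε) (s f : ℕ) : 0 ≤ overBound a ε x s f := by
  unfold overBound; positivity

lemma sub_le_overBound {a ε x y : ℝ} (hε : 0 < ε) (hx : 0 ≤ x) {s f : ℕ}
    (hy : y ∉ largeSamples a s f) : y - x ≤ overBound a ε x s f := by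
  have hy' : y ≤ s / (s + f + 1 : ℝ) + Real.sqrt (a / 2) / Real.sqrt (s + f + 1) := by
    simpa [largeSamples] using hy
  set z : ℝ := ((s : ℝ) - (s + f) * x) / (s + f + 1) with hz
  have h1 : (s : ℝ) / (s + f + 1) - x ≤ z := by
    rw [hz, sub_le_iff_le_add, ← sub_le_iff_le_add', ← sub_div, sub_sub_cancel,
      div_le_iff₀ (by positivity)]
    nlinarith
  have h2 : z ≤ ε + 1 / (4 * ε) * z ^ 2 := by
    have : ε + 1 / (4 * ε) * z ^ 2 - z = (z - 2 * ε) ^ 2 / (4 * ε) := by field_simp; ring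
    have h3 : 0 ≤ (z - 2 * ε) ^ 2 / (4 * ε) := by positivity
    linarith
  unfold overBound
  rw [mul_one_div]
  linarith

section Probability

variable {Ω : Type*} {mΩ : MeasurableSpace Ω} {P : Measure Ω}

/-- `Y` is only controlled through its lower integral, and need not be integrable. -/
lemma integral_le_add_of_lintegral_le {D a Y : Ω → ℝ} (hD : Integrable D P) (ha : Integrable a P)
    {y : ℝ} (hy : 0 ≤ y) (hle : ∀ᵐ ω ∂P, D ω ≤ a ω + Y ω)
    (hY : ∫⁻ ω, ENNReal.ofReal (Y ω) ∂P ≤ ENNReal.ofReal y) :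
    ∫ ω, D ω ∂P ≤ ∫ ω, a ω ∂P + y := by
  have hDa : Integrable (fun ω => D ω - a ω) P := hD.sub ha
  have hpos : Integrable (fun ω => max (D ω - a ω) 0) P := hDa.pos_part
  have h1 : ∫ ω, (D ω - a ω) ∂P ≤ ∫ ω, max (D ω - a ω) 0 ∂P :=
    integral_mono hDa hpos fun ω => le_max_left _ _
  have h2 : ∫ ω, max (D ω - a ω) 0 ∂P ≤ y := by
    rw [integral_eq_lintegral_of_nonneg_ae (f := fun ω => max (D ω - a ω) 0)
      (.of_forall fun ω => le_max_right _ _) hpos.aestronglyMeasurable]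
    refine ENNReal.toReal_le_of_le_ofReal hy (le_trans (lintegral_mono_ae ?_) hY)
    filter_upwards [hle] with ω hω
    rw [ENNReal.ofReal_max, ENNReal.ofReal_zero, max_eq_left zero_le]
    exact ENNReal.ofReal_le_ofReal (by linarith)
  rw [integral_sub hD ha] at h1
  linarith

namespace IsRun

variable {ℱ : Filtration ℕ mΩ} {T m : ℕ} {η : ℝ} {PZ : PMF (Finset (Fin N))} {k w u : Fin N → ℝ}
  {q : Finset (Fin N) → Finset (Fin N) → ℝ}
  {Z : ℕ → Ω → Finset (Fin N)} {θ : ℕ → Ω → Fin N → ℝ} {A : ℕ → Ω → Finset (Fin N)}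
  {X : ℕ → Ω → Fin N → Bool} {Astar : ℕ → Ω → Finset (Fin N)} {t : ℕ}

/-- The event that the sample of the available arm `i` in round `t` is exceptionally large. -/
def largeEvent (a : ℝ) (Z : ℕ → Ω → Finset (Fin N)) (θ : ℕ → Ω → Fin N → ℝ)
    (A : ℕ → Ω → Finset (Fin N)) (X : ℕ → Ω → Fin N → Bool) (i : Fin N) (t : ℕ) : Set Ω :=
  {ω | i ∈ Z t ω ∧ θ t ω i ∈ largeSamples a (succ A X i t ω) (fail A X i t ω)}

variable (h : IsRun P ℱ T m η PZ k w u q Z θ A X Astar)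
include h

/-- The loss of one round against the stationary policy, in terms of the true indices. -/
lemma loss_le (hη : 0 < η) (hq : IsFeasiblePolicy PZ m k q) (hw : ∀ i, 0 ≤ w i)
    (hu : ∀ i, u i ∈ Icc (0 : ℝ) 1) {wmax : ℝ} (hwmax : ∀ i, w i ≤ wmax) (hw0 : 0 ≤ wmax)
    {a ε ε' : ℝ} (hε : 0 < ε) (hε' : 0 < ε') (ht : t < T) {ω : Ω}
    (hθ : ∀ i ∈ Z t ω, θ t ω i ∈ Ioo (0 : ℝ) 1) :
    ∑ i, pullProb m q (Z t ω) i * trueIndex η k w u A t ω i -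
        ∑ i ∈ A t ω, trueIndex η k w u A t ω i ≤
      wmax * (m * ε + ∑ i, (if i ∈ A t ω then
        overBound a ε' (u i) (succ A X i t ω) (fail A X i t ω) else 0)) +
      (∑ i, excess m η ε k w u Z θ A i t ω +
        ∑ i, wmax * (largeEvent a Z θ A X i t).indicator (fun _ => 1) ω) := by
  have hAmem := h.A_mem t ht ω
  have hAsub := (mem_admissible.1 hAmem).1
  have hidx : ∀ i ∈ A t ω, 0 ≤ index η k w θ A t ω i := fun i hi => by
    have h1 := (hθ i (hAsub hi)).1
    have h2 := queue_nonneg (fun τ => A τ ω) i k t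
    have h3 := hw i
    unfold index
    positivity
  refine (pullProb_sub_sum_le hq hAmem (fun B hB => h.sum_index_le ht ω hB) hidx
    (trueIndex η k w u A t ω)).trans ?_
  have hunder : ∑ i, pullProb m q (Z t ω) i * (if i ∈ A t ω then 0 else
      max (trueIndex η k w u A t ω i - threshold m (Z t ω) (index η k w θ A t ω) i) 0) ≤
      wmax * (m * ε) + ∑ i, excess m η ε k w u Z θ A i t ω := by
    have hterm : ∀ i, pullProb m q (Z t ω) i * (if i ∈ A t ω then 0 else
        max (trueIndex η k w u A t ω i - threshold m (Z t ω) (index η k w θ A t ω) i) 0) ≤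
        pullProb m q (Z t ω) i * (wmax * ε) + excess m η ε k w u Z θ A i t ω := by
      intro i
      have hp0 := pullProb_nonneg hq (Z t ω) i
      have hp1 := pullProb_le_one hq (Z t ω) i
      have he := excess_nonneg (m := m) (η := η) (ε := ε) (k := k) (w := w) (u := u) (Z := Z)
        (θ := θ) (A := A) i t ω
      by_cases hiZ : i ∈ Z t ω
      · by_cases hiA : i ∈ A t ω
        · rw [if_pos hiA]
          have : 0 ≤ wmax * ε := by positivity
          nlinarith
        · rw [if_neg hiA]
          have hex : excess m η ε k w u Z θ A i t ω = max (trueIndex η k w u A t ω i -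
              threshold m (Z t ω) (index η k w θ A t ω) i - w i * ε) 0 := by
            rw [excess, if_pos ⟨hiZ, hiA⟩]
          set z := trueIndex η k w u A t ω i - threshold m (Z t ω) (index η k w θ A t ω) i
          have hz : max z 0 ≤ wmax * ε + max (z - w i * ε) 0 := by
            have h1 := le_max_left (z - w i * ε) 0
            have h2 := le_max_right (z - w i * ε) 0
            have h3 : w i * ε ≤ wmax * ε := mul_le_mul_of_nonneg_right (hwmax i) hε.le
            have h4 : 0 ≤ wmax * ε := by positivity
            exact max_le (by linarith) (by linarith)
          rw [← hex] at hz
          calc _ ≤ pullProb m q (Z t ω) i * (wmax * ε + excess m η ε k w u Z θ A i t ω) :=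
                mul_le_mul_of_nonneg_left hz hp0
            _ ≤ _ := by
                rw [mul_add]
                linarith [mul_le_of_le_one_left he hp1]
      · rw [pullProb_eq_zero hiZ]
        simpa using he
    refine (Finset.sum_le_sum fun i _ => hterm i).trans ?_
    rw [Finset.sum_add_distrib, ← Finset.sum_mul]
    have := mul_le_mul_of_nonneg_right (sum_pullProb_le hq (Z t ω))
      (show 0 ≤ wmax * ε by positivity)
    linarith
  have hover : ∑ i ∈ A t ω, max (index η k w θ A t ω i - trueIndex η k w u A t ω i) 0 ≤
      wmax * (∑ i, (if i ∈ A t ω then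
        overBound a ε' (u i) (succ A X i t ω) (fail A X i t ω) else 0)) +
      ∑ i, wmax * (largeEvent a Z θ A X i t).indicator (fun _ => 1) ω := by
    rw [← Finset.mul_sum, ← mul_add, ← Finset.sum_add_distrib, Finset.mul_sum]
    have hnn : ∀ i, 0 ≤ wmax * ((if i ∈ A t ω then
        overBound a ε' (u i) (succ A X i t ω) (fail A X i t ω) else 0) +
        (largeEvent a Z θ A X i t).indicator (fun _ => 1) ω) := by
      intro i
      refine mul_nonneg hw0 (add_nonneg ?_ (indicator_nonneg (fun _ _ => zero_le_one) _))
      split_ifs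
      · exact overBound_nonneg hε' _ _
      · exact le_rfl
    refine le_trans (Finset.sum_le_sum fun i hi => ?_)
      (Finset.sum_le_sum_of_subset_of_nonneg (Finset.subset_univ (A t ω)) fun i _ _ => hnn i)
    refine max_le ?_ (hnn i)
    have hiZ := hAsub hi
    have e : index η k w θ A t ω i - trueIndex η k w u A t ω i = w i * (θ t ω i - u i) := by
      unfold index trueIndex; ring
    rw [e, if_pos hi]
    set o := overBound a ε' (u i) (succ A X i t ω) (fail A X i t ω) with ho
    have ho0 : 0 ≤ o := overBound_nonneg hε' _ _
    have hind : 0 ≤ (largeEvent a Z θ A X i t).indicator (fun _ => (1 : ℝ)) ω :=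
      indicator_nonneg (fun _ _ => zero_le_one) _
    -- an exceptionally large sample costs at most `1`
    have key : θ t ω i - u i ≤ o + (largeEvent a Z θ A X i t).indicator (fun _ => 1) ω := by
      by_cases hl : θ t ω i ∈ largeSamples a (succ A X i t ω) (fail A X i t ω)
      · have : ω ∈ largeEvent a Z θ A X i t := ⟨hiZ, hl⟩
        rw [indicator_of_mem this]
        linarith [(hθ i hiZ).2, (hu i).1]
      · linarith [sub_le_overBound hε' (hu i).1 hl]
    calc w i * (θ t ω i - u i)
        ≤ w i * (o + (largeEvent a Z θ A X i t).indicator (fun _ => 1) ω) :=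
          mul_le_mul_of_nonneg_left key (hw i)
      _ ≤ _ := mul_le_mul_of_nonneg_right (hwmax i) (by linarith)
  linarith

variable [IsProbabilityMeasure P]

lemma ae_sample_mem_Ioo (ht : t < T) : ∀ᵐ ω ∂P, ∀ i ∈ Z t ω, θ t ω i ∈ Ioo (0 : ℝ) 1 := by
  have h1 : ∀ i, ∀ᵐ ω ∂P, ¬(i ∈ Z t ω ∧ θ t ω i ∈ (Ioo (0 : ℝ) 1)ᶜ) := fun i => by
    rw [ae_iff]
    simp only [not_not]
    exact le_antisymm (h.measure_sample_mem_le ht i (b := fun _ _ => (Ioo (0 : ℝ) 1)ᶜ)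
      (fun _ _ => measurableSet_Ioo.compl) fun s f => (betaMeasure_compl_Ioo s f).le) zero_le
  filter_upwards [ae_all_iff.2 h1] with ω hω i hi
  by_contra hc
  exact hω i ⟨hi, hc⟩

omit [IsProbabilityMeasure P] in
lemma measurableSet_largeEvent (a : ℝ) (ht : t < T) (i : Fin N) :
    MeasurableSet (largeEvent a Z θ A X i t) :=
  h.measurableSet_sample_mem ht i fun _ _ => measurableSet_Ioi

lemma measure_largeEvent_le {a : ℝ} (ha : 0 ≤ a) (ht : t < T) (i : Fin N) :
    P (largeEvent a Z θ A X i t) ≤ ENNReal.ofReal (Real.exp (-a)) :=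
  h.measure_sample_mem_le ht i (b := largeSamples a) (fun _ _ => measurableSet_Ioi)
    fun s f => betaMeasure_Ioi_le s f ha

/-- The overestimation of the pulled arms, without the exceptionally large samples. -/
lemma sum_integral_overBound_le (hT : 0 < T) {a ε' : ℝ} (hε' : 0 < ε') :
    ∑ t ∈ Finset.range T, ∫ ω, ∑ i, (if i ∈ A t ω then
        overBound a ε' (u i) (succ A X i t ω) (fail A X i t ω) else 0) ∂P ≤
      Real.sqrt (a / 2) * (2 * Real.sqrt (N * (m * T))) + m * T * ε' +
        N * (1 + Real.log T) / (16 * ε') := by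
  set g₁ : ℕ → ℕ → ℝ := fun s f =>
    Real.sqrt (a / 2) * (1 / Real.sqrt ((s + f : ℝ) + 1)) + ε' with hg₁
  set g₂ : Fin N → ℕ → ℕ → ℝ := fun i s f =>
    (((s : ℝ) - (s + f) * u i) / (s + f + 1)) ^ 2 with hg₂
  have hsplit : ∀ t ∈ Finset.range T, ∫ ω, ∑ i, (if i ∈ A t ω then
      overBound a ε' (u i) (succ A X i t ω) (fail A X i t ω) else 0) ∂P =
      ∫ ω, ∑ i, (if i ∈ A t ω then g₁ (succ A X i t ω) (fail A X i t ω) else 0) ∂P +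
      1 / (4 * ε') * ∑ i, ∫ ω, (if i ∈ A t ω then
        g₂ i (succ A X i t ω) (fail A X i t ω) else 0) ∂P := by
    intro t ht
    have ht' := Finset.mem_range.1 ht
    rw [← integral_finsetSum _ fun i _ => h.integrable_ite_counts i ht' (g₂ i),
      ← integral_const_mul, ← integral_add
      (integrable_finsetSum _ fun i _ => h.integrable_ite_counts i ht' g₁)
      ((integrable_finsetSum _ fun i _ => h.integrable_ite_counts i ht' (g₂ i)).const_mul _)]
    refine integral_congr_ae (.of_forall fun ω => ?_)
    simp only
    rw [Finset.mul_sum, ← Finset.sum_add_distrib]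
    refine Finset.sum_congr rfl fun i _ => ?_
    split_ifs
    · simp only [overBound, hg₁, hg₂]
    · simp
  rw [Finset.sum_congr rfl hsplit, Finset.sum_add_distrib, ← Finset.mul_sum, Finset.sum_comm]
  have h2 : 1 / (4 * ε') * ∑ i, ∑ t ∈ Finset.range T, ∫ ω, (if i ∈ A t ω then
        g₂ i (succ A X i t ω) (fail A X i t ω) else 0) ∂P ≤
        N * (1 + Real.log T) / (16 * ε') := by
    calc _ ≤ 1 / (4 * ε') * ∑ _i : Fin N, (1 + Real.log T) / 4 := by
          refine mul_le_mul_of_nonneg_left ?_ (by positivity)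
          exact Finset.sum_le_sum fun i _ => h.sum_integral_sq_dev_le i hT
      _ = _ := by
          simp only [Finset.sum_const, Finset.card_univ, Fintype.card_fin, nsmul_eq_mul]
          field_simp; ring
  have h1 : ∑ t ∈ Finset.range T, ∫ ω, ∑ i, (if i ∈ A t ω then
      g₁ (succ A X i t ω) (fail A X i t ω) else 0) ∂P ≤
      Real.sqrt (a / 2) * (2 * Real.sqrt (N * (m * T))) + m * T * ε' := by
    have hint : ∀ t ∈ Finset.range T, Integrable (fun ω => ∑ i, (if i ∈ A t ω then
        g₁ (succ A X i t ω) (fail A X i t ω) else 0)) P := fun t ht =>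
      integrable_finsetSum _ fun i _ => h.integrable_ite_counts i (Finset.mem_range.1 ht) g₁
    rw [← integral_finsetSum _ hint]
    calc _ ≤ ∫ _ω, (Real.sqrt (a / 2) * (2 * Real.sqrt (N * (m * T))) + m * T * ε') ∂P := by
          refine integral_mono (integrable_finsetSum _ hint) (integrable_const _) fun ω => ?_
          have hcard : ∀ t < T, (A t ω).card ≤ m := fun t ht =>
            (mem_admissible.1 (h.A_mem t ht ω)).2
          have e : ∀ t i, (if i ∈ A t ω then g₁ (succ A X i t ω) (fail A X i t ω) else 0) =
              Real.sqrt (a / 2) * (if i ∈ A t ω then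
                1 / Real.sqrt ((pulls (fun τ => A τ ω) i t : ℝ) + 1) else 0) +
              ε' * (if i ∈ A t ω then 1 else 0) := by
            intro t i
            rw [← successes_add_failures (fun τ => A τ ω) (fun τ => X τ ω) i t]
            push_cast
            split_ifs
            · simp only [hg₁]; ring
            · simp
          simp only [e, Finset.sum_add_distrib, ← Finset.mul_sum]
          refine add_le_add (mul_le_mul_of_nonneg_left ?_ (Real.sqrt_nonneg _)) ?_
          · rw [Finset.sum_comm]
            calc _ ≤ ∑ i, 2 * Real.sqrt (pulls (fun τ => A τ ω) i T) :=
                  Finset.sum_le_sum fun i _ => sum_inv_sqrt_le (fun τ => A τ ω) i T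
              _ ≤ _ := by
                  -- Cauchy--Schwarz over the arms, which together have at most `m T` pulls
                  rw [← Finset.mul_sum]
                  refine mul_le_mul_of_nonneg_left (Real.le_sqrt_of_sq_le ?_) (by norm_num)
                  refine (sq_sum_le_card_mul_sum_sq (s := Finset.univ)
                    (f := fun i => Real.sqrt (pulls (fun τ => A τ ω) i T))).trans ?_
                  simp only [Finset.card_univ, Fintype.card_fin, Real.sq_sqrt (Nat.cast_nonneg _)]
                  refine mul_le_mul_of_nonneg_left ?_ (Nat.cast_nonneg _)
                  exact_mod_cast sum_pulls_le (fun τ => A τ ω) hcard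
          · calc _ ≤ ε' * ∑ t ∈ Finset.range T, (m : ℝ) := by
                  refine mul_le_mul_of_nonneg_left (Finset.sum_le_sum fun t ht => ?_) hε'.le
                  simpa using hcard t (Finset.mem_range.1 ht)
              _ = _ := by simp; ring
      _ = _ := by simp
  linarith

end IsRun

end Probability

/-! ### The regret -/

section Probability

variable {Ω : Type*} {mΩ : MeasurableSpace Ω} {P : Measure Ω} [IsProbabilityMeasure P]

namespace IsRun

variable {ℱ : Filtration ℕ mΩ} {T m : ℕ} {η : ℝ} {PZ : PMF (Finset (Fin N))} {k w u : Fin N → ℝ}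
  {q : Finset (Fin N) → Finset (Fin N) → ℝ}
  {Z : ℕ → Ω → Finset (Fin N)} {θ : ℕ → Ω → Fin N → ℝ} {A : ℕ → Ω → Finset (Fin N)}
  {X : ℕ → Ω → Fin N → Bool} {Astar : ℕ → Ω → Finset (Fin N)} {t : ℕ}

variable (h : IsRun P ℱ T m η PZ k w u q Z θ A X Astar)
include h

lemma integrable_sum_pullProb (ht : t < T) (v : Fin N → ℝ) :
    Integrable (fun ω => ∑ i, pullProb m q (Z t ω) i * v i) P :=
  integrable_comp_discrete (h.meas_Z ht) fun S => ∑ i, pullProb m q S i * v i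

lemma integrable_sum_A (ht : t < T) (v : Fin N → ℝ) :
    Integrable (fun ω => ∑ i ∈ A t ω, v i) P :=
  integrable_comp_discrete (h.meas_A ht) fun S => ∑ i ∈ S, v i

/-- The regret compares the algorithm with the pulling probabilities of the stationary policy. -/
lemma mul_regret_eq (hT : 0 < T) :
    T * regret P T w A X Astar = ∑ t ∈ Finset.range T,
      (∫ ω, ∑ i, pullProb m q (Z t ω) i * (w i * u i) ∂P - ∫ ω, ∑ i ∈ A t ω, w i * u i ∂P) := by
  have hT' : (T : ℝ) ≠ 0 := by exact_mod_cast hT.ne'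
  have hi1 : ∀ t ∈ Finset.range T, Integrable (fun ω => reward w (X t ω) (Astar t ω)) P :=
    fun t ht => integrable_comp_discrete ((h.meas_X (Finset.mem_range.1 ht)).prodMk
      (h.meas_Astar (Finset.mem_range.1 ht))) fun p => reward w p.1 p.2
  have hi2 : ∀ t ∈ Finset.range T, Integrable (fun ω => reward w (X t ω) (A t ω)) P :=
    fun t ht => integrable_comp_discrete ((h.meas_X (Finset.mem_range.1 ht)).prodMk
      (h.meas_A (Finset.mem_range.1 ht))) fun p => reward w p.1 p.2
  have hi : ∀ t ∈ Finset.range T,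
      Integrable (fun ω => reward w (X t ω) (Astar t ω) - reward w (X t ω) (A t ω)) P :=
    fun t ht => (hi1 t ht).sub (hi2 t ht)
  rw [regret, integral_const_mul, ← mul_assoc, mul_one_div_cancel hT', one_mul,
    integral_finsetSum _ hi]
  refine Finset.sum_congr rfl fun t ht => ?_
  have ht' := Finset.mem_range.1 ht
  rw [integral_sub (hi1 t ht) (hi2 t ht), h.integral_reward ht' measurable_preReward_Astar,
    h.integral_reward ht' measurable_preReward_A, h.integral_sum_Astar ht' fun i => w i * u i]

/-- The regret is at most the largest possible reward. -/
lemma mul_regret_le (hT : 0 < T) (hq : IsFeasiblePolicy PZ m k q) (hw : ∀ i, 0 ≤ w i)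
    (hu : ∀ i, u i ∈ Icc (0 : ℝ) 1) {wmax : ℝ} (hwmax : ∀ i, w i ≤ wmax) (hw0 : 0 ≤ wmax) :
    T * regret P T w A X Astar ≤ T * (m * wmax) := by
  rw [h.mul_regret_eq hT]
  have : ∀ t ∈ Finset.range T, ∫ ω, ∑ i, pullProb m q (Z t ω) i * (w i * u i) ∂P -
      ∫ ω, ∑ i ∈ A t ω, w i * u i ∂P ≤ m * wmax := by
    intro t ht
    have ht' := Finset.mem_range.1 ht
    have h1 : 0 ≤ ∫ ω, ∑ i ∈ A t ω, w i * u i ∂P :=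
      integral_nonneg fun ω => Finset.sum_nonneg fun i _ => mul_nonneg (hw i) (hu i).1
    have h2 : ∫ ω, ∑ i, pullProb m q (Z t ω) i * (w i * u i) ∂P ≤ ∫ _ω, (m * wmax : ℝ) ∂P := by
      refine integral_mono (h.integrable_sum_pullProb ht' _) (integrable_const _) fun ω => ?_
      calc ∑ i, pullProb m q (Z t ω) i * (w i * u i) ≤ ∑ i, pullProb m q (Z t ω) i * wmax := by
            refine Finset.sum_le_sum fun i _ => mul_le_mul_of_nonneg_left ?_
              (pullProb_nonneg hq _ _)
            exact (mul_le_of_le_one_right (hw i) (hu i).2).trans (hwmax i)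
        _ ≤ m * wmax := by
            rw [← Finset.sum_mul]
            exact mul_le_mul_of_nonneg_right (sum_pullProb_le hq _) hw0
    simp only [integral_const, probReal_univ, smul_eq_mul, one_mul] at h2
    linarith
  refine (Finset.sum_le_sum this).trans (le_of_eq ?_)
  simp

omit [IsProbabilityMeasure P] in
lemma integrable_queue_mul (hq : IsFeasiblePolicy PZ m k q) (ht : t < T) (i : Fin N) {g : Ω → ℝ}
    (hg : Integrable g P) : Integrable (fun ω => queue k (fun τ => A τ ω) i t * g ω) P := by
  refine hg.bdd_mul (c := t)
    ((h.measurable_queue i ht.le).mono (ℱ.le t) le_rfl).aestronglyMeasurable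
    (.of_forall fun ω => ?_)
  rw [Real.norm_of_nonneg (queue_nonneg _ _ _ _)]
  exact queue_le _ _ (k_le_one hq i) t

lemma integrable_loss (hq : IsFeasiblePolicy PZ m k q) (ht : t < T) :
    Integrable (fun ω => ∑ i, pullProb m q (Z t ω) i * trueIndex η k w u A t ω i -
        ∑ i ∈ A t ω, trueIndex η k w u A t ω i) P := by
  have e : ∀ ω, ∑ i, pullProb m q (Z t ω) i * trueIndex η k w u A t ω i -
        ∑ i ∈ A t ω, trueIndex η k w u A t ω i =
      ∑ i, (1 / η * (queue k (fun τ => A τ ω) i t *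
        (pullProb m q (Z t ω) i - if i ∈ A t ω then 1 else 0)) +
        w i * u i * (pullProb m q (Z t ω) i - if i ∈ A t ω then 1 else 0)) := by
    intro ω
    rw [← Finset.sum_ite_mem_eq (A t ω), ← Finset.sum_sub_distrib]
    refine Finset.sum_congr rfl fun i _ => ?_
    unfold trueIndex
    split_ifs <;> ring
  simp_rw [e]
  have hg : ∀ i, Integrable (fun ω => pullProb m q (Z t ω) i - if i ∈ A t ω then 1 else 0) P :=
    fun i => integrable_comp_discrete ((h.meas_Z ht).prodMk (h.meas_A ht))
      fun p => pullProb m q p.1 i - if i ∈ p.2 then 1 else 0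
  exact integrable_finsetSum _ fun i _ =>
    ((h.integrable_queue_mul hq ht i (hg i)).const_mul _).add ((hg i).const_mul _)

/-- Lyapunov drift: up to `N T / (2 η)`, the regret is the loss in terms of the true indices. The
queue terms that the indices contain besides the rewards telescope for the algorithm
(`sum_queue_mul_le`), and the stationary policy serves the queues on average
(`integral_queue_mul_le`). -/
lemma mul_regret_le_drift (hη : 0 < η) (hT : 0 < T) (hq : IsFeasiblePolicy PZ m k q) :
    T * regret P T w A X Astar ≤ N * T / (2 * η) + ∫ ω, ∑ t ∈ Finset.range T,
      (∑ i, pullProb m q (Z t ω) i * trueIndex η k w u A t ω i -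
        ∑ i ∈ A t ω, trueIndex η k w u A t ω i) ∂P := by
  set D : ℕ → Ω → ℝ := fun t ω => ∑ i, pullProb m q (Z t ω) i * trueIndex η k w u A t ω i -
        ∑ i ∈ A t ω, trueIndex η k w u A t ω i with hD
  have hDi : ∀ t ∈ Finset.range T, Integrable (D t) P := fun t ht =>
    h.integrable_loss hq (Finset.mem_range.1 ht)
  set F : ℕ → Ω → ℝ := fun t ω =>
    ∑ i, queue k (fun τ => A τ ω) i t * ((if i ∈ A t ω then 1 else 0) - k i) with hF
  set G : ℕ → Fin N → Ω → ℝ := fun t i ω =>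
    queue k (fun τ => A τ ω) i t * (k i - pullProb m q (Z t ω) i) with hG
  have hFi : ∀ t ∈ Finset.range T, Integrable (F t) P := fun t ht =>
    integrable_finsetSum _ fun i _ => h.integrable_queue_mul hq (Finset.mem_range.1 ht) i
      (integrable_comp_discrete (h.meas_A (Finset.mem_range.1 ht))
        fun S => (if i ∈ S then 1 else 0) - k i)
  have hGi : ∀ t ∈ Finset.range T, ∀ i, Integrable (G t i) P := fun t ht i =>
    h.integrable_queue_mul hq (Finset.mem_range.1 ht) i
      (integrable_comp_discrete (h.meas_Z (Finset.mem_range.1 ht))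
        fun S => k i - pullProb m q S i)
  have hone : ∀ t ∈ Finset.range T,
      ∫ ω, ∑ i, pullProb m q (Z t ω) i * (w i * u i) ∂P - ∫ ω, ∑ i ∈ A t ω, w i * u i ∂P ≤
      ∫ ω, D t ω ∂P + 1 / η * ∫ ω, F t ω ∂P := by
    intro t ht
    have ht' := Finset.mem_range.1 ht
    have e : ∀ ω, ∑ i, pullProb m q (Z t ω) i * (w i * u i) - ∑ i ∈ A t ω, w i * u i =
        (D t ω + 1 / η * F t ω) + 1 / η * ∑ i, G t i ω := by
      intro ω
      simp only [hD, hF, hG]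
      rw [← Finset.sum_ite_mem_eq (A t ω) fun i => w i * u i,
        ← Finset.sum_ite_mem_eq (A t ω) (trueIndex η k w u A t ω), ← Finset.sum_sub_distrib,
        ← Finset.sum_sub_distrib, Finset.mul_sum, Finset.mul_sum, ← Finset.sum_add_distrib,
        ← Finset.sum_add_distrib]
      refine Finset.sum_congr rfl fun i _ => ?_
      unfold trueIndex
      split_ifs <;> ring
    have hDF : Integrable (fun ω => D t ω + 1 / η * F t ω) P :=
      (hDi t ht).add ((hFi t ht).const_mul _)
    rw [← integral_sub (h.integrable_sum_pullProb ht' _) (h.integrable_sum_A ht' _),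
      integral_congr_ae (.of_forall e), integral_add hDF
        ((integrable_finsetSum _ fun i _ => hGi t ht i).const_mul _),
      integral_add (hDi t ht) ((hFi t ht).const_mul _), integral_const_mul, integral_const_mul,
      integral_finsetSum _ fun i _ => hGi t ht i]
    have : 1 / η * ∑ i, ∫ ω, G t i ω ∂P ≤ 0 :=
      mul_nonpos_of_nonneg_of_nonpos (by positivity)
        (Finset.sum_nonpos fun i _ => h.integral_queue_mul_le hq ht' i)
    linarith
  rw [h.mul_regret_eq hT, integral_finsetSum _ hDi]
  refine (Finset.sum_le_sum hone).trans ?_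
  rw [Finset.sum_add_distrib, ← Finset.mul_sum, ← integral_finsetSum _ hFi]
  have hdrift : ∫ ω, ∑ t ∈ Finset.range T, F t ω ∂P ≤ ∫ _ω, (N * T / 2 : ℝ) ∂P :=
    integral_mono (integrable_finsetSum _ hFi) (integrable_const _) fun ω =>
      sum_queue_mul_le (fun τ => A τ ω) (k_le_one hq) T
  simp only [integral_const, probReal_univ, smul_eq_mul, one_mul] at hdrift
  have := mul_le_mul_of_nonneg_left hdrift (show 0 ≤ 1 / η by positivity)
  have e : 1 / η * (N * T / 2 : ℝ) = N * T / (2 * η) := by field_simp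
  linarith

/-- The regret bound with the two resolutions `ε` and `ε'` for under- and overestimation. The
samples that count as exceptionally large have posterior probability at most `1 / T`, which costs
`N` in total. -/
lemma mul_regret_le_of_pos (hη : 0 < η) (hm : 0 < m) (hT : 0 < T)
    (hq : IsFeasiblePolicy PZ m k q) (hw : ∀ i, 0 ≤ w i)
    (hu : ∀ i, u i ∈ Icc (0 : ℝ) 1) {wmax : ℝ} (hwmax : ∀ i, w i ≤ wmax) (hw0 : 0 ≤ wmax)
    {ε ε' : ℝ} (hε : 0 < ε) (hε' : 0 < ε') :
    T * regret P T w A X Astar ≤ N * T / (2 * η) + wmax *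
      (m * T * ε + N * (3 / 4 * (1 + Real.log T) / ε) + m * T * ε' +
        N * (1 + Real.log T) / (16 * ε') +
        Real.sqrt (Real.log T / 2) * (2 * Real.sqrt (N * (m * T))) + N) := by
  have hT' : (0 : ℝ) < T := by exact_mod_cast hT
  have hlog : 0 ≤ Real.log T := Real.log_nonneg (by exact_mod_cast hT)
  set L := Real.log T with hL
  set a : ℕ → Ω → ℝ := fun t ω => ∑ i, (if i ∈ A t ω then
        overBound L ε' (u i) (succ A X i t ω) (fail A X i t ω) else 0) with ha
  have hai : ∀ t ∈ Finset.range T, Integrable (a t) P := fun t ht =>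
    integrable_finsetSum _ fun i _ =>
      h.integrable_ite_counts i (Finset.mem_range.1 ht) (overBound L ε' (u i))
  set Y : ℕ → Ω → ℝ := fun t ω => ∑ i, excess m η ε k w u Z θ A i t ω +
        ∑ i, wmax * (largeEvent L Z θ A X i t).indicator (fun _ => 1) ω with hY
  have hYle : ∫⁻ ω, ENNReal.ofReal (∑ t ∈ Finset.range T, Y t ω) ∂P ≤
      ENNReal.ofReal (wmax * (N * (3 / 4 * (1 + L) / ε)) + wmax * N) := by
    have hind : ∀ i t ω, 0 ≤ wmax * (largeEvent L Z θ A X i t).indicator (fun _ => 1) ω :=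
      fun i t ω => mul_nonneg hw0 (indicator_nonneg (fun _ _ => zero_le_one) _)
    have hex : ∀ i t ω, 0 ≤ excess m η ε k w u Z θ A i t ω := fun i t ω => excess_nonneg i t ω
    have e : ∀ ω, ENNReal.ofReal (∑ t ∈ Finset.range T, Y t ω) =
        ∑ t ∈ Finset.range T, (∑ i, ENNReal.ofReal (excess m η ε k w u Z θ A i t ω) +
          ∑ i, ENNReal.ofReal wmax * (largeEvent L Z θ A X i t).indicator (fun _ => 1) ω) := by
      intro ω
      rw [ENNReal.ofReal_sum_of_nonneg fun t _ => add_nonneg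
        (Finset.sum_nonneg fun i _ => hex i t ω) (Finset.sum_nonneg fun i _ => hind i t ω)]
      refine Finset.sum_congr rfl fun t _ => ?_
      rw [ENNReal.ofReal_add (Finset.sum_nonneg fun i _ => hex i t ω)
        (Finset.sum_nonneg fun i _ => hind i t ω),
        ENNReal.ofReal_sum_of_nonneg fun i _ => hex i t ω,
        ENNReal.ofReal_sum_of_nonneg fun i _ => hind i t ω]
      congr 1
      refine Finset.sum_congr rfl fun i _ => ?_
      rw [ENNReal.ofReal_mul hw0]
      congr 1
      by_cases hω : ω ∈ largeEvent L Z θ A X i t <;> simp [hω]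
    have hm1 : ∀ t ∈ Finset.range T, ∀ i, Measurable fun ω =>
        ENNReal.ofReal (excess m η ε k w u Z θ A i t ω) := fun t ht i =>
      (h.measurable_excess (Finset.mem_range.1 ht) i).ennreal_ofReal
    have hm2 : ∀ t ∈ Finset.range T, ∀ i, Measurable fun ω => ENNReal.ofReal wmax *
        (largeEvent L Z θ A X i t).indicator (fun _ => (1 : ℝ≥0∞)) ω := fun t ht i =>
      (measurable_const.indicator
        (h.measurableSet_largeEvent L (Finset.mem_range.1 ht) i)).const_mul _
    have hm3 : ∀ t ∈ Finset.range T, Measurable fun ω =>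
        ∑ i, ENNReal.ofReal (excess m η ε k w u Z θ A i t ω) +
          ∑ i, ENNReal.ofReal wmax * (largeEvent L Z θ A X i t).indicator (fun _ => 1) ω :=
      fun t ht => (Finset.measurable_fun_sum _ fun i _ => hm1 t ht i).add
        (Finset.measurable_fun_sum _ fun i _ => hm2 t ht i)
    simp_rw [e]
    rw [lintegral_finsetSum _ hm3]
    have hstep : ∀ t ∈ Finset.range T, ∫⁻ ω,
        (∑ i, ENNReal.ofReal (excess m η ε k w u Z θ A i t ω) +
          ∑ i, ENNReal.ofReal wmax * (largeEvent L Z θ A X i t).indicator (fun _ => 1) ω) ∂P ≤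
        ∑ i, ∫⁻ ω, ENNReal.ofReal (excess m η ε k w u Z θ A i t ω) ∂P +
          ENNReal.ofReal (wmax * N / T) := by
      intro t ht
      rw [lintegral_add_left (Finset.measurable_fun_sum _ fun i _ => hm1 t ht i),
        lintegral_finsetSum _ fun i _ => hm1 t ht i, lintegral_finsetSum _ fun i _ => hm2 t ht i]
      refine add_le_add le_rfl ?_
      calc _ ≤ ∑ _i : Fin N, ENNReal.ofReal (wmax / T) := by
            refine Finset.sum_le_sum fun i _ => ?_
            rw [lintegral_const_mul' _ _ ENNReal.ofReal_ne_top, lintegral_indicator_const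
              (h.measurableSet_largeEvent L (Finset.mem_range.1 ht) i), one_mul, div_eq_mul_inv,
              ENNReal.ofReal_mul hw0]
            refine mul_le_mul_right ((h.measure_largeEvent_le hlog
              (Finset.mem_range.1 ht) i).trans (le_of_eq ?_)) _
            rw [Real.exp_neg, hL, Real.exp_log hT']
        _ = _ := by
            rw [Finset.sum_const, Finset.card_univ, Fintype.card_fin, ← ENNReal.ofReal_nsmul,
              nsmul_eq_mul]
            congr 1; ring
    refine (Finset.sum_le_sum hstep).trans ?_
    rw [Finset.sum_add_distrib, Finset.sum_comm, ENNReal.ofReal_add (by positivity) (by positivity)]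
    refine add_le_add ?_ (le_of_eq ?_)
    · calc _ ≤ ∑ _i : Fin N, ENNReal.ofReal (wmax * (3 / 4 * (1 + L) / ε)) := by
            refine Finset.sum_le_sum fun i _ =>
              (h.sum_lintegral_excess_le hm hT i (hw i) (hu i).2 hε).trans ?_
            exact ENNReal.ofReal_le_ofReal
              (mul_le_mul_of_nonneg_right (hwmax i) (by positivity))
        _ = _ := by
            rw [Finset.sum_const, Finset.card_univ, Fintype.card_fin, ← ENNReal.ofReal_nsmul,
              nsmul_eq_mul]
            congr 1; ring
    · rw [Finset.sum_const, Finset.card_range, ← ENNReal.ofReal_nsmul, nsmul_eq_mul]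
      congr 1; field_simp
  have hae : ∀ᵐ ω ∂P, ∀ t : Fin T, ∀ i ∈ Z t ω, θ t ω i ∈ Ioo (0 : ℝ) 1 :=
    ae_all_iff.2 fun t => h.ae_sample_mem_Ioo t.2
  have hmain := integral_le_add_of_lintegral_le
    (D := fun ω => ∑ t ∈ Finset.range T,
      (∑ i, pullProb m q (Z t ω) i * trueIndex η k w u A t ω i -
        ∑ i ∈ A t ω, trueIndex η k w u A t ω i))
    (a := fun ω => ∑ t ∈ Finset.range T, wmax * (m * ε + a t ω))
    (Y := fun ω => ∑ t ∈ Finset.range T, Y t ω)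
    (integrable_finsetSum _ fun t ht => h.integrable_loss hq (Finset.mem_range.1 ht))
    (integrable_finsetSum _ fun t ht => ((integrable_const _).add (hai t ht)).const_mul _)
    (y := wmax * (N * (3 / 4 * (1 + L) / ε)) + wmax * N) (by positivity) (by
      filter_upwards [hae] with ω hω
      rw [← Finset.sum_add_distrib]
      refine Finset.sum_le_sum fun t ht => ?_
      have ht' := Finset.mem_range.1 ht
      exact h.loss_le hη hq hw hu hwmax hw0 hε hε' ht' (hω ⟨t, ht'⟩)) hYle
  have hsum : ∫ ω, ∑ t ∈ Finset.range T, wmax * (m * ε + a t ω) ∂P ≤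
      wmax * (m * T * ε + (Real.sqrt (L / 2) * (2 * Real.sqrt (N * (m * T))) + m * T * ε' +
        N * (1 + L) / (16 * ε'))) := by
    have hi : ∀ t ∈ Finset.range T, Integrable (fun ω => wmax * (m * ε + a t ω)) P :=
      fun t ht => ((integrable_const _).add (hai t ht)).const_mul _
    rw [integral_finsetSum _ hi]
    have : ∀ t ∈ Finset.range T, ∫ ω, wmax * (m * ε + a t ω) ∂P =
        wmax * (m * ε + ∫ ω, a t ω ∂P) := by
      intro t ht
      rw [integral_const_mul, integral_add (integrable_const _) (hai t ht)]
      simp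
    rw [Finset.sum_congr rfl this, ← Finset.mul_sum, Finset.sum_add_distrib]
    refine mul_le_mul_of_nonneg_left (add_le_add (le_of_eq ?_) ?_) hw0
    · simp; ring
    · exact h.sum_integral_overBound_le hT hε'
  have hdrift := h.mul_regret_le_drift hη hT hq
  refine (hdrift.trans (add_le_add_right (hmain.trans (add_le_add_left hsum _)) _)).trans
    (le_of_eq ?_)
  ring

end IsRun

end Probability

/-- The hypothesis `log T < 4` means `T < exp 4 < 55`. -/
lemma le_sixteen_mul_log {T : ℝ} (h2 : 2 ≤ T) (h4 : Real.log T < 4) : T ≤ 16 * Real.log T := by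
  have hT0 : 0 < T := by linarith
  have hl2 := Real.log_two_gt_d9
  have hT55 : T < 55 := by
    have h1 : T < Real.exp 4 := by rwa [← Real.log_lt_iff_lt_exp hT0]
    have h2 : Real.exp 4 = Real.exp 1 ^ 4 := by rw [← Real.exp_nat_mul]; norm_num
    have h3 : Real.exp 1 ^ 4 ≤ 2.7182818286 ^ 4 :=
      pow_le_pow_left₀ (Real.exp_pos 1).le Real.exp_one_lt_d9.le 4
    norm_num at h3
    linarith
  have hpow : ∀ j : ℕ, (2 : ℝ) ^ j ≤ T → j * Real.log 2 ≤ Real.log T := fun j hj => by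
    rw [← Real.log_pow]; exact Real.log_le_log (by positivity) hj
  -- on `[2, 11]`, `(11, 33]` and `(33, 55)`, `log T` is at least `log 2`, `3 log 2` and `5 log 2`
  rcases le_or_gt T 11 with h11 | h11
  · have := hpow 1 (by linarith)
    push_cast at this; linarith
  rcases le_or_gt T 33 with h33 | h33
  · have := hpow 3 (by linarith)
    push_cast at this; linarith
  · have := hpow 5 (by linarith)
    push_cast at this; linarith

end CSMABF

end

theorem theorem2 {N : ℕ} (m T : ℕ) (hm : 0 < m) (hmN : m ≤ N) (hT : 1 < T)
    (η : ℝ) (hη : 0 < η)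
    (PZ : PMF (Finset (Fin N))) (k w u : Fin N → ℝ)
    (hw : ∀ i, 0 ≤ w i) (hu : ∀ i, u i ∈ Set.Icc (0 : ℝ) 1)
    (wmax : ℝ) (hwmax : IsGreatest (Set.range w) wmax) (hwpos : 0 < wmax)
    (q : Finset (Fin N) → Finset (Fin N) → ℝ)
    (hq : CSMABF.IsOptimalPolicy PZ m k w u q)
    {Ω : Type*} [mΩ : MeasurableSpace Ω] (P : Measure Ω) [IsProbabilityMeasure P]
    (ℱ : Filtration ℕ mΩ)
    (Z : ℕ → Ω → Finset (Fin N)) (θ : ℕ → Ω → Fin N → ℝ) (A : ℕ → Ω → Finset (Fin N))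
    (X : ℕ → Ω → Fin N → Bool) (Astar : ℕ → Ω → Finset (Fin N))
    (hrun : CSMABF.IsRun P ℱ T m η PZ k w u q Z θ A X Astar) :
    CSMABF.regret P T w A X Astar ≤
      (N : ℝ) / (2 * η) +
        (4 * wmax * Real.sqrt ((m : ℝ) * N * T * Real.log T) + 2.51 * wmax * N) / T := by
  have hT0 : (0 : ℝ) < T := by exact_mod_cast (zero_lt_one.trans hT)
  have hm0 : (0 : ℝ) < m := by exact_mod_cast hm
  have hN0 : (0 : ℝ) < N := by exact_mod_cast hm.trans_le hmN
  have hT2 : (2 : ℝ) ≤ T := by exact_mod_cast hT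
  have hmN' : (m : ℝ) ≤ N := by exact_mod_cast hmN
  have hle : ∀ i, w i ≤ wmax := fun i => hwmax.2 ⟨i, rfl⟩
  set L := Real.log T with hL
  have hL0 : 0 < L := Real.log_pos (by linarith)
  set Λ := Real.sqrt ((m : ℝ) * N * T * L) with hΛ
  have hΛ0 : 0 ≤ Λ := Real.sqrt_nonneg _
  suffices hmain : T * CSMABF.regret P T w A X Astar ≤
      N * T / (2 * η) + (4 * wmax * Λ + 2.51 * wmax * N) by
    have e : (N : ℝ) / (2 * η) + (4 * wmax * Λ + 2.51 * wmax * N) / T =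
        (N * T / (2 * η) + (4 * wmax * Λ + 2.51 * wmax * N)) / T := by
      field_simp
    rw [e, le_div_iff₀ hT0, mul_comm]
    exact hmain
  have hdriftpos : 0 ≤ (N : ℝ) * T / (2 * η) := by positivity
  rcases lt_or_ge L 4 with h4 | h4
  · -- few rounds: the trivial bound `m * wmax` per round is below `4 * wmax * Λ`
    have htriv := hrun.mul_regret_le (by omega) hq.1 hw hu hle hwpos.le
    have h16 := CSMABF.le_sixteen_mul_log hT2 h4
    have hmT : m * T ≤ 4 * Λ := by
      have : (m * T / 4 : ℝ) ≤ Λ := by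
        refine Real.le_sqrt_of_sq_le ?_
        have h1 : (m : ℝ) * T ≤ N * (16 * L) := by gcongr
        calc (m * T / 4 : ℝ) ^ 2 = m * T * (m * T) / 16 := by ring
          _ ≤ m * T * (N * (16 * L)) / 16 := by gcongr
          _ = _ := by ring
      linarith
    have h1 := mul_le_mul_of_nonneg_left hmT hwpos.le
    have h2 : 0 ≤ 2.51 * wmax * N := by positivity
    linarith
  · -- The resolutions that balance the terms are proportional to `√(N (1 + log T) / (m T))`. As
    -- `log T ≥ 4`, the quantity `r` is at most `1.12 * Λ`, and the coefficients add up to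
    -- `(7 / 8 + 6 / 7 + 1 / 4 + 1 / 4) * 1.12 + √2 < 4`.
    set r := Real.sqrt ((m : ℝ) * T * (N * (1 + L))) with hr
    have hr0 : 0 < r := Real.sqrt_pos.2 (by positivity)
    have hr2 : r ^ 2 = (m : ℝ) * T * (N * (1 + L)) := Real.sq_sqrt (by positivity)
    have hmT : (0 : ℝ) < m * T := by positivity
    have hbound := hrun.mul_regret_le_of_pos hη hm (by omega) hq.1 hw hu hle hwpos.le
      (ε := 7 / 8 * (r / (m * T))) (ε' := 1 / 4 * (r / (m * T))) (by positivity) (by positivity)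
    rw [← hL] at hbound
    have hNL : (N : ℝ) * (1 + L) = r * (r / (m * T)) := by
      rw [← mul_div_assoc, ← sq, hr2]; field_simp
    have e1 : (m : ℝ) * T * (7 / 8 * (r / (m * T))) = 7 / 8 * r := by field_simp
    have e2 : (N : ℝ) * (3 / 4 * (1 + L) / (7 / 8 * (r / (m * T)))) = 6 / 7 * r := by
      calc (N : ℝ) * (3 / 4 * (1 + L) / (7 / 8 * (r / (m * T))))
          = (N * (1 + L)) * (6 / 7) / (r / (m * T)) := by field_simp; ring
        _ = _ := by rw [hNL]; field_simp
    have e3 : (m : ℝ) * T * (1 / 4 * (r / (m * T))) = 1 / 4 * r := by field_simp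
    have e4 : (N : ℝ) * (1 + L) / (16 * (1 / 4 * (r / (m * T)))) = 1 / 4 * r := by
      rw [hNL]; field_simp; ring
    have e5 : Real.sqrt (L / 2) * (2 * Real.sqrt (N * (m * T))) = Real.sqrt 2 * Λ := by
      have h2 : (2 : ℝ) = Real.sqrt 2 * Real.sqrt 2 := (Real.mul_self_sqrt (by norm_num)).symm
      have h3 : Real.sqrt (L / 2) * Real.sqrt 2 = Real.sqrt L := by
        rw [← Real.sqrt_mul (by positivity)]; congr 1; ring
      have h4 : Λ = Real.sqrt L * Real.sqrt (N * (m * T)) := by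
        rw [hΛ, ← Real.sqrt_mul hL0.le]; congr 1; ring
      rw [h4]
      calc Real.sqrt (L / 2) * (2 * Real.sqrt (N * (m * T)))
          = Real.sqrt (L / 2) * ((Real.sqrt 2 * Real.sqrt 2) * Real.sqrt (N * (m * T))) := by
            rw [← h2]
        _ = Real.sqrt 2 * ((Real.sqrt (L / 2) * Real.sqrt 2) * Real.sqrt (N * (m * T))) := by ring
        _ = _ := by rw [h3]
    rw [e1, e2, e3, e4, e5] at hbound
    have hrΛ : r ≤ 1.12 * Λ := by
      refine Real.sqrt_le_iff.2 ⟨by positivity, ?_⟩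
      rw [mul_pow, hΛ, Real.sq_sqrt (by positivity)]
      have h1 : 1 + L ≤ 1.12 ^ 2 * L := by norm_num; linarith
      calc (m : ℝ) * T * (N * (1 + L)) ≤ m * T * (N * (1.12 ^ 2 * L)) := by gcongr
        _ = _ := by ring
    have hs2 : Real.sqrt 2 ≤ 1.42 := Real.sqrt_le_iff.2 ⟨by norm_num, by norm_num⟩
    have hs2Λ := mul_le_mul_of_nonneg_right hs2 hΛ0
    have htotal : 7 / 8 * r + 6 / 7 * r + 1 / 4 * r + 1 / 4 * r + Real.sqrt 2 * Λ + N ≤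
        4 * Λ + 2.51 * N := by
      norm_num at hrΛ hs2Λ ⊢
      linarith
    have := mul_le_mul_of_nonneg_left htotal hwpos.le
    linarith
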